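/- Let $\mathcal X=\prod_{i=1}^n\mathcal X_i$ and $\mathcal Y=\prod_{j=1}^m\mathcal Y_j$ be products of Euclidean spaces, and let $A\colon\mathcal X\to\mathcal Y$ be linear with blocks $A_{j,i}\colon\mathcal X_i\to\mathcal Y_j$, $J(i)=\{j: A_{j,i}\ne0\}$, $I(j)=\{i: A_{j,i}\neq 0\}$ (so $|A_{j,i}|=\|A_{j,i}\|$ is the absolute value when the blocks are one-dimensional). For a nonnegative diagonal weight $w$ write $\|x\|_w^2=\sum_i w_i\|x^i\|^2$. Consider $\min_x f(x)+g(x)+h(Ax)$ under the following assumptions: $f\colon\mathcal X\to\mathbb R$ is convex and differentiable with $f(x+U_i(u))\le f(x)+\langle\nabla_i f(x),u\rangle+\frac{\beta_i}{2}\|u\|^2$ for all $x\in\mathcal X$, all $i$ and all $u\in\mathcal X_i$, where $\beta_i\ge0$ and $U_i(u)$ is the vector with block $i$ equal to $u$ and the other blocks zero; $g(x)=\sum_i g_i(x^i)$ and $h(y)=\sum_j h_j(y^j)$ are separable, proper, lower semicontinuous and convex with values in $\mathbb R\cup\{+\infty\}$; the set $\mathcal Z_\star$ of pairs $(x_\star,y_\star)$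 with $0\in\nabla f(x_\star)+\partial g(x_\star)+A^\top y_\star$ and $0\in Ax_\star-\partial h^*(y_\star)$ is nonempty; and $0\in\mathrm{ri}(\mathrm{dom}\,h-A\,\mathrm{dom}\,g)$. Let $p_i>0$ with $\sum_i p_i=1$, $\underline p=\min_i p_i$, $P=\mathrm{diag}(p_i)$, $\pi_j=\sum_{i\in I(j)}p_i$, $\theta_j=\pi_j/\underline p>0$, $\sigma_j>0$, and let $\tau_i>0$ satisfy $$\tau_i<\frac{2p_i-\underline p}{\beta_ip_i+\underline p^{-1}p_i\sum_{j=1}^m\pi_j\sigma_j\|A_{j,i}\|^2}$$ (no upper bound if the denominator is $0$). Starting from $x_0\in\mathrm{dom}\,g$ and $y_0=\breve y_0\in\mathrm{dom}\,h^*$, with independent indices $i_1,i_2,\dots$ such that $\mathbb P(i_{k+1}=i)=p_i$, let for $k\ge 0$ $$\bar y_{k+1}=\mathrm{prox}_{\sigma,h^*}(y_k+\sigma Ax_k),\qquad \bar x_{k+1}=\mathrm{prox}_{\tau,g}\bigl(x_k-\tau(\nabla f(x_k)+A^\top\bar y_{k+1})\bigr),$$ where $\mathrm{prox}_{V,\varphi}(v)=\arg\min_u\varphi(u)+\frac12\|u-v\|^2_{V^{-1}}$,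 let $x_{k+1}^{i_{k+1}}=\bar x_{k+1}^{i_{k+1}}$ and $x_{k+1}^{i}=x_k^{i}$ for $i\ne i_{k+1}$, let $y_{k+1}^j=\bar y_{k+1}^j+\sigma_j\theta_j(A(x_{k+1}-x_k))_j$ and $\breve y_{k+1}^j=\bar y_{k+1}^j$ for $j\in J(i_{k+1})$, and $y_{k+1}^j=y_k^j$, $\breve y_{k+1}^j=\breve y_k^j$ for $j\notin J(i_{k+1})$. Put $x_K^{av}=\frac1K\sum_{k=1}^Kx_k$ and $y_K^{av}=\frac1K\sum_{k=1}^K\breve y_k$. Then for every $K\ge1$, every bounded set $\mathcal C=\mathcal C_x\times\mathcal C_y\subset\mathcal X\times\mathcal Y$ and every $(x_\star,y_\star)\in\mathcal Z_\star$, the restricted gap $$G_{\mathcal C}(\bar x,\bar y)=\sup_{(x,y)\in\mathcal C} f(\bar x)+g(\bar x)+\langle A\bar x,y\rangle-h^*(y)-f(x)-g(x)-\langle Ax,\bar y\rangle+h^*(\bar y)$$ (with values in $[-\infty,+\infty]$) is such that $G_{\mathcal C}(x_K^{av},y_K^{av})$ is measurable, its positive part has finite expectation, and $$\mathbb E\bigl[G_{\mathcal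 C}(x_K^{av},y_K^{av})\bigr]\le\frac{C_g}{\underline pK}.$$ Here $C_g=C_{g,1}+(C_{g,2}+C_{g,3}+C_{g,4})$ with $$C_{g,1}=\sup_{(x,y)\in\mathcal C}\bigl\{2\underline p\|x_0-x\|^2_{\tau^{-1}P^{-1}}+2\underline p\|y_0-y\|^2_{\sigma^{-1}\pi^{-1}}\bigr\}+4\sqrt{\Delta_0\underline p^{-1}}\sup_{y\in\mathcal C_y}\|A^\top y\|_{\tau P}+\sqrt{\Delta_0\bigl(\underline p^{-1}+2\underline p^{-2}C_{\tau,\tilde V}^{-1}\bigr)}\sup_{x\in\mathcal C_x}\|Ax\|_{\sigma\pi},$$ $$\sum_{l=2}^4C_{g,l}=\Delta_0\bigl(5+9\underline p^{-1}+C_{\tau,\tilde V}^{-1}(1+10\underline p^{-1}+8\underline p^{-2})\bigr)+(1-\underline p)\bigl(f(x_0)+g(x_0)-f(x_\star)-g(x_\star)\bigr)+h^*(y_0)-h^*(y_\star)+\underline p\|Ax_\star\|_{\sigma\pi^{-1}}+\|A^\top y_\star\|^2_{\tau P},$$ where $$\Delta_0=f(x_0)+g(x_0)-f(x_\star)-g(x_\star)+\langle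 A^\top y_\star,x_0-x_\star\rangle+\tfrac{\underline p}{2}\|x_0-x_\star\|^2_{\tau^{-1}P^{-1}}+\tfrac{\underline p}{2}\|y_0-y_\star\|^2_{\sigma^{-1}\pi^{-1}},$$ $$C_{\tau,\tilde V}=\min_iC(\tau)_i\tau_i,\qquad C(\tau)_i=\frac{2p_i}{\underline p\tau_i}-\frac1{\tau_i}-p_i\sum_{j=1}^m\pi_j^{-1}\sigma_j\theta_j^2\|A_{j,i}\|^2-\frac{\beta_ip_i}{\underline p}.$$ -/

import Mathlib

namespace PureCD

open MeasureTheory ProbabilityTheory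
open scoped RealInnerProductSpace

noncomputable section

/-! ### Block Euclidean spaces and convex analysis with values in `ℝ ∪ {+∞}` -/

/-- The Euclidean product of the blocks `ℝ^{d 0}, …, ℝ^{d (n-1)}`. -/
abbrev Blk {n : ℕ} (d : Fin n → ℕ) : Type :=
  PiLp 2 (fun i : Fin n => EuclideanSpace ℝ (Fin (d i)))

/-- `‖x‖²_w = ∑ i, w i * ‖x i‖²` for a diagonal weight `w`. -/
def wsq {n : ℕ} {d : Fin n → ℕ} (w : Fin n → ℝ) (x : Blk d) : ℝ :=
  ∑ i, w i * ‖x i‖ ^ 2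

/-- `‖x‖_w`. -/
def wnorm {n : ℕ} {d : Fin n → ℕ} (w : Fin n → ℝ) (x : Blk d) : ℝ :=
  Real.sqrt (wsq w x)

/-- Effective domain. -/
def dom {E : Type*} (φ : E → EReal) : Set E := {x | φ x ≠ ⊤}

/-- Proper, lower semicontinuous, convex (convexity of the epigraph). -/
structure ProperLscConvex {E : Type*} [NormedAddCommGroup E] [NormedSpace ℝ E]
    (φ : E → EReal) : Prop where
  ne_bot : ∀ x, φ x ≠ ⊥
  dom_nonempty : (dom φ).Nonempty
  lsc : LowerSemicontinuous φ
  convex : Convex ℝ {z : E × ℝ | φ z.1 ≤ (z.2 : EReal)}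

/-- Fenchel conjugate. -/
def conj {E : Type*} [NormedAddCommGroup E] [InnerProductSpace ℝ E]
    (φ : E → EReal) (y : E) : EReal :=
  ⨆ u : E, ((⟪u, y⟫ : ℝ) : EReal) - φ u

/-- Convex subdifferential. -/
def subdiff {E : Type*} [NormedAddCommGroup E] [InnerProductSpace ℝ E]
    (φ : E → EReal) (x : E) : Set E :=
  {v | φ x ≠ ⊤ ∧ ∀ u, φ x + ((⟪v, u - x⟫ : ℝ) : EReal) ≤ φ u}

/-- `u = prox_{V, φ}(v)`, that is, `u` minimizes `φ w + (1/2) ‖w - v‖²_{V⁻¹}` over `w`. -/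
def IsProx {n : ℕ} {d : Fin n → ℕ} (V : Fin n → ℝ) (φ : Blk d → EReal) (v u : Blk d) : Prop :=
  ∀ w, φ u + ((1 / 2 * wsq (fun i => (V i)⁻¹) (u - v) : ℝ) : EReal)
    ≤ φ w + ((1 / 2 * wsq (fun i => (V i)⁻¹) (w - v) : ℝ) : EReal)

/-! ### Problem data -/

/-- The data of `min_x f x + g x + h (A x)` with `g`, `h` block separable, the coordinatewise
smoothness constants `β`, the sampling probabilities `p` and the step sizes `τ`, `σ`. -/
structure Data {n m : ℕ} (d : Fin n → ℕ) (e : Fin m → ℕ) where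
  f : Blk d → ℝ
  g : ∀ i : Fin n, EuclideanSpace ℝ (Fin (d i)) → EReal
  h : ∀ j : Fin m, EuclideanSpace ℝ (Fin (e j)) → EReal
  A : ∀ (j : Fin m) (i : Fin n), EuclideanSpace ℝ (Fin (d i)) →L[ℝ] EuclideanSpace ℝ (Fin (e j))
  β : Fin n → ℝ
  p : Fin n → ℝ
  τ : Fin n → ℝ
  σ : Fin m → ℝ

namespace Data

variable {n m : ℕ} {d : Fin n → ℕ} {e : Fin m → ℕ} (D : Data d e)

/-- `g x = ∑ i, g i (x i)`. -/
def gSum (x : Blk d) : EReal := ∑ i, D.g i (x i)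

/-- `h y = ∑ j, h j (y j)`. -/
def hSum (y : Blk e) : EReal := ∑ j, D.h j (y j)

/-- `h^*`. -/
def hConj (y : Blk e) : EReal := conj D.hSum y

/-- `A x`. -/
def mulA (x : Blk d) : Blk e := WithLp.toLp 2 (fun j => ∑ i, D.A j i (x i))

/-- `Aᵀ y`. -/
def mulAT (y : Blk e) : Blk d :=
  WithLp.toLp 2 (fun i => ∑ j, ContinuousLinearMap.adjoint (D.A j i) (y j))

/-- The smallest probability. -/
def pmin : ℝ := ⨅ i, D.p i

open Classical in
/-- `J i`: the block rows that are nonzero in the block column `i`. -/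
def J (i : Fin n) : Finset (Fin m) := Finset.univ.filter (fun j => D.A j i ≠ 0)

open Classical in
/-- `I j`: the block columns that are nonzero in the block row `j`. -/
def I (j : Fin m) : Finset (Fin n) := Finset.univ.filter (fun i => D.A j i ≠ 0)

/-- `π_j = ∑_{i ∈ I j} p_i`. -/
def pr (j : Fin m) : ℝ := ∑ i ∈ D.I j, D.p i

/-- `θ_j = π_j / pmin`. -/
def θ (j : Fin m) : ℝ := D.pr j / D.pmin

/-- `C(τ)_i`. -/
def Cτ (i : Fin n) : ℝ :=
  2 * D.p i / (D.pmin * D.τ i) - 1 / D.τ i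
    - D.p i * ∑ j, (D.pr j)⁻¹ * D.σ j * D.θ j ^ 2 * ‖D.A j i‖ ^ 2
    - D.β i * D.p i / D.pmin

/-- `C_{τ,Ṽ} = min_i C(τ)_i τ_i`. -/
def CτV : ℝ := ⨅ i, D.Cτ i * D.τ i

/-- `V(x, y)`. -/
def V (x : Blk d) (y : Blk e) : ℝ :=
  D.pmin / 2 * wsq (fun i => (D.τ i)⁻¹ * (D.p i)⁻¹) x
    + D.pmin / 2 * wsq (fun j => (D.σ j)⁻¹ * (D.pr j)⁻¹) y

/-- Primal-dual solutions: `0 ∈ ∇f x + ∂g x + Aᵀ y` and `0 ∈ A x - ∂h^* y`. -/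
def IsSolution (x : Blk d) (y : Blk e) : Prop :=
  -(gradient D.f x + D.mulAT y) ∈ subdiff D.gSum x ∧ D.mulA x ∈ subdiff D.hConj y

/-- The assumptions on the functions. -/
structure Assumptions : Prop where
  f_convex : ConvexOn ℝ Set.univ D.f
  f_diff : Differentiable ℝ D.f
  β_nonneg : ∀ i, 0 ≤ D.β i
  /-- coordinatewise Lipschitz gradients -/
  f_smooth : ∀ (x : Blk d) (i : Fin n) (u : EuclideanSpace ℝ (Fin (d i))),
    D.f (x + PiLp.single 2 i u) ≤ D.f x + ⟪gradient D.f x i, u⟫ + D.β i / 2 * ‖u‖ ^ 2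
  g_plc : ∀ i, ProperLscConvex (D.g i)
  h_plc : ∀ j, ProperLscConvex (D.h j)
  solution : ∃ x y, D.IsSolution x y
  /-- Slater's condition `0 ∈ ri (dom h - A dom g)` -/
  slater : (0 : Blk e) ∈
    intrinsicInterior ℝ {w | ∃ u ∈ dom D.hSum, ∃ x ∈ dom D.gSum, w = u - D.mulA x}

/-- Admissible probabilities and step sizes. The step size rule is written without a division,
so that it puts no upper bound on `τ i` when `β i = 0` and the block column `i` vanishes. -/
structure Parameters : Prop where
  p_pos : ∀ i, 0 < D.p i
  p_sum : ∑ i, D.p i = 1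
  τ_pos : ∀ i, 0 < D.τ i
  σ_pos : ∀ j, 0 < D.σ j
  θ_pos : ∀ j, 0 < D.θ j
  step : ∀ i, D.τ i * (D.β i * D.p i
      + D.pmin⁻¹ * D.p i * ∑ j, D.pr j * D.σ j * ‖D.A j i‖ ^ 2) < 2 * D.p i - D.pmin

/-! ### The algorithm -/

/-- The sequences generated by the algorithm from `(x₀, y₀)` when `ι k` (the paper's `i_{k+1}`)
is the index drawn at iteration `k`, with the auxiliary dual sequence `yb`, started at `y₀`. -/
structure IsRun {Ω : Type*} (x₀ : Blk d) (y₀ : Blk e) (ι : ℕ → Ω → Fin n)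
    (x xbar : ℕ → Ω → Blk d) (y ybar yb : ℕ → Ω → Blk e) : Prop where
  x_zero : ∀ ω, x 0 ω = x₀
  y_zero : ∀ ω, y 0 ω = y₀
  yb_zero : ∀ ω, yb 0 ω = y₀
  ybar_succ : ∀ k ω, IsProx D.σ D.hConj
    (y k ω + WithLp.toLp 2 (fun j => D.σ j • D.mulA (x k ω) j)) (ybar (k + 1) ω)
  xbar_succ : ∀ k ω, IsProx D.τ D.gSum
    (x k ω - WithLp.toLp 2
      (fun i => D.τ i • (gradient D.f (x k ω) + D.mulAT (ybar (k + 1) ω)) i)) (xbar (k + 1) ω)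
  x_upd : ∀ k ω, x (k + 1) ω (ι k ω) = xbar (k + 1) ω (ι k ω)
  x_keep : ∀ k ω, ∀ i, i ≠ ι k ω → x (k + 1) ω i = x k ω i
  y_upd : ∀ k ω, ∀ j ∈ D.J (ι k ω), y (k + 1) ω j =
    ybar (k + 1) ω j + (D.σ j * D.θ j) • D.mulA (x (k + 1) ω - x k ω) j
  y_keep : ∀ k ω, ∀ j ∉ D.J (ι k ω), y (k + 1) ω j = y k ω j
  yb_upd : ∀ k ω, ∀ j ∈ D.J (ι k ω), yb (k + 1) ω j = ybar (k + 1) ω j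
  yb_keep : ∀ k ω, ∀ j ∉ D.J (ι k ω), yb (k + 1) ω j = yb k ω j

/-- Independent draws `ι k` with `ℙ(ι k = i) = p i`. -/
structure IsSampling {Ω : Type*} [MeasurableSpace Ω] (μ : Measure Ω) (ι : ℕ → Ω → Fin n) :
    Prop where
  meas : ∀ k, Measurable (ι k)
  indep : iIndepFun ι μ
  law : ∀ k i, μ {ω | ι k ω = i} = ENNReal.ofReal (D.p i)

/-! ### The gap and the constants -/

/-- The restricted primal-dual gap `G_{Cx × Cy}(xb, yb)`, with values in `[-∞, +∞]`. -/
def gap (Cx : Set (Blk d)) (Cy : Set (Blk e)) (xb : Blk d) (yb : Blk e) : EReal :=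
  ⨆ x ∈ Cx, ⨆ y ∈ Cy,
    ((D.f xb : EReal) + D.gSum xb + ((⟪D.mulA xb, y⟫ : ℝ) : EReal) - D.hConj y
      - (D.f x : EReal) - D.gSum x - ((⟪D.mulA x, yb⟫ : ℝ) : EReal) + D.hConj yb)

/-- `f + g` as a real number (used on the domain of `g`). -/
def F (x : Blk d) : ℝ := D.f x + (D.gSum x).toReal

/-- `Δ₀ = D_p(x₀; z⋆) + V(z₀ - z⋆)`. -/
def Δ₀ (x₀ xs : Blk d) (y₀ ys : Blk e) : ℝ :=
  D.F x₀ - D.F xs + ⟪D.mulAT ys, x₀ - xs⟫ + D.V (x₀ - xs) (y₀ - ys)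

/-- `C_{g,1}`, the part of the constant that depends on the set `Cx × Cy`. -/
def Cg₁ (x₀ xs : Blk d) (y₀ ys : Blk e) (Cx : Set (Blk d)) (Cy : Set (Blk e)) : ℝ :=
  sSup ((fun z : Blk d × Blk e =>
      2 * D.pmin * wsq (fun i => (D.τ i)⁻¹ * (D.p i)⁻¹) (x₀ - z.1)
        + 2 * D.pmin * wsq (fun j => (D.σ j)⁻¹ * (D.pr j)⁻¹) (y₀ - z.2)) '' (Cx ×ˢ Cy))
    + 4 * Real.sqrt (D.Δ₀ x₀ xs y₀ ys * D.pmin⁻¹)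
        * sSup ((fun y => wnorm (fun i => D.τ i * D.p i) (D.mulAT y)) '' Cy)
    + Real.sqrt (D.Δ₀ x₀ xs y₀ ys * (D.pmin⁻¹ + 2 * (D.pmin ^ 2)⁻¹ * D.CτV⁻¹))
        * sSup ((fun x => wnorm (fun j => D.σ j * D.pr j) (D.mulA x)) '' Cx)

/-- `C_{g,2} + C_{g,3} + C_{g,4}`. -/
def Cg₂₃₄ (x₀ xs : Blk d) (y₀ ys : Blk e) : ℝ :=
  D.Δ₀ x₀ xs y₀ ys * (5 + 9 * D.pmin⁻¹
      + D.CτV⁻¹ * (1 + 10 * D.pmin⁻¹ + 8 * (D.pmin ^ 2)⁻¹))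
    + (1 - D.pmin) * (D.F x₀ - D.F xs)
    + ((D.hConj y₀).toReal - (D.hConj ys).toReal)
    + D.pmin * wnorm (fun j => D.σ j * (D.pr j)⁻¹) (D.mulA xs)
    + wsq (fun i => D.τ i * D.p i) (D.mulAT ys)

/-- `C_g`. -/
def Cg (x₀ xs : Blk d) (y₀ ys : Blk e) (Cx : Set (Blk d)) (Cy : Set (Blk e)) : ℝ :=
  D.Cg₁ x₀ xs y₀ ys Cx Cy + D.Cg₂₃₄ x₀ xs y₀ ys

end Data

/-- `(1/K) ∑_{k=1}^K u_k`. -/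
def average {E : Type*} [AddCommGroup E] [Module ℝ E] {Ω : Type*}
    (u : ℕ → Ω → E) (K : ℕ) (ω : Ω) : E :=
  (K : ℝ)⁻¹ • ∑ k ∈ Finset.Icc 1 K, u k ω

/-- `𝔼[G⁺]`. -/
def expPos {Ω : Type*} [MeasurableSpace Ω] (μ : Measure Ω) (G : Ω → EReal) : ENNReal :=
  ∫⁻ ω, (G ω).toENNReal ∂μ

/-- `𝔼[G⁻]`. -/
def expNeg {Ω : Type*} [MeasurableSpace Ω] (μ : Measure Ω) (G : Ω → EReal) : ENNReal :=
  ∫⁻ ω, (-(G ω)).toENNReal ∂μ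

/-- Expectation of an extended real random variable, `𝔼[G] = 𝔼[G⁺] - 𝔼[G⁻]`
(meaningful when one of the two is finite). -/
def expectation {Ω : Type*} [MeasurableSpace Ω] (μ : Measure Ω) (G : Ω → EReal) : EReal :=
  (expPos μ G : EReal) - (expNeg μ G : EReal)

end

end PureCD

namespace PureCD

open MeasureTheory ProbabilityTheory
open scoped RealInnerProductSpace

noncomputable section

/-! ### Convex functions with values in `ℝ ∪ {+∞}` and their real parts -/

/-! For a fixed comparison point `(u, v)`, the method has a primal-dual descent property in mean
over the drawn index (`Assumptions.one_step`). The function `Q`, which is `F x + ⟪A x, v⟫` plus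
weighted squared distances to `(u, v)`, loses `pmin` times a gap and a multiple of the squared
lengths of the full steps. The factor `θ` makes the mean of the dual extrapolation reproduce `Aᵀ (y'
- v)`, and the step size rule keeps the coefficients `Cτ` of the primal lengths positive. The gap
that appears involves the full dual step `y'`, which the algorithm never realises entirely. The
separable correction `L₂`, with weights `pmin / pr j`, exchanges it in mean for the gap at the
auxiliary sequence (`mean_yb`), so `L = Q + L₂` decreases by `pmin` times the gap of the pair being
averaged (`IsPath.mean_L_le`).

The difficulty is that the supremum over `(u, v)` stands inside the expectation, so the maximizer
depends on the draws and mean inequalities at fixed points do not suffice. Telescoping is therefore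
done along each path, keeping the deviation of `L` from its mean prediction. Apart from terms free
of the iterates, `L` is affine in `(u, v)` (`L_sub_L`). The accumulated deviation is thus a scalar
martingale at the starting point plus linear pairings of `(u, v)` with vector martingales
(`scalarNoise_eq`). Young's inequality separates the two factors of each pairing: the comparison
point goes into a supremum over the bounded set, and squared martingale norms remain. The result,
`pathBound`, no longer contains `(u, v)`.

It remains to integrate. Martingale increments are orthogonal, so the squared norms have expectation
at most a sum of one-step second moments (`integral_wsq_noise_le`). Descent towards a solution
bounds the expected step lengths and distances by `Δ₀` (`energy`), and a contraction bounds the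
distance of the two dual sequences (`dual_distance`). Boundary terms at the last iterate are handled
by nonnegativity of the primal gap and of each row of the dual gap at a solution. Convexity passes
from the mean of the gaps to the gap at the averages. As the first `k` draws take finitely many
values, measurability and integrability are automatic once proximal points are known to be unique.
-/

lemma convexOn_toReal {E : Type*} [NormedAddCommGroup E] [NormedSpace ℝ E] {φ : E → EReal}
    (hb : ∀ x, φ x ≠ ⊥) (hc : Convex ℝ {z : E × ℝ | φ z.1 ≤ (z.2 : EReal)}) :
    ConvexOn ℝ (dom φ) (fun x => (φ x).toReal) := by
  have key : ∀ x ∈ dom φ, ∀ y ∈ dom φ, ∀ a b : ℝ, 0 ≤ a → 0 ≤ b → a + b = 1 →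
      φ (a • x + b • y) ≤ ((a * (φ x).toReal + b * (φ y).toReal : ℝ) : EReal) := by
    intro x hx y hy a b ha hb' hab
    have h1 : (x, (φ x).toReal) ∈ {z : E × ℝ | φ z.1 ≤ (z.2 : EReal)} :=
      (EReal.coe_toReal hx (hb x)).ge
    have h2 : (y, (φ y).toReal) ∈ {z : E × ℝ | φ z.1 ≤ (z.2 : EReal)} :=
      (EReal.coe_toReal hy (hb y)).ge
    simpa using hc h1 h2 ha hb' hab
  refine ⟨fun x hx y hy a b ha hb' hab => ?_, fun x hx y hy a b ha hb' hab => ?_⟩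
  · exact ne_top_of_le_ne_top (EReal.coe_ne_top _) (key x hx y hy a b ha hb' hab)
  · have h := key x hx y hy a b ha hb' hab
    exact EReal.toReal_le_toReal h (hb _) (EReal.coe_ne_top _)

lemma EReal_sum_ne_bot {ι : Type*} {s : Finset ι} {f : ι → EReal}
    (h : ∀ i ∈ s, f i ≠ ⊥) : ∑ i ∈ s, f i ≠ ⊥ := by
  classical
  induction s using Finset.induction_on with
  | empty => simp
  | insert a s ha ih =>
    rw [Finset.sum_insert ha, Ne, EReal.add_eq_bot_iff]
    push Not
    exact ⟨h a (by simp), ih fun i hi => h i (by simp [hi])⟩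

lemma EReal_coe_sum {ι : Type*} (s : Finset ι) (f : ι → ℝ) :
    ((∑ i ∈ s, f i : ℝ) : EReal) = ∑ i ∈ s, (f i : EReal) := by
  classical
  induction s using Finset.induction_on with
  | empty => simp
  | insert a s ha ih => rw [Finset.sum_insert ha, Finset.sum_insert ha, EReal.coe_add, ih]

/-- A separable function which is the sum of the real convex functions `φ i` on the product of
the convex sets `S i`, and `+∞` elsewhere. -/
structure SepConvex {n : ℕ} {d : Fin n → ℕ} (Ψ : Blk d → EReal)
    (S : ∀ i, Set (EuclideanSpace ℝ (Fin (d i))))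
    (φ : ∀ i, EuclideanSpace ℝ (Fin (d i)) → ℝ) : Prop where
  convex : ∀ i, ConvexOn ℝ (S i) (φ i)
  ne_top : ∀ x, Ψ x ≠ ⊤ ↔ ∀ i, x i ∈ S i
  coe : ∀ x, (∀ i, x i ∈ S i) → Ψ x = ((∑ i, φ i (x i) : ℝ) : EReal)

lemma sepConvex_sum {n : ℕ} {d : Fin n → ℕ} {φ : ∀ i, EuclideanSpace ℝ (Fin (d i)) → EReal}
    (hb : ∀ i x, φ i x ≠ ⊥)
    (hc : ∀ i, Convex ℝ {z : EuclideanSpace ℝ (Fin (d i)) × ℝ | φ i z.1 ≤ (z.2 : EReal)}) :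
    SepConvex (fun x : Blk d => ∑ i, φ i (x i)) (fun i => dom (φ i))
      (fun i x => (φ i x).toReal) := by
  have hcoe : ∀ x : Blk d, (∀ i, x i ∈ dom (φ i)) →
      ∑ i, φ i (x i) = ((∑ i, (φ i (x i)).toReal : ℝ) : EReal) := by
    intro x hx
    rw [EReal_coe_sum]
    exact Finset.sum_congr rfl fun i _ => (EReal.coe_toReal (hx i) (hb i _)).symm
  refine ⟨fun i => convexOn_toReal (hb i) (hc i), fun x => ⟨fun h i hi => h ?_, fun h => ?_⟩, hcoe⟩
  · rw [← Finset.add_sum_erase _ _ (Finset.mem_univ i), hi]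
    exact EReal.top_add_of_ne_bot (EReal_sum_ne_bot fun j _ => hb j _)
  · rw [hcoe x h]; exact EReal.coe_ne_top _

namespace SepConvex

variable {n : ℕ} {d : Fin n → ℕ} {Ψ : Blk d → EReal}
  {S : ∀ i, Set (EuclideanSpace ℝ (Fin (d i)))} {φ : ∀ i, EuclideanSpace ℝ (Fin (d i)) → ℝ}

lemma toReal_eq (h : SepConvex Ψ S φ) {x : Blk d} (hx : ∀ i, x i ∈ S i) :
    (Ψ x).toReal = ∑ i, φ i (x i) := by
  rw [h.coe x hx, EReal.toReal_coe]

lemma average_mem (h : SepConvex Ψ S φ) {K : ℕ} (hK : 1 ≤ K) {u : ℕ → Blk d}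
    (hu : ∀ k i, u k i ∈ S i) (i : Fin n) :
    ((K : ℝ)⁻¹ • ∑ k ∈ Finset.Icc 1 K, u k) i ∈ S i := by
  have hK' : (K : ℝ) ≠ 0 := by positivity
  have := (h.convex i).1.sum_mem (t := Finset.Icc 1 K) (w := fun _ => (K : ℝ)⁻¹)
    (z := fun k => u k i) (fun _ _ => by positivity) (by simp [hK']) (fun k _ => hu k i)
  simpa [Finset.smul_sum] using this

lemma average_le (h : SepConvex Ψ S φ) {K : ℕ} (hK : 1 ≤ K) {u : ℕ → Blk d}
    (hu : ∀ k i, u k i ∈ S i) :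
    ∑ i, φ i (((K : ℝ)⁻¹ • ∑ k ∈ Finset.Icc 1 K, u k) i)
      ≤ (K : ℝ)⁻¹ * ∑ k ∈ Finset.Icc 1 K, ∑ i, φ i (u k i) := by
  have hK' : (K : ℝ) ≠ 0 := by positivity
  rw [Finset.sum_comm, Finset.mul_sum]
  refine Finset.sum_le_sum fun i _ => ?_
  have := (h.convex i).map_sum_le (t := Finset.Icc 1 K) (w := fun _ => (K : ℝ)⁻¹)
    (p := fun k => u k i) (fun _ _ => by positivity) (by simp [hK']) (fun k _ => hu k i)
  simpa [Finset.smul_sum, Finset.mul_sum] using this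

end SepConvex

/-- Letting the step tend to zero removes the remainder. This turns the minimality that defines a
proximal point into a variational inequality. -/
lemma nonneg_of_forall_add_mul_nonneg {a b : ℝ}
    (h : ∀ t : ℝ, 0 < t → t ≤ 1 → 0 ≤ a + t * b) : 0 ≤ a := by
  by_contra! ha
  have hb : 0 < |b| + 1 := by positivity
  -- The witness keeps `t * b` at most half of `-a`, so that `a + t * b` stays negative.
  have ht : 0 < min 1 (-a / (2 * (|b| + 1))) := by
    refine lt_min one_pos (by apply div_pos <;> linarith)
  have h1 := h _ ht (min_le_left _ _)
  have h2 : min 1 (-a / (2 * (|b| + 1))) * b ≤ -a / 2 := by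
    calc min 1 (-a / (2 * (|b| + 1))) * b ≤ min 1 (-a / (2 * (|b| + 1))) * (|b| + 1) := by
          refine mul_le_mul_of_nonneg_left ?_ ht.le
          linarith [le_abs_self b]
      _ ≤ -a / (2 * (|b| + 1)) * (|b| + 1) := by gcongr; exact min_le_right _ _
      _ = -a / 2 := by field_simp
  linarith

/-- Moving the block `i` of `u` to `w`. -/
def setBlk {n : ℕ} {d : Fin n → ℕ} (u : Blk d) (i : Fin n) (w : EuclideanSpace ℝ (Fin (d i))) :
    Blk d :=
  u + PiLp.single 2 i (w - u i)

lemma setBlk_same {n : ℕ} {d : Fin n → ℕ} (u : Blk d) (i : Fin n)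
    (w : EuclideanSpace ℝ (Fin (d i))) : setBlk u i w i = w := by
  simp [setBlk]

lemma setBlk_of_ne {n : ℕ} {d : Fin n → ℕ} (u : Blk d) {i j : Fin n} (h : j ≠ i)
    (w : EuclideanSpace ℝ (Fin (d i))) : setBlk u i w j = u j := by
  simp [setBlk, h]

lemma sum_setBlk {n : ℕ} {d : Fin n → ℕ} (u : Blk d) (i : Fin n)
    (w : EuclideanSpace ℝ (Fin (d i))) (F : ∀ j, EuclideanSpace ℝ (Fin (d j)) → ℝ) :
    ∑ j, F j (setBlk u i w j) = ∑ j, F j (u j) + (F i w - F i (u i)) := by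
  rw [← Finset.add_sum_erase _ _ (Finset.mem_univ i),
    ← Finset.add_sum_erase _ (fun j => F j (u j)) (Finset.mem_univ i), setBlk_same,
    Finset.sum_congr rfl (fun j hj => by rw [setBlk_of_ne u (Finset.ne_of_mem_erase hj) w])]
  ring

lemma setBlk_mem {n : ℕ} {d : Fin n → ℕ} {S : ∀ i, Set (EuclideanSpace ℝ (Fin (d i)))} {u : Blk d}
    (hu : ∀ j, u j ∈ S j) {i : Fin n} {w : EuclideanSpace ℝ (Fin (d i))} (hw : w ∈ S i)
    (j : Fin n) : setBlk u i w j ∈ S j := by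
  rcases eq_or_ne j i with rfl | h
  · rwa [setBlk_same]
  · rw [setBlk_of_ne u h]; exact hu j

/-! ### Proximal points of separable functions -/

section Prox

variable {n : ℕ} {d : Fin n → ℕ} {Ψ : Blk d → EReal}
  {S : ∀ i, Set (EuclideanSpace ℝ (Fin (d i)))} {φ : ∀ i, EuclideanSpace ℝ (Fin (d i)) → ℝ}
  {V : Fin n → ℝ} {v u : Blk d}

lemma IsProx.mem (h : SepConvex Ψ S φ) (hne : ∃ x : Blk d, ∀ i, x i ∈ S i) (hu : IsProx V Ψ v u) :
    ∀ i, u i ∈ S i := by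
  obtain ⟨x, hx⟩ := hne
  have h1 := hu x
  rw [h.coe x hx, ← EReal.coe_add] at h1
  refine (h.ne_top u).1 fun h2 => ?_
  rw [h2, EReal.top_add_coe] at h1
  exact EReal.coe_ne_top _ (top_le_iff.1 h1)

/-- The variational inequality of the proximal operator, block by block. -/
lemma IsProx.variational (h : SepConvex Ψ S φ) (hu : IsProx V Ψ v u) (hmem : ∀ i, u i ∈ S i)
    (i : Fin n) {w : EuclideanSpace ℝ (Fin (d i))} (hw : w ∈ S i) :
    φ i (u i) ≤ φ i w + (V i)⁻¹ * ⟪u i - v i, w - u i⟫ := by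
  have key : ∀ t : ℝ, 0 < t → t ≤ 1 → 0 ≤ (φ i w - φ i (u i) + (V i)⁻¹ * ⟪u i - v i, w - u i⟫)
      + t * ((V i)⁻¹ / 2 * ‖w - u i‖ ^ 2) := by
    intro t ht ht1
    have hwt : (1 - t) • u i + t • w ∈ S i :=
      (h.convex i).1 (hmem i) hw (by linarith) ht.le (by ring)
    have h1 := hu (setBlk u i ((1 - t) • u i + t • w))
    rw [h.coe u hmem, h.coe _ (setBlk_mem hmem hwt), ← EReal.coe_add, ← EReal.coe_add,
      EReal.coe_le_coe_iff] at h1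
    simp only [wsq, PiLp.sub_apply] at h1
    rw [sum_setBlk u i _ φ, sum_setBlk u i _ (fun j x => (V j)⁻¹ * ‖x - v j‖ ^ 2)] at h1
    have h2 := (h.convex i).2 (hmem i) hw (by linarith : 0 ≤ 1 - t) ht.le (by ring)
    simp only [smul_eq_mul] at h2
    have h3 : ‖(1 - t) • u i + t • w - v i‖ ^ 2
        = ‖u i - v i‖ ^ 2 + 2 * t * ⟪u i - v i, w - u i⟫ + t ^ 2 * ‖w - u i‖ ^ 2 := by
      have : (1 - t) • u i + t • w - v i = (u i - v i) + t • (w - u i) := by module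
      rw [this, norm_add_sq_real, inner_smul_right, norm_smul, mul_pow, Real.norm_eq_abs, sq_abs]
      ring
    rw [h3] at h1
    have h4 : 0 ≤ t * ((φ i w - φ i (u i) + (V i)⁻¹ * ⟪u i - v i, w - u i⟫)
      + t * ((V i)⁻¹ / 2 * ‖w - u i‖ ^ 2)) := by linarith
    exact nonneg_of_mul_nonneg_right h4 ht
  linarith [nonneg_of_forall_add_mul_nonneg key]

/-- Testing each minimizer in the variational inequality of the other and adding leaves a
nonpositive square that must be nonnegative, block by block. This is what makes a run, specified
only through `IsProx`, a function of the draws. -/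
lemma IsProx.unique (h : SepConvex Ψ S φ) (hne : ∃ x : Blk d, ∀ i, x i ∈ S i) (hV : ∀ i, 0 < V i)
    {u' : Blk d} (hu : IsProx V Ψ v u) (hu' : IsProx V Ψ v u') : u = u' := by
  refine PiLp.ext fun i => ?_
  have m := hu.mem h hne
  have m' := hu'.mem h hne
  have h1 := hu.variational h m i (m' i)
  have h2 := hu'.variational h m' i (m i)
  have h3 : ⟪u i - v i, u' i - u i⟫ + ⟪u' i - v i, u i - u' i⟫ = -‖u i - u' i‖ ^ 2 := by
    rw [← real_inner_self_eq_norm_sq]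
    simp only [inner_sub_left, inner_sub_right]
    ring
  have h4 : 0 ≤ (V i)⁻¹ * (-‖u i - u' i‖ ^ 2) := by rw [← h3]; linarith
  have h5 : 0 ≤ -‖u i - u' i‖ ^ 2 := nonneg_of_mul_nonneg_right h4 (inv_pos.2 (hV i))
  have h6 : ‖u i - u' i‖ = 0 := by
    have : ‖u i - u' i‖ ^ 2 = 0 := le_antisymm (by linarith) (by positivity)
    simpa using this
  exact sub_eq_zero.1 (norm_eq_zero.1 h6)

end Prox

/-! ### The conjugate of a separable function -/

section Conj

variable {E : Type*} [NormedAddCommGroup E] [InnerProductSpace ℝ E]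

lemma conj_ne_bot {φ : E → EReal} (hd : (dom φ).Nonempty) (y : E) : conj φ y ≠ ⊥ := by
  obtain ⟨u, hu⟩ := hd
  have h : ((⟪u, y⟫ : ℝ) : EReal) - φ u ≤ conj φ y :=
    le_iSup (fun u : E => ((⟪u, y⟫ : ℝ) : EReal) - φ u) u
  refine ne_bot_of_le_ne_bot ?_ h
  rw [sub_eq_add_neg, Ne, EReal.add_eq_bot_iff]
  push Not
  exact ⟨EReal.coe_ne_bot _, by simpa [dom] using hu⟩

/-- The epigraph of a conjugate is an intersection of half-spaces, one for each point of `dom φ`;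
convexity of `φ` plays no role. -/
lemma conj_convex {φ : E → EReal} (hb : ∀ x, φ x ≠ ⊥) :
    Convex ℝ {z : E × ℝ | conj φ z.1 ≤ (z.2 : EReal)} := by
  have hset : {z : E × ℝ | conj φ z.1 ≤ (z.2 : EReal)} =
      {z : E × ℝ | ∀ u ∈ dom φ, ⟪u, z.1⟫ - (φ u).toReal ≤ z.2} := by
    ext z
    simp only [conj, Set.mem_ofPred_eq, iSup_le_iff]
    refine forall_congr' fun u => ?_
    by_cases hu : φ u = ⊤
    · simp [hu, dom]
    · have : φ u = ((φ u).toReal : EReal) := (EReal.coe_toReal hu (hb u)).symm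
      rw [this, ← EReal.coe_sub, EReal.coe_le_coe_iff]
      simp [dom, hu]
  rw [hset]
  rintro ⟨y, s⟩ hy ⟨y', s'⟩ hy' a b ha hb' hab u hu
  have h1 := mul_le_mul_of_nonneg_left (hy u hu) ha
  have h2 := mul_le_mul_of_nonneg_left (hy' u hu) hb'
  simp only [Prod.fst_add, Prod.smul_fst, Prod.snd_add, Prod.smul_snd, smul_eq_mul,
    inner_add_right, inner_smul_right]
  have h3 : (φ u).toReal = a * (φ u).toReal + b * (φ u).toReal := by rw [← add_mul, hab, one_mul]
  simp only at h1 h2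
  linarith

/-- For finite `r` this is the adjunction between addition and subtraction; for `r = ⊤` a single
term other than `⊥` already forces `s = ⊤`. -/
lemma EReal_iSup_add_le {ι : Type*} [Nonempty ι] {f : ι → EReal} {r s : EReal} (hr : r ≠ ⊥)
    (hf : ∃ i, f i ≠ ⊥)
    (h : ∀ i, f i ≠ ⊥ → f i + r ≤ s) : (⨆ i, f i) + r ≤ s := by
  induction r with
  | bot => exact absurd rfl hr
  | top =>
    obtain ⟨i, hi⟩ := hf
    have := h i hi
    rw [EReal.add_top_of_ne_bot hi, top_le_iff] at this
    simp [this]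
  | coe r =>
    rw [← EReal.le_sub_iff_add_le (by simp) (by simp)]
    refine iSup_le fun i => ?_
    by_cases hi : f i = ⊥
    · simp [hi]
    · rw [EReal.le_sub_iff_add_le (by simp) (by simp)]
      exact h i hi

/-- A separable expression is maximized block by block. For `≥`, the blocks of a feasible point are
replaced by their suprema one at a time, staying in the effective domains so that `⊥` and `⊤` are
never added. -/
lemma conj_sum {m : ℕ} {e : Fin m → ℕ} {φ : ∀ j, EuclideanSpace ℝ (Fin (e j)) → EReal}
    (hb : ∀ j x, φ j x ≠ ⊥) (hd : ∀ j, (dom (φ j)).Nonempty) (y : Blk e) :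
    conj (fun x : Blk e => ∑ j, φ j (x j)) y = ∑ j, conj (φ j) (y j) := by
  classical
  set c : ∀ j, EuclideanSpace ℝ (Fin (e j)) → EReal :=
    fun j u => ((⟪u, y j⟫ : ℝ) : EReal) - φ j u with hc
  have cbot : ∀ j u, c j u ≠ ⊥ ↔ u ∈ dom (φ j) := by
    intro j u
    simp only [hc, sub_eq_add_neg, Ne, EReal.add_eq_bot_iff, EReal.coe_ne_bot, false_or,
      EReal.neg_eq_bot_iff, dom, Set.mem_ofPred_eq]
  have csum : ∀ u : Blk e, (∀ j, u j ∈ dom (φ j)) →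
      ((⟪u, y⟫ : ℝ) : EReal) - ∑ j, φ j (u j) = ∑ j, c j (u j) := by
    intro u hu
    have h1 : ∀ j, φ j (u j) = ((φ j (u j)).toReal : EReal) := fun j =>
      (EReal.coe_toReal (hu j) (hb j _)).symm
    simp only [hc]
    rw [Finset.sum_congr rfl fun j _ => h1 j,
      Finset.sum_congr rfl fun j _ => congrArg (fun z => ((⟪u j, y j⟫ : ℝ) : EReal) - z) (h1 j)]
    simp only [← EReal.coe_sub]
    rw [← EReal_coe_sum, ← EReal_coe_sum, ← EReal.coe_sub, PiLp.inner_apply,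
      Finset.sum_sub_distrib]
  apply le_antisymm
  · refine iSup_le fun u => ?_
    by_cases hu : ∀ j, u j ∈ dom (φ j)
    · rw [csum u hu]
      exact Finset.sum_le_sum fun j _ => le_iSup (fun v => c j v) (u j)
    · push Not at hu
      obtain ⟨j, hj⟩ := hu
      have hj' : φ j (u j) = ⊤ := by simpa [dom] using hj
      have : ∑ j, φ j (u j) = ⊤ := by
        rw [← Finset.add_sum_erase _ _ (Finset.mem_univ j), hj']
        exact EReal.top_add_of_ne_bot (EReal_sum_ne_bot fun j _ => hb j _)
      simp only [this]
      simp
  · have key : ∀ T : Finset (Fin m), ∀ u : Blk e, (∀ j, u j ∈ dom (φ j)) →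
        ∑ j ∈ T, conj (φ j) (y j) + ∑ j ∈ Finset.univ \ T, c j (u j)
          ≤ conj (fun x : Blk e => ∑ j, φ j (x j)) y := by
      intro T
      induction T using Finset.induction_on with
      | empty =>
        intro u hu
        have := le_iSup (fun u : Blk e => ((⟪u, y⟫ : ℝ) : EReal) - ∑ j, φ j (u j)) u
        rw [csum u hu] at this
        simpa [conj] using this
      | insert a T ha ih =>
        intro u hu
        rw [Finset.sum_insert ha, add_assoc]
        refine EReal_iSup_add_le (f := c a) ?_ ?_ ?_
        · rw [Ne, EReal.add_eq_bot_iff]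
          push Not
          exact ⟨EReal_sum_ne_bot fun j _ => conj_ne_bot (hd j) _,
            EReal_sum_ne_bot fun j _ => (cbot j _).2 (hu j)⟩
        · obtain ⟨w, hw⟩ := hd a
          exact ⟨w, (cbot a w).2 hw⟩
        · intro w hw
          have h1 := ih (setBlk u a w) (setBlk_mem hu ((cbot a w).1 hw))
          have h2 : Finset.univ \ T = insert a (Finset.univ \ insert a T) := by
            ext j; by_cases hj : j = a <;> simp [hj, ha]
          rw [h2, Finset.sum_insert (by simp), setBlk_same] at h1
          have h3 : ∑ j ∈ Finset.univ \ insert a T, c j (setBlk u a w j)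
              = ∑ j ∈ Finset.univ \ insert a T, c j (u j) :=
            Finset.sum_congr rfl fun j hj => by
              rw [setBlk_of_ne]; rintro rfl; simp at hj
          rw [h3] at h1
          rw [add_left_comm]; exact h1
    choose w hw using hd
    simpa using key Finset.univ (WithLp.toLp 2 w) hw

end Conj

/-! ### Weighted norms -/

section Weighted

variable {n : ℕ} {d : Fin n → ℕ}

/-- `∑ i, w i * ⟪x i, y i⟫` for a diagonal weight `w`. -/
def wip (w : Fin n → ℝ) (x y : Blk d) : ℝ := ∑ i, w i * ⟪x i, y i⟫

lemma wsq_nonneg {w : Fin n → ℝ} (hw : ∀ i, 0 ≤ w i) (x : Blk d) : 0 ≤ wsq w x :=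
  Finset.sum_nonneg fun i _ => mul_nonneg (hw i) (by positivity)

lemma wsq_add (w : Fin n → ℝ) (x y : Blk d) :
    wsq w (x + y) = wsq w x + 2 * wip w x y + wsq w y := by
  simp only [wsq, wip, PiLp.add_apply, norm_add_sq_real, Finset.mul_sum,
    ← Finset.sum_add_distrib]
  exact Finset.sum_congr rfl fun i _ => by ring

lemma wsq_sub (w : Fin n → ℝ) (x y : Blk d) :
    wsq w (x - y) = wsq w x - 2 * wip w x y + wsq w y := by
  simp only [wsq, wip, PiLp.sub_apply, norm_sub_sq_real, Finset.mul_sum,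
    ← Finset.sum_add_distrib, ← Finset.sum_sub_distrib]
  exact Finset.sum_congr rfl fun i _ => by ring

lemma wsq_neg (w : Fin n → ℝ) (x : Blk d) : wsq w (-x) = wsq w x := by
  simp [wsq]

lemma wsq_sub_comm (w : Fin n → ℝ) (x y : Blk d) : wsq w (x - y) = wsq w (y - x) := by
  rw [← wsq_neg, neg_sub]

lemma wsq_zero (w : Fin n → ℝ) : wsq w (0 : Blk d) = 0 := by
  simp [wsq]

lemma wip_add_left (w : Fin n → ℝ) (x y z : Blk d) : wip w (x + y) z = wip w x z + wip w y z := by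
  simp [wip, inner_add_left, mul_add, Finset.sum_add_distrib]

lemma wip_sub_left (w : Fin n → ℝ) (x y z : Blk d) : wip w (x - y) z = wip w x z - wip w y z := by
  simp [wip, inner_sub_left, mul_sub, Finset.sum_sub_distrib]

lemma wip_sub_right (w : Fin n → ℝ) (x y z : Blk d) :
    wip w x (y - z) = wip w x y - wip w x z := by
  simp [wip, inner_sub_right, mul_sub, Finset.sum_sub_distrib]

lemma wip_smul_right (w : Fin n → ℝ) (c : ℝ) (x y : Blk d) :
    wip w x (c • y) = c * wip w x y := by
  simp only [wip, PiLp.smul_apply, inner_smul_right, Finset.mul_sum]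
  exact Finset.sum_congr rfl fun i _ => by ring

lemma wip_comm (w : Fin n → ℝ) (x y : Blk d) : wip w x y = wip w y x := by
  simp only [wip]
  exact Finset.sum_congr rfl fun i _ => by rw [real_inner_comm]

lemma wip_one (x y : Blk d) : wip 1 x y = ⟪x, y⟫ := by
  simp [wip, PiLp.inner_apply]

lemma wip_sum_right {ι : Type*} (w : Fin n → ℝ) (x : Blk d) (s : Finset ι) (y : ι → Blk d) :
    wip w x (∑ k ∈ s, y k) = ∑ k ∈ s, wip w x (y k) := by
  simp only [wip, WithLp.ofLp_sum, Finset.sum_apply, inner_sum, Finset.mul_sum]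
  exact Finset.sum_comm

lemma wsq_add_le {w : Fin n → ℝ} (hw : ∀ i, 0 ≤ w i) (x y : Blk d) :
    wsq w (x + y) ≤ 2 * wsq w x + 2 * wsq w y := by
  have h := wsq_nonneg hw (x - y)
  rw [wsq_sub] at h
  rw [wsq_add]; linarith

/-- Young's inequality with weights. -/
lemma wip_le {s w w' : Fin n → ℝ} (hw : ∀ i, 0 < w i) (h : ∀ i, s i ^ 2 ≤ w i * w' i)
    {c : ℝ} (hc : 0 < c) (x y : Blk d) :
    wip s x y ≤ c / 2 * wsq w x + (2 * c)⁻¹ * wsq w' y := by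
  simp only [wip, wsq, Finset.mul_sum, ← Finset.sum_add_distrib]
  refine Finset.sum_le_sum fun i _ => ?_
  have h1 : s i * ⟪x i, y i⟫ ≤ |s i| * (‖x i‖ * ‖y i‖) := by
    refine (le_abs_self _).trans ?_
    rw [abs_mul]
    exact mul_le_mul_of_nonneg_left (abs_real_inner_le_norm _ _) (abs_nonneg _)
  have hcw : 0 < c * w i := mul_pos hc (hw i)
  have h2 : 0 ≤ (c * w i * ‖x i‖ - |s i| * ‖y i‖) ^ 2 / (2 * (c * w i)) := by positivity
  have h3 : (c * w i * ‖x i‖ - |s i| * ‖y i‖) ^ 2 / (2 * (c * w i))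
      = c / 2 * (w i * ‖x i‖ ^ 2) - |s i| * (‖x i‖ * ‖y i‖)
        + s i ^ 2 * ‖y i‖ ^ 2 / (2 * (c * w i)) := by
    have hwi := (hw i).ne'
    rw [← sq_abs (s i)]
    field_simp
    ring
  have h4 : s i ^ 2 * ‖y i‖ ^ 2 / (2 * (c * w i)) ≤ (2 * c)⁻¹ * (w' i * ‖y i‖ ^ 2) := by
    rw [div_le_iff₀ (by positivity)]
    calc s i ^ 2 * ‖y i‖ ^ 2 ≤ w i * w' i * ‖y i‖ ^ 2 := by gcongr; exact h i
      _ = _ := by field_simp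
  linarith

/-- The Cauchy-Schwarz inequality with weights. -/
lemma wip_le_wnorm {s w w' : Fin n → ℝ} (hw : ∀ i, 0 < w i) (hw' : ∀ i, 0 ≤ w' i)
    (h : ∀ i, s i ^ 2 ≤ w i * w' i) (x y : Blk d) :
    wip s x y ≤ wnorm w x * wnorm w' y := by
  have hx := wsq_nonneg (fun i => (hw i).le) x
  have hy := wsq_nonneg hw' y
  refine le_of_forall_pos_le_add fun ε hε => ?_
  -- Young's inequality at the optimal ratio; both norms are enlarged by `η` because either may
  -- vanish.
  have key : ∀ η : ℝ, 0 < η → wip s x y ≤ (wnorm w x + η) * (wnorm w' y + η) := by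
    intro η hη
    have hX : 0 < wnorm w x + η := add_pos_of_nonneg_of_pos (Real.sqrt_nonneg _) hη
    have hY : 0 < wnorm w' y + η := add_pos_of_nonneg_of_pos (Real.sqrt_nonneg _) hη
    refine (wip_le hw h (div_pos hY hX) x y).trans ?_
    have h1 : wsq w x ≤ (wnorm w x + η) ^ 2 := by
      rw [← Real.sq_sqrt hx]; exact pow_le_pow_left₀ (Real.sqrt_nonneg _) (by unfold wnorm; linarith) 2
    have h2 : wsq w' y ≤ (wnorm w' y + η) ^ 2 := by
      rw [← Real.sq_sqrt hy]; exact pow_le_pow_left₀ (Real.sqrt_nonneg _) (by unfold wnorm; linarith) 2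
    calc _ ≤ (wnorm w' y + η) / (wnorm w x + η) / 2 * (wnorm w x + η) ^ 2
          + (2 * ((wnorm w' y + η) / (wnorm w x + η)))⁻¹ * (wnorm w' y + η) ^ 2 := by gcongr
      _ = _ := by field_simp; ring
  set a := wnorm w x
  set b := wnorm w' y
  have ha : 0 ≤ a := Real.sqrt_nonneg _
  have hb : 0 ≤ b := Real.sqrt_nonneg _
  have hη : 0 < min 1 (ε / (a + b + 1)) := lt_min one_pos (by positivity)
  refine (key _ hη).trans ?_
  have h1 := min_le_left 1 (ε / (a + b + 1))
  have h2 := min_le_right 1 (ε / (a + b + 1))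
  set η := min 1 (ε / (a + b + 1))
  have h3 : η * (a + b + 1) ≤ ε := by rwa [le_div_iff₀ (by positivity)] at h2
  nlinarith

lemma wnorm_sq {w : Fin n → ℝ} (hw : ∀ i, 0 ≤ w i) (x : Blk d) : wnorm w x ^ 2 = wsq w x :=
  Real.sq_sqrt (wsq_nonneg hw x)

lemma wnorm_nonneg (w : Fin n → ℝ) (x : Blk d) : 0 ≤ wnorm w x := Real.sqrt_nonneg _

lemma sum_wsq_setBlk (w : Fin n → ℝ) (x u : Blk d) (i : Fin n)
    (z : EuclideanSpace ℝ (Fin (d i))) :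
    wsq w (setBlk x i z - u) = wsq w (x - u) + w i * (‖z - u i‖ ^ 2 - ‖x i - u i‖ ^ 2) := by
  simp only [wsq, PiLp.sub_apply]
  rw [sum_setBlk x i z (fun j a => w j * ‖a - u j‖ ^ 2)]
  ring

/-- The second moment about the mean is at most the second moment about any other point. -/
lemma sum_wsq_sub_mean_le {ι : Type*} [Fintype ι] {p : ι → ℝ} (hp : ∑ i, p i = 1)
    {w : Fin n → ℝ} (hw : ∀ i, 0 ≤ w i) (a : ι → Blk d) (c z : Blk d) :
    ∑ i, p i * wsq w (z + a i - ∑ l, p l • a l)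
      ≤ wsq w z + ∑ i, p i * wsq w (a i - c) := by
  set m := ∑ l, p l • a l with hm
  have hcross : ∀ b : Blk d, ∑ i, p i * wip w b (a i - m) = 0 := by
    intro b
    simp only [wip_sub_right, mul_sub, Finset.sum_sub_distrib, ← Finset.sum_mul, hp, one_mul]
    rw [hm, wip_sum_right]
    simp [wip_smul_right]
  have h1 : ∑ i, p i * wsq w (z + a i - m) = wsq w z + ∑ i, p i * wsq w (a i - m) := by
    have : ∀ i, p i * wsq w (z + a i - m)
        = p i * wsq w z + 2 * (p i * wip w z (a i - m)) + p i * wsq w (a i - m) := by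
      intro i; rw [add_sub_assoc, wsq_add]; ring
    simp only [this, Finset.sum_add_distrib, ← Finset.mul_sum, hcross, ← Finset.sum_mul, hp]
    ring
  have h2 : ∑ i, p i * wsq w (a i - c) = wsq w (m - c) + ∑ i, p i * wsq w (a i - m) := by
    have : ∀ i, p i * wsq w (a i - c)
        = p i * wsq w (m - c) + 2 * (p i * wip w (m - c) (a i - m)) + p i * wsq w (a i - m) := by
      intro i
      have : a i - c = (m - c) + (a i - m) := by abel
      rw [this, wsq_add]; ring
    simp only [this, Finset.sum_add_distrib, ← Finset.mul_sum, hcross, ← Finset.sum_mul, hp]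
    ring
  have h3 := wsq_nonneg hw (m - c)
  rw [h1, h2]; linarith

end Weighted

/-! ### The gradient inequality -/

lemma gradient_inequality {E : Type*} [NormedAddCommGroup E] [InnerProductSpace ℝ E]
    [CompleteSpace E] {f : E → ℝ} (hf : ConvexOn ℝ Set.univ f) (hd : Differentiable ℝ f)
    (x u : E) : f x + ⟪gradient f x, u - x⟫ ≤ f u := by
  have hline : HasDerivAt (fun t : ℝ => x + t • (u - x)) (u - x) 0 := by
    simpa using ((hasDerivAt_id (0 : ℝ)).smul_const (u - x)).const_add x
  have hg : HasFDerivAt f (InnerProductSpace.toDual ℝ E (gradient f x)) x :=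
    (hd x).hasGradientAt.hasFDerivAt
  have hg' : HasFDerivAt f (InnerProductSpace.toDual ℝ E (gradient f x))
      (x + (0 : ℝ) • (u - x)) := by simpa using hg
  have hder : HasDerivAt (fun t : ℝ => f (x + t • (u - x))) ⟪gradient f x, u - x⟫ 0 := by
    have h := hg'.comp_hasDerivAt (0 : ℝ) hline
    rwa [InnerProductSpace.toDual_apply_apply] at h
  have hconv : ConvexOn ℝ Set.univ (fun t : ℝ => f (x + t • (u - x))) := by
    refine ⟨convex_univ, fun s _ t _ a b ha hb hab => ?_⟩
    have := hf.2 (Set.mem_univ (x + s • (u - x))) (Set.mem_univ (x + t • (u - x))) ha hb hab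
    convert this using 2
    have : x = a • x + b • x := by rw [← add_smul, hab, one_smul]
    nth_rewrite 1 [this]
    simp only [smul_eq_mul]
    module
  have := hconv.le_slope_of_hasDerivAt (Set.mem_univ 0) (Set.mem_univ 1) one_pos hder
  simp only [slope_def_field, zero_smul, one_smul, add_zero, add_sub_cancel, sub_zero,
    div_one] at this
  linarith

namespace Data

variable {n m : ℕ} {d : Fin n → ℕ} {e : Fin m → ℕ} (D : Data d e)

/-! ### The operator `A` -/

lemma mulA_apply (x : Blk d) (j : Fin m) : D.mulA x j = ∑ i, D.A j i (x i) := rfl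

lemma mulA_add (x z : Blk d) : D.mulA (x + z) = D.mulA x + D.mulA z := by
  refine PiLp.ext fun j => ?_
  simp [mulA_apply, Finset.sum_add_distrib]

lemma mulA_sub (x z : Blk d) : D.mulA (x - z) = D.mulA x - D.mulA z := by
  refine PiLp.ext fun j => ?_
  simp [mulA_apply, Finset.sum_sub_distrib]

lemma mulA_smul (c : ℝ) (x : Blk d) : D.mulA (c • x) = c • D.mulA x := by
  refine PiLp.ext fun j => ?_
  simp [mulA_apply, Finset.smul_sum]

lemma mulA_single (i : Fin n) (z : EuclideanSpace ℝ (Fin (d i))) (j : Fin m) :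
    D.mulA (PiLp.single 2 i z) j = D.A j i z := by
  rw [mulA_apply, Finset.sum_eq_single i]
  · simp
  · intro l _ hl; simp [hl]
  · simp

lemma inner_mulA (x : Blk d) (y : Blk e) : ⟪D.mulA x, y⟫ = ⟪x, D.mulAT y⟫ := by
  simp only [PiLp.inner_apply, mulA, mulAT, sum_inner, inner_sum,
    ContinuousLinearMap.adjoint_inner_right]
  exact Finset.sum_comm

lemma inner_mulAT_left (x : Blk d) (y : Blk e) : ⟪D.mulAT y, x⟫ = ⟪D.mulA x, y⟫ := by
  rw [inner_mulA, real_inner_comm]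

lemma mem_J {i : Fin n} {j : Fin m} : j ∈ D.J i ↔ D.A j i ≠ 0 := by simp [J]

lemma mem_I {i : Fin n} {j : Fin m} : i ∈ D.I j ↔ D.A j i ≠ 0 := by simp [I]


end Data
namespace Data

variable {n m : ℕ} {d : Fin n → ℕ} {e : Fin m → ℕ} {D : Data d e}

namespace Parameters

lemma pmin_le (_hp : D.Parameters) (i : Fin n) : D.pmin ≤ D.p i :=
  ciInf_le (Set.finite_range _).bddBelow i

lemma nonempty (hp : D.Parameters) : Nonempty (Fin n) := by
  by_contra h
  rw [not_nonempty_iff] at h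
  simpa using hp.p_sum

lemma exists_eq_pmin (hp : D.Parameters) : ∃ i, D.p i = D.pmin :=
  have := hp.nonempty
  exists_eq_ciInf_of_finite

lemma pmin_pos (hp : D.Parameters) : 0 < D.pmin := by
  obtain ⟨i, hi⟩ := hp.exists_eq_pmin
  rw [← hi]; exact hp.p_pos i

lemma p_le_one (hp : D.Parameters) (i : Fin n) : D.p i ≤ 1 := by
  rw [← hp.p_sum]
  exact Finset.single_le_sum (fun l _ => (hp.p_pos l).le) (Finset.mem_univ i)

lemma pmin_le_one (hp : D.Parameters) : D.pmin ≤ 1 := by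
  obtain ⟨i, hi⟩ := hp.exists_eq_pmin
  rw [← hi]; exact hp.p_le_one i

lemma pr_pos (hp : D.Parameters) (j : Fin m) : 0 < D.pr j := by
  have := hp.θ_pos j
  rw [θ, div_pos_iff_of_pos_right hp.pmin_pos] at this
  exact this

lemma pr_le_one (hp : D.Parameters) (j : Fin m) : D.pr j ≤ 1 := by
  rw [← hp.p_sum]
  exact Finset.sum_le_sum_of_subset_of_nonneg (Finset.subset_univ _) fun l _ _ => (hp.p_pos l).le

lemma p_le_pr (hp : D.Parameters) {i : Fin n} {j : Fin m} (h : D.A j i ≠ 0) :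
    D.p i ≤ D.pr j :=
  Finset.single_le_sum (f := D.p) (fun l _ => (hp.p_pos l).le) (D.mem_I.2 h)

/-- A positive `θ j` excludes an empty row, and any index of the row contributes at least `pmin`. -/
lemma pmin_le_pr (hp : D.Parameters) (j : Fin m) : D.pmin ≤ D.pr j := by
  by_contra! hlt
  have hempty : D.I j = ∅ := by
    by_contra hne
    obtain ⟨i, hi⟩ := Finset.nonempty_iff_ne_empty.2 hne
    linarith [hp.p_le_pr (D.mem_I.1 hi), hp.pmin_le i]
  have := hp.pr_pos j
  simp [pr, hempty] at this

lemma θ_eq (_hp : D.Parameters) (j : Fin m) : D.θ j = D.pr j * D.pmin⁻¹ := rfl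

/-- The sum over the rows of a column of `A` that enters the step size rule. -/
lemma column_le (hp : D.Parameters) (hβ : ∀ i, 0 ≤ D.β i) (i : Fin n) :
    D.p i * ∑ j, D.pr j * D.σ j * ‖D.A j i‖ ^ 2
      ≤ D.pmin * (2 * D.p i - D.pmin) * (D.τ i)⁻¹ := by
  have h := hp.step i
  have hm := hp.pmin_pos
  have hτ := hp.τ_pos i
  have h0 : 0 ≤ D.τ i * (D.β i * D.p i) :=
    mul_nonneg hτ.le (mul_nonneg (hβ i) (hp.p_pos i).le)
  rw [← div_eq_mul_inv, le_div_iff₀ hτ]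
  set s := ∑ j, D.pr j * D.σ j * ‖D.A j i‖ ^ 2
  have h2 : D.τ i * (D.pmin⁻¹ * D.p i * s) ≤ 2 * D.p i - D.pmin := by linarith
  calc D.p i * s * D.τ i = D.pmin * (D.τ i * (D.pmin⁻¹ * D.p i * s)) := by field_simp
    _ ≤ _ := mul_le_mul_of_nonneg_left h2 hm.le

lemma column_weighted_eq (hp : D.Parameters) (i : Fin n) :
    ∑ j, (D.pr j)⁻¹ * D.σ j * D.θ j ^ 2 * ‖D.A j i‖ ^ 2
      = (D.pmin ^ 2)⁻¹ * ∑ j, D.pr j * D.σ j * ‖D.A j i‖ ^ 2 := by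
  rw [Finset.mul_sum]
  refine Finset.sum_congr rfl fun j _ => ?_
  have := (hp.pr_pos j).ne'
  rw [hp.θ_eq]
  field_simp

/-- Clearing denominators shows that `Cτ` is the slack in the step size rule, so its positivity is
that rule. -/
lemma Cτ_mul_τ (hp : D.Parameters) (i : Fin n) :
    D.pmin * (D.Cτ i * D.τ i) = 2 * D.p i - D.pmin - D.τ i * (D.β i * D.p i
      + D.pmin⁻¹ * D.p i * ∑ j, D.pr j * D.σ j * ‖D.A j i‖ ^ 2) := by
  have hm := hp.pmin_pos
  have hτ := hp.τ_pos i
  rw [Cτ, hp.column_weighted_eq]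
  field_simp
  ring

lemma Cτ_mul_τ_pos (hp : D.Parameters) (i : Fin n) : 0 < D.Cτ i * D.τ i := by
  have h := hp.Cτ_mul_τ i
  have h2 := hp.step i
  exact pos_of_mul_pos_right (by rw [h]; linarith) hp.pmin_pos.le

lemma Cτ_pos (hp : D.Parameters) (i : Fin n) : 0 < D.Cτ i :=
  pos_of_mul_pos_left (hp.Cτ_mul_τ_pos i) (hp.τ_pos i).le

lemma CτV_le (_hp : D.Parameters) (i : Fin n) : D.CτV ≤ D.Cτ i * D.τ i :=
  ciInf_le (Set.finite_range (fun i => D.Cτ i * D.τ i)).bddBelow i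

lemma CτV_pos (hp : D.Parameters) : 0 < D.CτV := by
  have := hp.nonempty
  obtain ⟨i, hi⟩ := exists_eq_ciInf_of_finite (f := fun i => D.Cτ i * D.τ i)
  rw [CτV, ← hi]; exact hp.Cτ_mul_τ_pos i

/-- At an index of smallest probability the slack is at most `2 * p i - pmin = pmin`. The resulting
`1 ≤ CτV⁻¹` is what allows the final comparison of constants. -/
lemma CτV_le_one (hp : D.Parameters) (hβ : ∀ i, 0 ≤ D.β i) : D.CτV ≤ 1 := by
  obtain ⟨i, hi⟩ := hp.exists_eq_pmin
  refine (hp.CτV_le i).trans ?_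
  have h := hp.Cτ_mul_τ i
  have hm := hp.pmin_pos
  have h0 : 0 ≤ D.τ i * (D.β i * D.p i
      + D.pmin⁻¹ * D.p i * ∑ j, D.pr j * D.σ j * ‖D.A j i‖ ^ 2) := by
    refine mul_nonneg (hp.τ_pos i).le (add_nonneg (mul_nonneg (hβ i) (hp.p_pos i).le)
      (mul_nonneg (mul_nonneg (inv_nonneg.2 hm.le) (hp.p_pos i).le) (Finset.sum_nonneg fun j _ => ?_)))
    exact mul_nonneg (mul_nonneg (hp.pr_pos j).le (hp.σ_pos j).le) (by positivity)
  rw [hi] at h h0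
  have : D.pmin * (D.Cτ i * D.τ i) ≤ D.pmin * 1 := by rw [h]; linarith
  exact le_of_mul_le_mul_left this hm

lemma τ_inv_le (hp : D.Parameters) (i : Fin n) : (D.τ i)⁻¹ ≤ D.CτV⁻¹ * D.Cτ i := by
  rw [inv_mul_eq_div, le_div_iff₀ hp.CτV_pos, inv_mul_le_iff₀ (hp.τ_pos i), mul_comm]
  exact hp.CτV_le i

/-- The operator `A` is nonexpansive between the weighted norms of the algorithm. -/
lemma wsq_mulA_le (hp : D.Parameters) (hβ : ∀ i, 0 ≤ D.β i) (w : Blk d) :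
    wsq (fun j => D.σ j * (D.pr j)⁻¹) (D.mulA w)
      ≤ wsq (fun i => (D.τ i)⁻¹ * (D.p i)⁻¹) w := by
  -- Cauchy-Schwarz over the nonzero blocks of the row, with weights `p i` whose sum is `pr j`.
  have hrow : ∀ j, ‖D.mulA w j‖ ^ 2 ≤ D.pr j * ∑ i, (D.p i)⁻¹ * (‖D.A j i‖ ^ 2 * ‖w i‖ ^ 2) := by
    intro j
    have h1 : D.mulA w j = ∑ i ∈ D.I j, D.A j i (w i) := by
      rw [mulA_apply]
      refine (Finset.sum_subset (Finset.subset_univ _) fun i _ hi => ?_).symm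
      rw [mem_I, not_not] at hi
      simp [hi]
    have h2 : (∑ i ∈ D.I j, ‖D.A j i (w i)‖) ^ 2
        ≤ D.pr j * ∑ i ∈ D.I j, (D.p i)⁻¹ * ‖D.A j i (w i)‖ ^ 2 := by
      refine Finset.sum_sq_le_sum_mul_sum_of_sq_le_mul _ (fun i _ => (hp.p_pos i).le)
        (fun i _ => mul_nonneg (inv_nonneg.2 (hp.p_pos i).le) (by positivity)) fun i _ => ?_
      rw [mul_inv_cancel_left₀ (hp.p_pos i).ne']
    calc ‖D.mulA w j‖ ^ 2 ≤ (∑ i ∈ D.I j, ‖D.A j i (w i)‖) ^ 2 := by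
          rw [h1]; gcongr; exact norm_sum_le _ _
      _ ≤ _ := h2
      _ ≤ _ := by
        refine mul_le_mul_of_nonneg_left ?_ (hp.pr_pos j).le
        calc ∑ i ∈ D.I j, (D.p i)⁻¹ * ‖D.A j i (w i)‖ ^ 2
            ≤ ∑ i ∈ D.I j, (D.p i)⁻¹ * (‖D.A j i‖ ^ 2 * ‖w i‖ ^ 2) := by
              refine Finset.sum_le_sum fun i _ => mul_le_mul_of_nonneg_left ?_
                (inv_nonneg.2 (hp.p_pos i).le)
              rw [← mul_pow]
              exact pow_le_pow_left₀ (norm_nonneg _) ((D.A j i).le_opNorm _) 2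
          _ ≤ _ := Finset.sum_le_sum_of_subset_of_nonneg (Finset.subset_univ _) fun i _ _ =>
              mul_nonneg (inv_nonneg.2 (hp.p_pos i).le) (by positivity)
  have hcol : ∀ i, ∑ j, D.σ j * ‖D.A j i‖ ^ 2 ≤ (D.τ i)⁻¹ := by
    intro i
    have hpi := hp.p_pos i
    have h1 : D.p i * ∑ j, D.σ j * ‖D.A j i‖ ^ 2 ≤ ∑ j, D.pr j * D.σ j * ‖D.A j i‖ ^ 2 := by
      rw [Finset.mul_sum]
      refine Finset.sum_le_sum fun j _ => ?_
      by_cases hA : D.A j i = 0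
      · simp [hA]
      · rw [mul_assoc]
        exact mul_le_mul_of_nonneg_right (hp.p_le_pr hA)
          (mul_nonneg (hp.σ_pos j).le (by positivity))
    have h2 := mul_le_mul_of_nonneg_left h1 hpi.le
    have h3 := h2.trans (hp.column_le hβ i)
    -- `pmin * (2 * p - pmin) ≤ p ^ 2` is the inequality `0 ≤ (p - pmin) ^ 2`.
    have h4 : D.pmin * (2 * D.p i - D.pmin) * (D.τ i)⁻¹ ≤ D.p i ^ 2 * (D.τ i)⁻¹ := by
      refine mul_le_mul_of_nonneg_right ?_ (inv_nonneg.2 (hp.τ_pos i).le)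
      nlinarith [sq_nonneg (D.p i - D.pmin)]
    have h5 := h3.trans h4
    rw [← mul_assoc, ← sq] at h5
    exact le_of_mul_le_mul_left h5 (by positivity)
  calc wsq (fun j => D.σ j * (D.pr j)⁻¹) (D.mulA w)
      ≤ ∑ j, D.σ j * (D.pr j)⁻¹ * (D.pr j * ∑ i, (D.p i)⁻¹ * (‖D.A j i‖ ^ 2 * ‖w i‖ ^ 2)) :=
        Finset.sum_le_sum fun j _ => mul_le_mul_of_nonneg_left (hrow j)
          (mul_nonneg (hp.σ_pos j).le (inv_nonneg.2 (hp.pr_pos j).le))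
    _ = ∑ j, ∑ i, (D.p i)⁻¹ * ‖w i‖ ^ 2 * (D.σ j * ‖D.A j i‖ ^ 2) := by
        refine Finset.sum_congr rfl fun j _ => ?_
        have := (hp.pr_pos j).ne'
        rw [mul_assoc, inv_mul_cancel_left₀ this, Finset.mul_sum]
        exact Finset.sum_congr rfl fun i _ => by ring
    _ = ∑ i, (D.p i)⁻¹ * ‖w i‖ ^ 2 * ∑ j, D.σ j * ‖D.A j i‖ ^ 2 := by
        rw [Finset.sum_comm]
        exact Finset.sum_congr rfl fun i _ => by rw [Finset.mul_sum]
    _ ≤ ∑ i, (D.p i)⁻¹ * ‖w i‖ ^ 2 * (D.τ i)⁻¹ :=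
        Finset.sum_le_sum fun i _ => mul_le_mul_of_nonneg_left (hcol i)
          (mul_nonneg (inv_nonneg.2 (hp.p_pos i).le) (by positivity))
    _ = _ := Finset.sum_congr rfl fun i _ => by ring

/-- The average over the drawn index of a quantity that distinguishes the updated rows. -/
lemma sum_ite_J (hp : D.Parameters) (j : Fin m) (a : Fin n → ℝ) (b : ℝ) :
    ∑ i, D.p i * (if j ∈ D.J i then a i else b)
      = ∑ i ∈ D.I j, D.p i * a i + (1 - D.pr j) * b := by
  classical
  have h1 : ∀ i, D.p i * (if j ∈ D.J i then a i else b)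
      = (if i ∈ D.I j then D.p i * a i else 0) + (D.p i - if i ∈ D.I j then D.p i else 0) * b := by
    intro i
    by_cases h : D.A j i = 0 <;> simp [mem_I, mem_J, h]
  simp only [h1, Finset.sum_add_distrib, ← Finset.sum_mul, Finset.sum_sub_distrib, hp.p_sum,
    Finset.sum_ite_mem, Finset.univ_inter, pr]

lemma sum_I_eq (D : Data d e) (j : Fin m) (a : Fin n → ℝ) (ha : ∀ i, D.A j i = 0 → a i = 0) :
    ∑ i ∈ D.I j, D.p i * a i = ∑ i, D.p i * a i :=
  Finset.sum_subset (Finset.subset_univ _) fun i _ hi => by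
    rw [mem_I, not_not] at hi
    rw [ha i hi, mul_zero]

end Parameters

end Data
namespace Data

variable {n m : ℕ} {d : Fin n → ℕ} {e : Fin m → ℕ} (D : Data d e)

/-! ### One step of the algorithm for a given index -/

/-- The weight `τ⁻¹ P⁻¹`. -/
abbrev wx (i : Fin n) : ℝ := (D.τ i)⁻¹ * (D.p i)⁻¹

/-- The weight `σ⁻¹ π⁻¹`. -/
abbrev wy (j : Fin m) : ℝ := (D.σ j)⁻¹ * (D.pr j)⁻¹

/-- The dual update when the index `i` is drawn. -/
def stepY (x x' : Blk d) (y y' : Blk e) (i : Fin n) : Blk e :=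
  WithLp.toLp 2 fun j =>
    if j ∈ D.J i then y' j + (D.σ j * D.θ j) • D.A j i (x' i - x i) else y j

/-- The update of the auxiliary dual sequence when the index `i` is drawn. -/
def stepYb (y' z : Blk e) (i : Fin n) : Blk e :=
  WithLp.toLp 2 fun j => if j ∈ D.J i then y' j else z j

/-- The constant that controls the variance of the dual updates. -/
def κ : ℝ := (2 * D.pmin⁻¹ - 1) * D.CτV⁻¹

variable {D}

lemma mulA_setBlk_sub (x : Blk d) (i : Fin n) (w : EuclideanSpace ℝ (Fin (d i))) (j : Fin m) :
    D.mulA (setBlk x i w - x) j = D.A j i (w - x i) := by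
  rw [setBlk, add_sub_cancel_left, mulA_single]

namespace Parameters

lemma wx_pos (hp : D.Parameters) (i : Fin n) : 0 < D.wx i :=
  mul_pos (inv_pos.2 (hp.τ_pos i)) (inv_pos.2 (hp.p_pos i))

lemma wy_pos (hp : D.Parameters) (j : Fin m) : 0 < D.wy j :=
  mul_pos (inv_pos.2 (hp.σ_pos j)) (inv_pos.2 (hp.pr_pos j))

/-- Row `j` moves exactly when the drawn column meets it, which has probability `pr j`, so means
over the draw decouple row by row. -/
lemma sum_sum_ite_J (hp : D.Parameters) (a : Fin n → Fin m → ℝ) (b : Fin m → ℝ) :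
    ∑ i, D.p i * ∑ j, (if j ∈ D.J i then a i j else b j)
      = ∑ j, (∑ i ∈ D.I j, D.p i * a i j + (1 - D.pr j) * b j) := by
  simp only [Finset.mul_sum]
  rw [Finset.sum_comm]
  refine Finset.sum_congr rfl fun j _ => ?_
  simp only [← hp.sum_ite_J j (fun i => a i j) (b j)]

lemma wsq_τ_inv_le (hp : D.Parameters) (z : Blk d) :
    wsq (fun i => (D.τ i)⁻¹) z ≤ D.CτV⁻¹ * wsq D.Cτ z := by
  rw [wsq, wsq, Finset.mul_sum]
  refine Finset.sum_le_sum fun i _ => ?_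
  rw [← mul_assoc]
  exact mul_le_mul_of_nonneg_right (hp.τ_inv_le i) (by positivity)

/-- The origin of `κ`: the column bound with `2 * p i - pmin ≤ 2 - pmin`, followed by the exchange
of `τ⁻¹` for `Cτ` at the price `CτV⁻¹`. -/
lemma sum_norm_A_le (hp : D.Parameters) (hβ : ∀ i, 0 ≤ D.β i) (z : Blk d) :
    ∑ i, D.p i * ∑ j, D.σ j * D.pr j * ‖D.A j i (z i)‖ ^ 2
      ≤ D.pmin ^ 2 * D.κ * wsq D.Cτ z := by
  have hm := hp.pmin_pos
  have h1 : ∀ i, D.p i * ∑ j, D.σ j * D.pr j * ‖D.A j i (z i)‖ ^ 2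
      ≤ D.pmin * (2 - D.pmin) * ((D.τ i)⁻¹ * ‖z i‖ ^ 2) := by
    intro i
    have hτ := inv_pos.2 (hp.τ_pos i)
    calc D.p i * ∑ j, D.σ j * D.pr j * ‖D.A j i (z i)‖ ^ 2
        ≤ D.p i * ∑ j, D.σ j * D.pr j * (‖D.A j i‖ * ‖z i‖) ^ 2 := by
          refine mul_le_mul_of_nonneg_left (Finset.sum_le_sum fun j _ => ?_) (hp.p_pos i).le
          refine mul_le_mul_of_nonneg_left ?_ (mul_nonneg (hp.σ_pos j).le (hp.pr_pos j).le)
          exact pow_le_pow_left₀ (norm_nonneg _) ((D.A j i).le_opNorm _) 2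
      _ = (D.p i * ∑ j, D.pr j * D.σ j * ‖D.A j i‖ ^ 2) * ‖z i‖ ^ 2 := by
          rw [mul_assoc, Finset.sum_mul]
          congr 1
          exact Finset.sum_congr rfl fun j _ => by ring
      _ ≤ (D.pmin * (2 * D.p i - D.pmin) * (D.τ i)⁻¹) * ‖z i‖ ^ 2 :=
          mul_le_mul_of_nonneg_right (hp.column_le hβ i) (by positivity)
      _ ≤ (D.pmin * (2 - D.pmin) * (D.τ i)⁻¹) * ‖z i‖ ^ 2 := by
          have := hp.p_le_one i
          gcongr
          linarith
      _ = _ := by ring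
  calc _ ≤ ∑ i, D.pmin * (2 - D.pmin) * ((D.τ i)⁻¹ * ‖z i‖ ^ 2) :=
        Finset.sum_le_sum fun i _ => h1 i
    _ = D.pmin * (2 - D.pmin) * wsq (fun i => (D.τ i)⁻¹) z := by rw [wsq, Finset.mul_sum]
    _ ≤ D.pmin * (2 - D.pmin) * (D.CτV⁻¹ * wsq D.Cτ z) := by
        refine mul_le_mul_of_nonneg_left (hp.wsq_τ_inv_le z) (mul_nonneg hm.le ?_)
        linarith [hp.pmin_le_one]
    _ = _ := by rw [κ]; field_simp

/-- The definition of `θ` gives `wy j * (σ j * θ j) ^ 2 = σ j * pr j / pmin ^ 2`. -/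
lemma sum_norm_A_θ_eq (hp : D.Parameters) (z : Blk d) :
    ∑ j, ∑ i, D.p i * (D.wy j * ((D.σ j * D.θ j) ^ 2 * ‖D.A j i (z i)‖ ^ 2))
      = (D.pmin ^ 2)⁻¹ * ∑ i, D.p i * ∑ j, D.σ j * D.pr j * ‖D.A j i (z i)‖ ^ 2 := by
  rw [Finset.sum_comm, Finset.mul_sum]
  refine Finset.sum_congr rfl fun i _ => ?_
  rw [Finset.mul_sum, Finset.mul_sum]
  refine Finset.sum_congr rfl fun j _ => ?_
  have h1 := (hp.pr_pos j).ne'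
  have h2 := (hp.σ_pos j).ne'
  have h3 := hp.pmin_pos.ne'
  rw [hp.θ_eq, wy]
  field_simp

lemma sum_norm_A_θ_le (hp : D.Parameters) (hβ : ∀ i, 0 ≤ D.β i) (z : Blk d) :
    ∑ j, ∑ i, D.p i * (D.wy j * ((D.σ j * D.θ j) ^ 2 * ‖D.A j i (z i)‖ ^ 2))
      ≤ D.κ * wsq D.Cτ z := by
  have hm := hp.pmin_pos
  rw [hp.sum_norm_A_θ_eq, inv_mul_le_iff₀ (by positivity), ← mul_assoc]
  exact hp.sum_norm_A_le hβ z

/-- Second moment of the primal step. -/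
lemma moment_x (hp : D.Parameters) (x x' : Blk d) :
    ∑ i, D.p i * wsq D.wx (setBlk x i (x' i) - x) ≤ D.CτV⁻¹ * wsq D.Cτ (x' - x) := by
  refine le_trans (le_of_eq ?_) (hp.wsq_τ_inv_le _)
  rw [wsq]
  refine Finset.sum_congr rfl fun i _ => ?_
  have := (hp.p_pos i).ne'
  rw [sum_wsq_setBlk, sub_self, wsq_zero, sub_self, norm_zero, wx, PiLp.sub_apply]
  field_simp
  ring

/-- Second moment of the image of the primal step. -/
lemma moment_Ax (hp : D.Parameters) (hβ : ∀ i, 0 ≤ D.β i) (x x' : Blk d) :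
    ∑ i, D.p i * wsq (fun j => D.σ j * D.pr j) (D.mulA (setBlk x i (x' i)) - D.mulA x)
      ≤ D.pmin ^ 2 * D.κ * wsq D.Cτ (x' - x) := by
  refine le_trans (le_of_eq ?_) (hp.sum_norm_A_le hβ (x' - x))
  refine Finset.sum_congr rfl fun i _ => ?_
  simp only [← mulA_sub, wsq, mulA_setBlk_sub, PiLp.sub_apply]

/-- Second moment of the dual step. -/
lemma moment_y (hp : D.Parameters) (hβ : ∀ i, 0 ≤ D.β i) (x x' : Blk d) (y y' : Blk e) :
    ∑ i, D.p i * wsq D.wy (D.stepY x x' y y' i - y)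
      ≤ 2 * wsq (fun j => (D.σ j)⁻¹) (y' - y) + 2 * (D.κ * wsq D.Cτ (x' - x)) := by
  have h1 : ∀ i, wsq D.wy (D.stepY x x' y y' i - y)
      ≤ ∑ j, (if j ∈ D.J i then 2 * (D.wy j * ‖y' j - y j‖ ^ 2)
        + 2 * (D.wy j * ((D.σ j * D.θ j) ^ 2 * ‖D.A j i ((x' - x) i)‖ ^ 2)) else 0) := by
    intro i
    refine Finset.sum_le_sum fun j _ => ?_
    simp only [stepY, PiLp.sub_apply]
    split_ifs with h
    · have h2 : y' j + (D.σ j * D.θ j) • D.A j i (x' i - x i) - y j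
          = (y' j - y j) + (D.σ j * D.θ j) • D.A j i (x' i - x i) := by abel
      rw [h2]
      have h3 := norm_add_sq_real (y' j - y j) ((D.σ j * D.θ j) • D.A j i (x' i - x i))
      have h4 := norm_sub_sq_real (y' j - y j) ((D.σ j * D.θ j) • D.A j i (x' i - x i))
      have h5 := sq_nonneg ‖(y' j - y j) - (D.σ j * D.θ j) • D.A j i (x' i - x i)‖
      have h6 : ‖(D.σ j * D.θ j) • D.A j i (x' i - x i)‖ ^ 2
          = (D.σ j * D.θ j) ^ 2 * ‖D.A j i (x' i - x i)‖ ^ 2 := by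
        rw [norm_smul, mul_pow, Real.norm_eq_abs, sq_abs]
      rw [← h6]
      have h7 := mul_le_mul_of_nonneg_left (by linarith :
        ‖(y' j - y j) + (D.σ j * D.θ j) • D.A j i (x' i - x i)‖ ^ 2 ≤ 2 * ‖y' j - y j‖ ^ 2
          + 2 * ‖(D.σ j * D.θ j) • D.A j i (x' i - x i)‖ ^ 2) (hp.wy_pos j).le
      linarith
    · simp
  refine (Finset.sum_le_sum fun i _ => mul_le_mul_of_nonneg_left (h1 i) (hp.p_pos i).le).trans ?_
  rw [hp.sum_sum_ite_J]
  have h2 : ∀ j, ∑ i ∈ D.I j, D.p i * (2 * (D.wy j * ‖y' j - y j‖ ^ 2)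
        + 2 * (D.wy j * ((D.σ j * D.θ j) ^ 2 * ‖D.A j i ((x' - x) i)‖ ^ 2))) + (1 - D.pr j) * 0
      = 2 * ((D.σ j)⁻¹ * ‖y' j - y j‖ ^ 2)
        + 2 * ∑ i, D.p i * (D.wy j * ((D.σ j * D.θ j) ^ 2 * ‖D.A j i ((x' - x) i)‖ ^ 2)) := by
    intro j
    rw [← sum_I_eq D j _ (fun i hi => by simp [hi])]
    simp only [mul_add, Finset.sum_add_distrib, ← Finset.sum_mul, Finset.mul_sum]
    have h3 := (hp.pr_pos j).ne'
    rw [show ∑ i ∈ D.I j, D.p i = D.pr j from rfl, wy, mul_zero, add_zero]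
    congr 1
    · field_simp
    · exact Finset.sum_congr rfl fun i _ => by ring
  simp only [h2, Finset.sum_add_distrib, ← Finset.mul_sum]
  have := hp.sum_norm_A_θ_le hβ (x' - x)
  simp only [wsq, PiLp.sub_apply] at this ⊢
  linarith

/-- Second moment of the step of the auxiliary dual sequence. -/
lemma moment_yb (hp : D.Parameters) (y' z : Blk e) :
    ∑ i, D.p i * wsq D.wy (D.stepYb y' z i - z) = wsq (fun j => (D.σ j)⁻¹) (y' - z) := by
  have h1 : ∀ i, wsq D.wy (D.stepYb y' z i - z)
      = ∑ j, (if j ∈ D.J i then D.wy j * ‖y' j - z j‖ ^ 2 else 0) := by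
    intro i
    refine Finset.sum_congr rfl fun j _ => ?_
    simp only [stepYb, PiLp.sub_apply]
    split_ifs with h <;> simp
  simp only [h1]
  rw [hp.sum_sum_ite_J (fun _ j => D.wy j * ‖y' j - z j‖ ^ 2) (fun _ => 0), wsq]
  refine Finset.sum_congr rfl fun j _ => ?_
  have h3 := (hp.pr_pos j).ne'
  rw [← Finset.sum_mul, show ∑ i ∈ D.I j, D.p i = D.pr j from rfl, wy, PiLp.sub_apply]
  field_simp
  ring

/-- Recursion for the distance between the two dual sequences. -/
lemma moment_y_sub_yb (hp : D.Parameters) (hβ : ∀ i, 0 ≤ D.β i) (x x' : Blk d)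
    (y y' z : Blk e) :
    ∑ i, D.p i * wsq D.wy (D.stepY x x' y y' i - D.stepYb y' z i)
      ≤ wsq D.wy (y - z) - wsq (fun j => (D.σ j)⁻¹) (y - z) + D.κ * wsq D.Cτ (x' - x) := by
  -- In a refreshed row both sequences restart from `y'`, so only the extrapolation separates them.
  -- The old difference survives with probability `1 - pr j`, and `pr j * wy j = (σ j)⁻¹` is the
  -- contraction.
  have h1 : ∀ i, wsq D.wy (D.stepY x x' y y' i - D.stepYb y' z i)
      = ∑ j, (if j ∈ D.J i then D.wy j * ((D.σ j * D.θ j) ^ 2 * ‖D.A j i ((x' - x) i)‖ ^ 2)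
        else D.wy j * ‖y j - z j‖ ^ 2) := by
    intro i
    refine Finset.sum_congr rfl fun j _ => ?_
    simp only [stepYb, stepY, PiLp.sub_apply]
    split_ifs with h
    · rw [add_sub_cancel_left, norm_smul, mul_pow, Real.norm_eq_abs, sq_abs]
    · rfl
  simp only [h1, hp.sum_sum_ite_J]
  rw [Finset.sum_add_distrib]
  have h2 := hp.sum_norm_A_θ_le hβ (x' - x)
  have h3 : ∑ j, (1 - D.pr j) * (D.wy j * ‖y j - z j‖ ^ 2)
      = wsq D.wy (y - z) - wsq (fun j => (D.σ j)⁻¹) (y - z) := by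
    rw [wsq, wsq, ← Finset.sum_sub_distrib]
    refine Finset.sum_congr rfl fun j _ => ?_
    have h3 := (hp.pr_pos j).ne'
    rw [wy, PiLp.sub_apply]
    field_simp
  have h4 : ∀ j, ∑ i ∈ D.I j,
      D.p i * (D.wy j * ((D.σ j * D.θ j) ^ 2 * ‖D.A j i ((x' - x) i)‖ ^ 2))
      = ∑ i, D.p i * (D.wy j * ((D.σ j * D.θ j) ^ 2 * ‖D.A j i ((x' - x) i)‖ ^ 2)) :=
    fun j => sum_I_eq D j _ (fun i hi => by simp [hi])
  simp only [h4]
  linarith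

/-- Mean of a separable function, with weights `pmin / π`, along the auxiliary dual sequence. -/
lemma mean_yb (hp : D.Parameters) (ψ : ∀ j, EuclideanSpace ℝ (Fin (e j)) → ℝ) (y' z : Blk e) :
    ∑ i, D.p i * ∑ j, D.pmin * (D.pr j)⁻¹ * ψ j (D.stepYb y' z i j)
      = D.pmin * ∑ j, ψ j (y' j) + ∑ j, D.pmin * (D.pr j)⁻¹ * ψ j (z j)
        - D.pmin * ∑ j, ψ j (z j) := by
  have h1 : ∀ i j, D.pmin * (D.pr j)⁻¹ * ψ j (D.stepYb y' z i j)
      = if j ∈ D.J i then D.pmin * (D.pr j)⁻¹ * ψ j (y' j)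
        else D.pmin * (D.pr j)⁻¹ * ψ j (z j) := by
    intro i j
    simp only [stepYb]
    split_ifs <;> rfl
  simp only [h1, hp.sum_sum_ite_J]
  rw [Finset.mul_sum, Finset.mul_sum, ← Finset.sum_add_distrib, ← Finset.sum_sub_distrib]
  refine Finset.sum_congr rfl fun j _ => ?_
  have h3 := (hp.pr_pos j).ne'
  -- The weight `wy` is not involved in the surviving factor: the refresh probability `pr j` cancels
  -- against the weight `pmin / pr j`.
  rw [← Finset.sum_mul, show ∑ i ∈ D.I j, D.p i = D.pr j from rfl]
  field_simp
  ring

/-- Mean of the distance of the dual step to a reference point. -/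
lemma mean_wsq_y (hp : D.Parameters) (x x' : Blk d) (y y' v : Blk e) :
    D.pmin / 2 * ∑ i, D.p i * wsq D.wy (D.stepY x x' y y' i - v)
      = D.pmin / 2 * wsq D.wy (y - v) - D.pmin / 2 * wsq (fun j => (D.σ j)⁻¹) (y - v)
        + D.pmin / 2 * wsq (fun j => (D.σ j)⁻¹) (y' - v)
        + ∑ i, D.p i * ⟪D.mulAT (y' - v) i, x' i - x i⟫
        + D.pmin / 2 * ((D.pmin ^ 2)⁻¹ *
          ∑ i, D.p i * ∑ j, D.σ j * D.pr j * ‖D.A j i ((x' - x) i)‖ ^ 2) := by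
  have hm := hp.pmin_pos.ne'
  have h1 : ∀ i, wsq D.wy (D.stepY x x' y y' i - v)
      = ∑ j, (if j ∈ D.J i then D.wy j * ‖y' j - v j‖ ^ 2
        + (2 * D.pmin⁻¹ * ⟪y' j - v j, D.A j i (x' i - x i)⟫
          + D.wy j * ((D.σ j * D.θ j) ^ 2 * ‖D.A j i ((x' - x) i)‖ ^ 2))
        else D.wy j * ‖y j - v j‖ ^ 2) := by
    intro i
    refine Finset.sum_congr rfl fun j _ => ?_
    simp only [stepY, PiLp.sub_apply]
    split_ifs with h
    -- Since `wy j * σ j * θ j = pmin⁻¹` does not depend on the row, the cross terms assemble into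
    -- `Aᵀ (y' - v)`.
    · have h2 : y' j + (D.σ j * D.θ j) • D.A j i (x' i - x i) - v j
          = (y' j - v j) + (D.σ j * D.θ j) • D.A j i (x' i - x i) := by abel
      have h3 := (hp.pr_pos j).ne'
      have h4 := (hp.σ_pos j).ne'
      rw [h2, norm_add_sq_real, norm_smul, mul_pow, Real.norm_eq_abs, sq_abs, inner_smul_right,
        mul_add, mul_add, add_assoc, hp.θ_eq, wy]
      congr 2
      field_simp
    · rfl
  have h2 : ∀ j, ∑ i ∈ D.I j, D.p i * (D.wy j * ‖y' j - v j‖ ^ 2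
        + (2 * D.pmin⁻¹ * ⟪y' j - v j, D.A j i (x' i - x i)⟫
          + D.wy j * ((D.σ j * D.θ j) ^ 2 * ‖D.A j i ((x' - x) i)‖ ^ 2)))
        + (1 - D.pr j) * (D.wy j * ‖y j - v j‖ ^ 2)
      = (D.wy j * ‖y j - v j‖ ^ 2 - (D.σ j)⁻¹ * ‖y j - v j‖ ^ 2
        + (D.σ j)⁻¹ * ‖y' j - v j‖ ^ 2)
        + (2 * D.pmin⁻¹ * ∑ i, D.p i * ⟪y' j - v j, D.A j i (x' i - x i)⟫
        + ∑ i, D.p i * (D.wy j * ((D.σ j * D.θ j) ^ 2 * ‖D.A j i ((x' - x) i)‖ ^ 2))) := by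
    intro j
    rw [← sum_I_eq D j (fun i => ⟪y' j - v j, D.A j i (x' i - x i)⟫) (fun i hi => by simp [hi]),
      ← sum_I_eq D j (fun i => D.wy j * ((D.σ j * D.θ j) ^ 2 * ‖D.A j i ((x' - x) i)‖ ^ 2))
        (fun i hi => by simp [hi])]
    have h3 := (hp.pr_pos j).ne'
    simp only [mul_add, Finset.sum_add_distrib, ← Finset.sum_mul]
    rw [show ∑ i ∈ D.I j, D.p i = D.pr j from rfl, Finset.mul_sum]
    have h4 : ∑ i ∈ D.I j, D.p i * (2 * D.pmin⁻¹ * ⟪y' j - v j, D.A j i (x' i - x i)⟫)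
        = ∑ i ∈ D.I j, 2 * D.pmin⁻¹ * (D.p i * ⟪y' j - v j, D.A j i (x' i - x i)⟫) :=
      Finset.sum_congr rfl fun i _ => by ring
    rw [h4]
    have h5 : D.pr j * (D.wy j * ‖y' j - v j‖ ^ 2) = (D.σ j)⁻¹ * ‖y' j - v j‖ ^ 2 := by
      rw [wy]; field_simp
    have h6 : D.pr j * (D.wy j * ‖y j - v j‖ ^ 2) = (D.σ j)⁻¹ * ‖y j - v j‖ ^ 2 := by
      rw [wy]; field_simp
    rw [h5, sub_mul, h6]
    ring
  have h3 : ∑ j, ∑ i, D.p i * ⟪y' j - v j, D.A j i (x' i - x i)⟫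
      = ∑ i, D.p i * ⟪D.mulAT (y' - v) i, x' i - x i⟫ := by
    rw [Finset.sum_comm]
    refine Finset.sum_congr rfl fun i _ => ?_
    simp only [mulAT, PiLp.sub_apply, sum_inner, ContinuousLinearMap.adjoint_inner_left,
      Finset.mul_sum]
  simp only [h1, hp.sum_sum_ite_J, h2]
  simp only [Finset.sum_add_distrib, Finset.sum_sub_distrib, ← Finset.mul_sum]
  rw [h3, hp.sum_norm_A_θ_eq]
  simp only [wsq, PiLp.sub_apply]
  field_simp
  ring

end Parameters

end Data
namespace Data

variable {n m : ℕ} {d : Fin n → ℕ} {e : Fin m → ℕ} (D : Data d e)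

/-! ### Real-valued versions of the functions -/

/-- The real part of `g i`. -/
def gr (i : Fin n) (z : EuclideanSpace ℝ (Fin (d i))) : ℝ := (D.g i z).toReal

/-- The real part of the conjugate of `h j`. -/
def hr (j : Fin m) (z : EuclideanSpace ℝ (Fin (e j))) : ℝ := (conj (D.h j) z).toReal

/-- Membership in the domain of `g`, block by block. -/
def MemX (x : Blk d) : Prop := ∀ i, x i ∈ dom (D.g i)

/-- Membership in the domain of `h^*`, block by block. -/
def MemY (y : Blk e) : Prop := ∀ j, y j ∈ dom (conj (D.h j))

/-- `f + g` with the real part of `g`. -/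
def Fr (x : Blk d) : ℝ := D.f x + ∑ i, D.gr i (x i)

/-- The real part of `h^*`. -/
def Hr (y : Blk e) : ℝ := ∑ j, D.hr j (y j)

/-- The Lyapunov function `F x + ⟪A x, v⟫ + V (x - u, y - v)`. -/
def Q (u : Blk d) (v : Blk e) (x : Blk d) (y : Blk e) : ℝ :=
  D.Fr x + ⟪D.mulA x, v⟫ + D.V (x - u) (y - v)

/-- `x'` and `y'` are the full proximal steps from `x` and `y`. -/
structure IsStep (x x' : Blk d) (y y' : Blk e) : Prop where
  dual : IsProx D.σ D.hConj (y + WithLp.toLp 2 (fun j => D.σ j • D.mulA x j)) y'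
  primal : IsProx D.τ D.gSum
    (x - WithLp.toLp 2 (fun i => D.τ i • (gradient D.f x + D.mulAT y') i)) x'

variable {D}

/-! ### Gaps to a solution and the one-step descent inequality -/

namespace Assumptions

lemma sep_g (hD : D.Assumptions) : SepConvex D.gSum (fun i => dom (D.g i)) D.gr :=
  sepConvex_sum (fun i => (hD.g_plc i).ne_bot) (fun i => (hD.g_plc i).convex)

lemma hConj_eq (hD : D.Assumptions) (y : Blk e) : D.hConj y = ∑ j, conj (D.h j) (y j) :=
  conj_sum (fun j => (hD.h_plc j).ne_bot) (fun j => (hD.h_plc j).dom_nonempty) y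

lemma sep_h (hD : D.Assumptions) : SepConvex D.hConj (fun j => dom (conj (D.h j))) D.hr := by
  have h : D.hConj = fun y => ∑ j, conj (D.h j) (y j) := funext hD.hConj_eq
  rw [h]
  exact sepConvex_sum (fun j => conj_ne_bot (hD.h_plc j).dom_nonempty)
    (fun j => conj_convex (hD.h_plc j).ne_bot)

lemma memX_iff (hD : D.Assumptions) {x : Blk d} : x ∈ dom D.gSum ↔ D.MemX x :=
  hD.sep_g.ne_top x

lemma memY_iff (hD : D.Assumptions) {y : Blk e} : y ∈ dom D.hConj ↔ D.MemY y :=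
  hD.sep_h.ne_top y

lemma F_eq (hD : D.Assumptions) {x : Blk d} (hx : D.MemX x) : D.F x = D.Fr x := by
  rw [F, Fr, hD.sep_g.toReal_eq hx]

lemma hConj_toReal (hD : D.Assumptions) {y : Blk e} (hy : D.MemY y) :
    (D.hConj y).toReal = D.Hr y := hD.sep_h.toReal_eq hy

/-- Nonnegativity of the primal gap to a solution. -/
lemma primal_gap_nonneg (hD : D.Assumptions) {xs : Blk d} {ys : Blk e}
    (hs : D.IsSolution xs ys) {x : Blk d} (hx : D.MemX x) :
    0 ≤ D.Fr x - D.Fr xs + ⟪D.mulA (x - xs), ys⟫ := by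
  obtain ⟨⟨hxs, h1⟩, -⟩ := hs
  have h2 := h1 x
  rw [hD.sep_g.coe x hx, hD.sep_g.coe xs (hD.memX_iff.1 hxs), ← EReal.coe_add,
    EReal.coe_le_coe_iff, inner_neg_left, inner_add_left, inner_mulAT_left] at h2
  have h3 := gradient_inequality hD.f_convex hD.f_diff xs x
  rw [Fr, Fr]
  linarith

/-- Nonnegativity of each block of the dual gap to a solution. -/
lemma dual_gap_nonneg (hD : D.Assumptions) {xs : Blk d} {ys : Blk e}
    (hs : D.IsSolution xs ys) {y : Blk e} (hy : D.MemY y) (j : Fin m) :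
    0 ≤ D.hr j (y j) - D.hr j (ys j) - ⟪D.mulA xs j, y j - ys j⟫ := by
  obtain ⟨-, hys, h1⟩ := hs
  have hys' : D.MemY ys := hD.memY_iff.1 hys
  -- A test point differing from `ys` only in row `j` isolates that row. Rowwise signs are needed
  -- later because the dual correction weights the rows unequally.
  have hmem : D.MemY (setBlk ys j (y j)) := setBlk_mem hys' (hy j)
  have h2 := h1 (setBlk ys j (y j))
  rw [hD.sep_h.coe _ hmem, hD.sep_h.coe _ hys', ← EReal.coe_add,
    EReal.coe_le_coe_iff, sum_setBlk, PiLp.inner_apply] at h2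
  simp only [PiLp.sub_apply] at h2
  rw [sum_setBlk ys j (y j) (fun l z => ⟪D.mulA xs l, z - ys l⟫)] at h2
  simp only [sub_self, inner_zero_right, Finset.sum_const_zero] at h2
  linarith

lemma dual_gap_sum_nonneg (hD : D.Assumptions) {xs : Blk d} {ys : Blk e}
    (hs : D.IsSolution xs ys) {y : Blk e} (hy : D.MemY y) :
    0 ≤ D.Hr y - D.Hr ys - ⟪D.mulA xs, y - ys⟫ := by
  have h := Finset.sum_nonneg fun j (_ : j ∈ Finset.univ) => hD.dual_gap_nonneg hs hy j
  rw [Finset.sum_sub_distrib, Finset.sum_sub_distrib] at h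
  simpa [Hr, PiLp.inner_apply] using h

lemma memX_of_isStep (hD : D.Assumptions) {x x' : Blk d} {y y' : Blk e} (h : D.IsStep x x' y y')
    (hne : ∃ z, D.MemX z) : D.MemX x' :=
  h.primal.mem hD.sep_g hne

lemma memY_of_isStep (hD : D.Assumptions) {x x' : Blk d} {y y' : Blk e} (h : D.IsStep x x' y y')
    (hne : ∃ z, D.MemY z) : D.MemY y' :=
  h.dual.mem hD.sep_h hne

lemma isStep_unique (hD : D.Assumptions) (hp : D.Parameters) {x x₁ x₂ : Blk d} {y y₁ y₂ : Blk e}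
    (h₁ : D.IsStep x x₁ y y₁) (h₂ : D.IsStep x x₂ y y₂)
    (hx : ∃ z, D.MemX z) (hy : ∃ z, D.MemY z) : x₁ = x₂ ∧ y₁ = y₂ := by
  have hy' : y₁ = y₂ := h₁.dual.unique hD.sep_h hy hp.σ_pos h₂.dual
  subst hy'
  exact ⟨h₁.primal.unique hD.sep_g hx hp.τ_pos h₂.primal, rfl⟩

/-- The dual step decreases the dual objective. -/
lemma dual_step (hD : D.Assumptions) (hp : D.Parameters) {x x' : Blk d} {y y' v : Blk e}
    (h : D.IsStep x x' y y') (hv : D.MemY v) :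
    D.Hr y' ≤ D.Hr v - ⟪D.mulA x, v - y'⟫
      + 1 / 2 * (wsq (fun j => (D.σ j)⁻¹) (y - v) - wsq (fun j => (D.σ j)⁻¹) (y' - v)
        - wsq (fun j => (D.σ j)⁻¹) (y' - y)) := by
  have hy' := hD.memY_of_isStep h ⟨v, hv⟩
  have h1 : ∀ j, D.hr j (y' j) ≤ D.hr j (v j) - ⟪D.mulA x j, v j - y' j⟫
      + 1 / 2 * ((D.σ j)⁻¹ * ‖y j - v j‖ ^ 2 - (D.σ j)⁻¹ * ‖y' j - v j‖ ^ 2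
        - (D.σ j)⁻¹ * ‖y' j - y j‖ ^ 2) := by
    intro j
    have h2 := h.dual.variational hD.sep_h hy' j (hv j)
    have h3 : y' j - (y + WithLp.toLp 2 (fun j => D.σ j • D.mulA x j)) j
        = (y' j - y j) - D.σ j • D.mulA x j := by
      simp only [PiLp.add_apply]; abel
    have h4 : y j - v j = -((v j - y' j) + (y' j - y j)) := by abel
    have h5 : ‖y j - v j‖ ^ 2 = ‖v j - y' j‖ ^ 2 + 2 * ⟪y' j - y j, v j - y' j⟫
        + ‖y' j - y j‖ ^ 2 := by
      rw [h4, norm_neg, norm_add_sq_real, real_inner_comm]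
    have hσ := (hp.σ_pos j).ne'
    rw [h3, inner_sub_left, real_inner_smul_left, mul_sub, inv_mul_cancel_left₀ hσ] at h2
    rw [h5, norm_sub_rev (v j)]
    linarith
  have h2 := Finset.sum_le_sum fun j (_ : j ∈ Finset.univ) => h1 j
  simp only [Finset.sum_add_distrib, Finset.sum_sub_distrib, ← Finset.mul_sum] at h2
  simpa only [Hr, wsq, PiLp.inner_apply, PiLp.sub_apply] using h2

/-- The primal step in one block. -/
lemma primal_block (hD : D.Assumptions) (hp : D.Parameters) {x x' u : Blk d} {y y' : Blk e}
    (h : D.IsStep x x' y y') (hx : D.MemX x) (hu : D.MemX u) (i : Fin n) :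
    D.p i * (D.gr i (x' i) - D.gr i (x i))
        + D.p i * ⟪gradient D.f x i, x' i - x i⟫
        + D.p i * ⟪D.mulAT y' i, x' i - x i⟫
        + D.pmin / 2 * ((D.τ i)⁻¹ * (‖x' i - u i‖ ^ 2 - ‖x i - u i‖ ^ 2))
        + (2 * D.p i - D.pmin) / 2 * (D.τ i)⁻¹ * ‖x' i - x i‖ ^ 2
      ≤ D.pmin * (D.gr i (u i) - D.gr i (x i))
        + D.pmin * ⟪gradient D.f x i, u i - x i⟫
        + D.pmin * ⟪D.mulAT y' i, u i - x i⟫ := by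
  have hx' := hD.memX_of_isStep h ⟨x, hx⟩
  have hτ := (hp.τ_pos i).ne'
  have h3 : x' i - (x - WithLp.toLp 2 (fun i => D.τ i • (gradient D.f x + D.mulAT y') i)) i
      = (x' i - x i) + D.τ i • (gradient D.f x i + D.mulAT y' i) := by
    simp only [PiLp.sub_apply, PiLp.add_apply]; abel
  have hvi : ∀ w ∈ dom (D.g i), D.gr i (x' i) ≤ D.gr i w + (D.τ i)⁻¹ * ⟪x' i - x i, w - x' i⟫
      + ⟪gradient D.f x i, w - x' i⟫ + ⟪D.mulAT y' i, w - x' i⟫ := by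
    intro w hw
    have h2 := h.primal.variational hD.sep_g hx' i hw
    rw [h3, inner_add_left, real_inner_smul_left, mul_add, inv_mul_cancel_left₀ hτ,
      inner_add_left] at h2
    linarith
  -- The comparison point is tested with weight `pmin` and the current point with weight `p i -
  -- pmin`. The squared step then has coefficient `pmin / 2 + (p i - pmin) = (2 * p i - pmin) / 2`,
  -- up to `(τ i)⁻¹`.
  have e1 := hvi _ (hu i)
  have e2 := hvi _ (hx i)
  have h4 : ⟪x' i - x i, x i - x' i⟫ = -‖x' i - x i‖ ^ 2 := by
    rw [← neg_sub (x' i) (x i), inner_neg_right, real_inner_self_eq_norm_sq]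
  have h5 : ∀ a : EuclideanSpace ℝ (Fin (d i)), ⟪a, x i - x' i⟫ = -⟪a, x' i - x i⟫ := by
    intro a; rw [← neg_sub (x' i) (x i), inner_neg_right]
  have h6 : ∀ a : EuclideanSpace ℝ (Fin (d i)),
      ⟪a, u i - x' i⟫ = ⟪a, u i - x i⟫ - ⟪a, x' i - x i⟫ := by
    intro a; rw [← inner_sub_right]; congr 1; abel
  have h7 : ‖x i - u i‖ ^ 2 = ‖x' i - u i‖ ^ 2 + 2 * ⟪x' i - x i, u i - x' i⟫
      + ‖x' i - x i‖ ^ 2 := by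
    have : x i - u i = -((u i - x' i) + (x' i - x i)) := by abel
    rw [this, norm_neg, norm_add_sq_real, real_inner_comm, norm_sub_rev (x' i) (u i)]
  rw [h4, h5, h5] at e2
  rw [h6 (gradient D.f x i), h6 (D.mulAT y' i)] at e1
  have e3 := mul_le_mul_of_nonneg_left e1 hp.pmin_pos.le
  have e4 := mul_le_mul_of_nonneg_left e2 (sub_nonneg.2 (hp.pmin_le i))
  rw [h7]
  linarith

/-- The fundamental inequality for one step, in mean over the drawn index. -/
lemma one_step (hD : D.Assumptions) (hp : D.Parameters) {x x' u : Blk d} {y y' v : Blk e}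
    (h : D.IsStep x x' y y') (hx : D.MemX x) (hu : D.MemX u) (hv : D.MemY v) :
    ∑ i, D.p i * D.Q u v (setBlk x i (x' i)) (D.stepY x x' y y' i)
      ≤ D.Q u v x y - D.pmin * (D.Fr x + ⟪D.mulA x, v⟫) + D.pmin * D.Fr u + D.pmin * D.Hr v
        - D.pmin * (D.Hr y' - ⟪D.mulA u, y'⟫)
        - D.pmin / 2 * wsq D.Cτ (x' - x) - D.pmin / 2 * wsq (fun j => (D.σ j)⁻¹) (y' - y) := by
  have hm := hp.pmin_pos
  have hF : ∀ i, D.Fr (setBlk x i (x' i)) ≤ D.Fr x + ((D.gr i (x' i) - D.gr i (x i))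
      + ⟪gradient D.f x i, x' i - x i⟫ + D.β i / 2 * ‖x' i - x i‖ ^ 2) := by
    intro i
    have h1 := hD.f_smooth x i (x' i - x i)
    rw [Fr, Fr, sum_setBlk]
    rw [setBlk]
    linarith
  have hA : ∀ i, ⟪D.mulA (setBlk x i (x' i)), v⟫
      = ⟪D.mulA x, v⟫ + ⟪D.mulAT v i, x' i - x i⟫ := by
    intro i
    rw [setBlk, mulA_add, inner_add_left, inner_mulA _ (PiLp.single 2 i _)]
    congr 1
    rw [PiLp.inner_apply, Finset.sum_eq_single i]
    · simp [real_inner_comm]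
    · intro l _ hl; simp [hl]
    · simp
  have hV : ∀ i, D.V (setBlk x i (x' i) - u) (D.stepY x x' y y' i - v)
      = D.pmin / 2 * wsq D.wx (x - u)
        + D.pmin / 2 * (D.wx i * (‖x' i - u i‖ ^ 2 - ‖x i - u i‖ ^ 2))
        + D.pmin / 2 * wsq D.wy (D.stepY x x' y y' i - v) := by
    intro i
    rw [V, sum_wsq_setBlk]
    ring
  have h1 : ∑ i, D.p i * D.Q u v (setBlk x i (x' i)) (D.stepY x x' y y' i)
      ≤ D.Fr x + ⟪D.mulA x, v⟫ + D.pmin / 2 * wsq D.wx (x - u)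
        + ∑ i, (D.p i * (D.gr i (x' i) - D.gr i (x i))
          + D.p i * ⟪gradient D.f x i, x' i - x i⟫
          + D.p i * (D.β i / 2 * ‖x' i - x i‖ ^ 2)
          + D.p i * ⟪D.mulAT v i, x' i - x i⟫
          + D.pmin / 2 * ((D.τ i)⁻¹ * (‖x' i - u i‖ ^ 2 - ‖x i - u i‖ ^ 2)))
        + D.pmin / 2 * ∑ i, D.p i * wsq D.wy (D.stepY x x' y y' i - v) := by
    have h2 : D.Fr x + ⟪D.mulA x, v⟫ + D.pmin / 2 * wsq D.wx (x - u)
        = ∑ i, D.p i * (D.Fr x + ⟪D.mulA x, v⟫ + D.pmin / 2 * wsq D.wx (x - u)) := by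
      rw [← Finset.sum_mul, hp.p_sum, one_mul]
    rw [h2, ← Finset.sum_add_distrib, Finset.mul_sum, ← Finset.sum_add_distrib]
    refine Finset.sum_le_sum fun i _ => ?_
    rw [Q, hA, hV]
    have h3 := mul_le_mul_of_nonneg_left (hF i) (hp.p_pos i).le
    have h4 : D.p i * (D.pmin / 2 * (D.wx i * (‖x' i - u i‖ ^ 2 - ‖x i - u i‖ ^ 2)))
        = D.pmin / 2 * ((D.τ i)⁻¹ * (‖x' i - u i‖ ^ 2 - ‖x i - u i‖ ^ 2)) := by
      have := (hp.p_pos i).ne'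
      rw [wx]; field_simp
    linarith
  have h2 := hp.mean_wsq_y x x' y y' v
  have h3 := hD.dual_step hp h hv
  have h4 := Finset.sum_le_sum fun i (_ : i ∈ Finset.univ) => hD.primal_block hp h hx hu i
  have h5 := gradient_inequality hD.f_convex hD.f_diff x u
  -- The curvature gained from the proximal step pays for the smoothness error of `f` and for the
  -- second moment of the dual extrapolation; `Cτ` is what is left.
  have h6 : D.pmin / 2 * wsq D.Cτ (x' - x)
      ≤ ∑ i, (2 * D.p i - D.pmin) / 2 * (D.τ i)⁻¹ * ‖x' i - x i‖ ^ 2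
        - ∑ i, D.p i * (D.β i / 2 * ‖x' i - x i‖ ^ 2)
        - D.pmin / 2 * ((D.pmin ^ 2)⁻¹ *
          ∑ i, D.p i * ∑ j, D.σ j * D.pr j * ‖D.A j i ((x' - x) i)‖ ^ 2) := by
    rw [wsq, Finset.mul_sum, ← Finset.sum_sub_distrib, Finset.mul_sum, Finset.mul_sum,
      ← Finset.sum_sub_distrib]
    refine Finset.sum_le_sum fun i _ => ?_
    have hA1 : ∑ j, D.σ j * D.pr j * ‖D.A j i ((x' - x) i)‖ ^ 2
        ≤ (∑ j, D.pr j * D.σ j * ‖D.A j i‖ ^ 2) * ‖x' i - x i‖ ^ 2 := by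
      rw [Finset.sum_mul]
      refine Finset.sum_le_sum fun j _ => ?_
      have h7 := pow_le_pow_left₀ (norm_nonneg _) ((D.A j i).le_opNorm ((x' - x) i)) 2
      have h8 := mul_le_mul_of_nonneg_left h7 (mul_nonneg (hp.σ_pos j).le (hp.pr_pos j).le)
      refine h8.trans (le_of_eq ?_)
      rw [PiLp.sub_apply]; ring
    have h7 : D.pmin / 2 * ((D.pmin ^ 2)⁻¹ * (D.p i *
          ∑ j, D.σ j * D.pr j * ‖D.A j i ((x' - x) i)‖ ^ 2))
        ≤ D.pmin / 2 * ((D.pmin ^ 2)⁻¹ * (D.p i *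
          ((∑ j, D.pr j * D.σ j * ‖D.A j i‖ ^ 2) * ‖x' i - x i‖ ^ 2))) := by
      have := (hp.p_pos i).le
      gcongr
    have hC : D.pmin * D.Cτ i = (2 * D.p i - D.pmin) * (D.τ i)⁻¹ - D.β i * D.p i
        - D.pmin⁻¹ * D.p i * ∑ j, D.pr j * D.σ j * ‖D.A j i‖ ^ 2 := by
      have hτ := (hp.τ_pos i).ne'
      have h8 := hp.Cτ_mul_τ i
      field_simp at h8 ⊢
      linarith
    have h9 : D.pmin / 2 * (D.Cτ i * ‖(x' - x) i‖ ^ 2)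
        = (D.pmin * D.Cτ i) / 2 * ‖x' i - x i‖ ^ 2 := by rw [PiLp.sub_apply]; ring
    have h10 : D.pmin / 2 * ((D.pmin ^ 2)⁻¹ * (D.p i *
          ((∑ j, D.pr j * D.σ j * ‖D.A j i‖ ^ 2) * ‖x' i - x i‖ ^ 2)))
        = (D.pmin⁻¹ * D.p i * ∑ j, D.pr j * D.σ j * ‖D.A j i‖ ^ 2) / 2 * ‖x' i - x i‖ ^ 2 := by
      field_simp
    rw [h9, hC]
    rw [h10] at h7
    linarith
  simp only [Finset.sum_add_distrib, Finset.sum_sub_distrib, ← Finset.mul_sum] at h1 h4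
  have hi1 : ∑ i, ⟪gradient D.f x i, u i - x i⟫ = ⟪gradient D.f x, u - x⟫ := by
    rw [PiLp.inner_apply]; rfl
  have hi2 : ∑ i, ⟪D.mulAT y' i, u i - x i⟫ = ⟪D.mulA u, y'⟫ - ⟪D.mulA x, y'⟫ := by
    rw [← inner_sub_left, ← mulA_sub, ← inner_mulAT_left, PiLp.inner_apply]
    rfl
  -- The pairing with `v` cancels the one produced by `⟪A x, v⟫` in `Q`; the pairing with `y'` is
  -- the one present in `primal_block`.
  have hi3 : ∑ i, D.p i * ⟪D.mulAT (y' - v) i, x' i - x i⟫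
      = ∑ i, D.p i * ⟪D.mulAT y' i, x' i - x i⟫ - ∑ i, D.p i * ⟪D.mulAT v i, x' i - x i⟫ := by
    rw [← Finset.sum_sub_distrib]
    refine Finset.sum_congr rfl fun i _ => ?_
    rw [← mul_sub, ← inner_sub_left]
    congr 2
    simp [mulAT, Finset.sum_sub_distrib]
  rw [hi1, hi2] at h4
  rw [hi3] at h2
  have h3' := mul_le_mul_of_nonneg_left h3 hm.le
  have h5' := mul_le_mul_of_nonneg_left h5 hm.le
  rw [inner_sub_right] at h3'
  have hQ : D.Q u v x y = D.Fr x + ⟪D.mulA x, v⟫ + (D.pmin / 2 * wsq D.wx (x - u)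
      + D.pmin / 2 * wsq D.wy (y - v)) := rfl
  rw [hQ, Fr, Fr] at *
  linarith

end Assumptions

end Data

/-! ### Young's inequality with two constants; accumulated noise -/

section Weighted

variable {n : ℕ} {d : Fin n → ℕ}

/-- Young's inequality with weights and two constants. -/
lemma wip_le_add {s w w' : Fin n → ℝ} {a b : ℝ} (ha : 0 < a) (hw : ∀ i, 0 < w i)
    (h : ∀ i, s i ^ 2 ≤ 4 * a * b * (w i * w' i)) (x y : Blk d) :
    wip s x y ≤ a * wsq w x + b * wsq w' y := by
  have h1 := wip_le (w' := fun i => 4 * a * b * w' i) hw (fun i => (h i).trans (le_of_eq (by ring)))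
    (show (0 : ℝ) < 2 * a by linarith) x y
  have h2 : wsq (fun i => 4 * a * b * w' i) y = 4 * a * b * wsq w' y := by
    simp only [wsq, Finset.mul_sum, mul_assoc]
  rw [h2] at h1
  refine h1.trans (le_of_eq ?_)
  field_simp
  ring

lemma wip_sum_left {ι : Type*} (w : Fin n → ℝ) (y : Blk d) (s : Finset ι) (x : ι → Blk d) :
    wip w (∑ k ∈ s, x k) y = ∑ k ∈ s, wip w (x k) y := by
  rw [wip_comm, wip_sum_right]
  exact Finset.sum_congr rfl fun k _ => wip_comm _ _ _

lemma wip_sub_mean_left {ι : Type*} [Fintype ι] (w : Fin n → ℝ) (p : ι → ℝ) (x y : Blk d)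
    (a : ι → Blk d) :
    wip w (x - ∑ i, p i • a i) y = wip w x y - ∑ i, p i * wip w (a i) y := by
  rw [wip_sub_left, wip_sum_left]
  congr 1
  exact Finset.sum_congr rfl fun i _ => by rw [wip_comm, wip_smul_right, wip_comm]

lemma wip_const_mul (c : ℝ) (w : Fin n → ℝ) (x y : Blk d) :
    wip (fun i => c * w i) x y = c * wip w x y := by
  simp only [wip, Finset.mul_sum, mul_assoc]

lemma wsq_add_add_le {w : Fin n → ℝ} (hw : ∀ i, 0 ≤ w i) (x y z : Blk d) :
    wsq w (x + y + z) ≤ 3 * (wsq w x + wsq w y + wsq w z) := by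
  have h1 := wsq_nonneg hw (x - y)
  have h2 := wsq_nonneg hw (x - z)
  have h3 := wsq_nonneg hw (y - z)
  rw [wsq_sub] at h1 h2 h3
  rw [wsq_add, wsq_add, wip_add_left]
  linarith

/-- The accumulated deviation of a sequence from its mean predictions. -/
def noise {n c : ℕ} {d : Fin c → ℕ} (p : Fin n → ℝ) (G : ℕ → Blk d) (Gn : ℕ → Fin n → Blk d)
    (K : ℕ) : Blk d :=
  ∑ k ∈ Finset.range K, (G (k + 1) - ∑ i, p i • Gn k i)

end Weighted

/-! ### The Lyapunov function of the ergodic gap and its telescoping along a path -/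

namespace Data

variable {n m : ℕ} {d : Fin n → ℕ} {e : Fin m → ℕ} (D : Data d e)

/-- The sequences generated by the algorithm for a given sequence of indices. -/
structure IsPath (i : ℕ → Fin n) (x x' : ℕ → Blk d) (y y' z : ℕ → Blk e) : Prop where
  step : ∀ k, D.IsStep (x k) (x' k) (y k) (y' k)
  x_succ : ∀ k, x (k + 1) = setBlk (x k) (i k) (x' k (i k))
  y_succ : ∀ k, y (k + 1) = D.stepY (x k) (x' k) (y k) (y' k) (i k)
  z_succ : ∀ k, z (k + 1) = D.stepYb (y' k) (z k) (i k)
  zero : z 0 = y 0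
  memX : D.MemX (x 0)
  memY : D.MemY (y 0)

/-- The separable dual part of the Lyapunov function for the ergodic gap. -/
def L₂ (u : Blk d) (z : Blk e) : ℝ :=
  ∑ j, D.pmin * (D.pr j)⁻¹ * (D.hr j (z j) - ⟪D.mulA u j, z j⟫)

/-- The Lyapunov function for the ergodic gap. -/
def L (u : Blk d) (v : Blk e) (x : Blk d) (y z : Blk e) : ℝ := D.Q u v x y + D.L₂ u z

/-- The primal-dual gap between `(x, z)` and `(u, v)`. -/
def Γ (u : Blk d) (v : Blk e) (x : Blk d) (z : Blk e) : ℝ :=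
  D.Fr x + ⟪D.mulA x, v⟫ - D.Fr u - D.Hr v + D.Hr z - ⟪D.mulA u, z⟫

/-- The accumulated deviation of the Lyapunov function. -/
def scalarNoise (u : Blk d) (v : Blk e) (x x' : ℕ → Blk d) (y y' z : ℕ → Blk e) (K : ℕ) : ℝ :=
  ∑ k ∈ Finset.range K, (D.L u v (x (k + 1)) (y (k + 1)) (z (k + 1))
    - ∑ i, D.p i * D.L u v (setBlk (x k) i (x' k i)) (D.stepY (x k) (x' k) (y k) (y' k) i)
        (D.stepYb (y' k) (z k) i))

variable {D}

lemma mulA_sum {ι : Type*} (s : Finset ι) (x : ι → Blk d) :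
    D.mulA (∑ k ∈ s, x k) = ∑ k ∈ s, D.mulA (x k) := by
  classical
  induction s using Finset.induction_on with
  | empty => simpa using D.mulA_smul 0 0
  | insert a s ha ih => rw [Finset.sum_insert ha, Finset.sum_insert ha, mulA_add, ih]

lemma mulA_noise (p : Fin n → ℝ) (x : ℕ → Blk d) (xn : ℕ → Fin n → Blk d) (K : ℕ) :
    D.mulA (noise p x xn K) = noise p (fun k => D.mulA (x k)) (fun k i => D.mulA (xn k i)) K := by
  simp only [noise, mulA_sum, mulA_sub, mulA_smul]

/-- The Lyapunov function depends on the comparison point in an affine way, up to terms that do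
not depend on the iterates. -/
lemma L_sub_L (u x₀ : Blk d) (v y₀ : Blk e) (x : Blk d) (y z : Blk e) :
    D.L u v x y z = D.L x₀ y₀ x y z + (wip 1 (D.mulA x) (v - y₀)
      - D.pmin * wip D.wx x (u - x₀) - D.pmin * wip D.wy y (v - y₀)
      - D.pmin * wip (fun j => (D.pr j)⁻¹) z (D.mulA (u - x₀)))
      + (D.pmin / 2 * (wsq D.wx u - wsq D.wx x₀) + D.pmin / 2 * (wsq D.wy v - wsq D.wy y₀)) := by
  have h1 : D.L₂ u z = D.L₂ x₀ z - D.pmin * wip (fun j => (D.pr j)⁻¹) z (D.mulA (u - x₀)) := by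
    rw [L₂, L₂, wip, Finset.mul_sum, ← Finset.sum_sub_distrib]
    refine Finset.sum_congr rfl fun j _ => ?_
    rw [mulA_sub, PiLp.sub_apply, inner_sub_right, real_inner_comm (z j), real_inner_comm (z j)]
    ring
  rw [L, L, h1, Q, Q, V, V, wip_one, inner_sub_right]
  simp only [wsq_sub, wip_sub_right]
  ring

/-- Terms free of the iterates cancel between a state and its mean prediction, so the affine
dependence of `L_sub_L` becomes linear. The comparison point enters only through pairings with noise
vectors that do not involve it, so it may be chosen after the draws. -/
lemma scalarNoise_eq (hp : D.Parameters) (u x₀ : Blk d) (v y₀ : Blk e) (x x' : ℕ → Blk d)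
    (y y' z : ℕ → Blk e) (K : ℕ) :
    D.scalarNoise u v x x' y y' z K = D.scalarNoise x₀ y₀ x x' y y' z K
      + ⟪D.mulA (noise D.p x (fun k i => setBlk (x k) i (x' k i)) K), v - y₀⟫
      - D.pmin * wip D.wx (noise D.p x (fun k i => setBlk (x k) i (x' k i)) K) (u - x₀)
      - D.pmin * wip D.wy
        (noise D.p y (fun k i => D.stepY (x k) (x' k) (y k) (y' k) i) K) (v - y₀)
      - D.pmin * wip (fun j => (D.pr j)⁻¹)
        (noise D.p z (fun k i => D.stepYb (y' k) (z k) i) K) (D.mulA (u - x₀)) := by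
  rw [← wip_one, mulA_noise]
  simp only [scalarNoise, noise, wip_sum_left, wip_sub_mean_left, Finset.mul_sum,
    ← Finset.sum_sub_distrib, ← Finset.sum_add_distrib]
  refine Finset.sum_congr rfl fun k _ => ?_
  rw [L_sub_L u x₀ v y₀ (x (k + 1))]
  have h1 : ∀ i, D.p i * D.L u v (setBlk (x k) i (x' k i))
        (D.stepY (x k) (x' k) (y k) (y' k) i) (D.stepYb (y' k) (z k) i)
      = D.p i * D.L x₀ y₀ (setBlk (x k) i (x' k i))
        (D.stepY (x k) (x' k) (y k) (y' k) i) (D.stepYb (y' k) (z k) i)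
      + D.p i * wip 1 (D.mulA (setBlk (x k) i (x' k i))) (v - y₀)
      - D.pmin * (D.p i * wip D.wx (setBlk (x k) i (x' k i)) (u - x₀))
      - D.pmin * (D.p i * wip D.wy (D.stepY (x k) (x' k) (y k) (y' k) i) (v - y₀))
      - D.pmin * (D.p i * wip (fun j => (D.pr j)⁻¹) (D.stepYb (y' k) (z k) i)
        (D.mulA (u - x₀)))
      + D.p i * (D.pmin / 2 * (wsq D.wx u - wsq D.wx x₀)
        + D.pmin / 2 * (wsq D.wy v - wsq D.wy y₀)) := by
    intro i
    rw [L_sub_L u x₀ v y₀ (setBlk (x k) i (x' k i))]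
    ring
  simp only [h1, Finset.sum_add_distrib, Finset.sum_sub_distrib, ← Finset.sum_mul, hp.p_sum,
    ← Finset.mul_sum]
  ring

namespace IsPath

variable {i : ℕ → Fin n} {x x' : ℕ → Blk d} {y y' z : ℕ → Blk e}

lemma memX_all (hD : D.Assumptions) (h : D.IsPath i x x' y y' z) (k : ℕ) : D.MemX (x k) := by
  induction k with
  | zero => exact h.memX
  | succ k ih =>
    rw [h.x_succ]
    exact setBlk_mem ih (hD.memX_of_isStep (h.step k) ⟨_, ih⟩ _)

lemma memY' (hD : D.Assumptions) (h : D.IsPath i x x' y y' z) (k : ℕ) : D.MemY (y' k) :=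
  hD.memY_of_isStep (h.step k) ⟨_, h.memY⟩

lemma memZ (hD : D.Assumptions) (h : D.IsPath i x x' y y' z) (k : ℕ) : D.MemY (z k) := by
  induction k with
  | zero => rw [h.zero]; exact h.memY
  | succ k ih =>
    intro j
    simp only [h.z_succ, stepYb]
    split_ifs
    · exact h.memY' hD k j
    · exact ih j

/-- `one_step` yields the dual gap at the full step; the mean of `L₂` replaces it by the dual gap at
`z`. The squared step lengths have a favourable sign and are dropped here. -/
lemma mean_L_le (hD : D.Assumptions) (hp : D.Parameters) (h : D.IsPath i x x' y y' z)
    {u : Blk d} {v : Blk e} (hu : D.MemX u) (hv : D.MemY v) (k : ℕ) :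
    ∑ i, D.p i * D.L u v (setBlk (x k) i (x' k i)) (D.stepY (x k) (x' k) (y k) (y' k) i)
        (D.stepYb (y' k) (z k) i)
      ≤ D.L u v (x k) (y k) (z k) - D.pmin * D.Γ u v (x k) (z k) := by
  have h1 := hD.one_step hp (h.step k) (h.memX_all hD k) hu hv
  have h2 := hp.mean_yb (fun j a => D.hr j a - ⟪D.mulA u j, a⟫) (y' k) (z k)
  have h3 : ∀ w : Blk e, ∑ j, (D.hr j (w j) - ⟪D.mulA u j, w j⟫)
      = D.Hr w - ⟪D.mulA u, w⟫ := by
    intro w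
    rw [Finset.sum_sub_distrib, Hr, PiLp.inner_apply]
  rw [h3, h3] at h2
  simp only [L, mul_add, Finset.sum_add_distrib]
  have h4 := mul_nonneg hp.pmin_pos.le (wsq_nonneg (fun i => (hp.Cτ_pos i).le) (x' k - x k))
  have h5 := mul_nonneg hp.pmin_pos.le
    (wsq_nonneg (fun j => (inv_pos.2 (hp.σ_pos j)).le) (y' k - y k))
  have h6 : ∑ i, D.p i * D.L₂ u (D.stepYb (y' k) (z k) i)
      = D.pmin * (D.Hr (y' k) - ⟪D.mulA u, y' k⟫) + D.L₂ u (z k)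
        - D.pmin * (D.Hr (z k) - ⟪D.mulA u, z k⟫) := h2
  rw [h6, Γ]
  linarith

/-- The accumulated gap along a path. -/
lemma sum_gap_le (hD : D.Assumptions) (hp : D.Parameters) (h : D.IsPath i x x' y y' z)
    {u : Blk d} {v : Blk e} (hu : D.MemX u) (hv : D.MemY v) (K : ℕ) :
    D.pmin * ∑ k ∈ Finset.Icc 1 K, D.Γ u v (x k) (z k)
      ≤ (D.L u v (x 0) (y 0) (z 0) - D.pmin * D.Γ u v (x 0) (z 0))
        - (D.L u v (x K) (y K) (z K) - D.pmin * D.Γ u v (x K) (z K))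
        + D.scalarNoise u v x x' y y' z K := by
  -- The one-step bounds control the gaps at `0, …, K - 1`; telescoping `L - pmin * Γ` instead of
  -- `L` shifts the sum to `1, …, K`.
  induction K with
  | zero => simp [scalarNoise]
  | succ K ih =>
    have h1 := h.mean_L_le hD hp hu hv K
    rw [Finset.sum_Icc_succ_top (by omega), mul_add, scalarNoise, Finset.sum_range_succ,
      ← scalarNoise]
    linarith

/-- The gap at the initial point, relative to the gap at the last iterate. -/
lemma potential_sub (h : D.IsPath i x x' y y' z) (u : Blk d) (v : Blk e) (K : ℕ) :
    (D.L u v (x 0) (y 0) (z 0) - D.pmin * D.Γ u v (x 0) (z 0))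
        - (D.L u v (x K) (y K) (z K) - D.pmin * D.Γ u v (x K) (z K))
      = (1 - D.pmin) * (D.Fr (x 0) - D.Fr (x K)) + (1 - D.pmin) * ⟪D.mulA (x 0 - x K), v⟫
        + D.V (x 0 - u) (y 0 - v) - D.V (x K - u) (y K - v)
        + ∑ j, (D.pmin * (D.pr j)⁻¹ - D.pmin) * (D.hr j (y 0 j) - D.hr j (z K j)
          + ⟪D.mulA u j, z K j - y 0 j⟫) := by
  have h1 : ∑ j, (D.pmin * (D.pr j)⁻¹ - D.pmin) * (D.hr j (y 0 j) - D.hr j (z K j)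
          + ⟪D.mulA u j, z K j - y 0 j⟫)
      = D.L₂ u (y 0) - D.L₂ u (z K) - D.pmin * (D.Hr (y 0) - ⟪D.mulA u, y 0⟫)
        + D.pmin * (D.Hr (z K) - ⟪D.mulA u, z K⟫) := by
    rw [L₂, L₂, Hr, Hr, PiLp.inner_apply, PiLp.inner_apply, ← Finset.sum_sub_distrib,
      ← Finset.sum_sub_distrib, ← Finset.sum_sub_distrib, Finset.mul_sum, Finset.mul_sum,
      ← Finset.sum_sub_distrib, ← Finset.sum_add_distrib]
    refine Finset.sum_congr rfl fun j _ => ?_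
    rw [inner_sub_right]; ring
  rw [h1, h.zero, L, L, Q, Q, Γ, Γ, mulA_sub, inner_sub_left]
  ring

end IsPath

end Data
-- A bound along each path that is uniform in the comparison point
namespace Data

variable {n m : ℕ} {d : Fin n → ℕ} {e : Fin m → ℕ} {D : Data d e}

/-- The weight `σ π⁻¹` of the dual space is positive. -/
lemma Parameters.σ_mul_pr_inv_pos (hp : D.Parameters) (j : Fin m) : 0 < D.σ j * (D.pr j)⁻¹ :=
  mul_pos (hp.σ_pos j) (inv_pos.2 (hp.pr_pos j))

lemma Parameters.σ_mul_pr_inv_mul_wy (hp : D.Parameters) (j : Fin m) :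
    D.σ j * (D.pr j)⁻¹ * D.wy j = ((D.pr j)⁻¹) ^ 2 := by
  have := (hp.σ_pos j).ne'
  rw [wy]; field_simp

lemma Parameters.one_le_pr_inv_sq (hp : D.Parameters) (j : Fin m) : 1 ≤ ((D.pr j)⁻¹) ^ 2 :=
  one_le_pow₀ ((one_le_inv₀ (hp.pr_pos j)).2 (hp.pr_le_one j))

/-- Young's inequality for an image under `A` and a dual vector. -/
lemma Parameters.wip_mulA_le (hp : D.Parameters) (hβ : ∀ i, 0 ≤ D.β i) {s : Fin m → ℝ} {a b : ℝ}
    (ha : 0 < a) (hs : ∀ j, s j ^ 2 ≤ 4 * a * b * ((D.pr j)⁻¹) ^ 2) (w : Blk d) (y : Blk e) :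
    wip s (D.mulA w) y ≤ a * wsq D.wx w + b * wsq D.wy y := by
  refine (wip_le_add (w := fun j => D.σ j * (D.pr j)⁻¹) (w' := D.wy) (b := b) ha
    hp.σ_mul_pr_inv_pos (fun j => ?_) (D.mulA w) y).trans ?_
  · rw [hp.σ_mul_pr_inv_mul_wy]; exact hs j
  · have := mul_le_mul_of_nonneg_left (hp.wsq_mulA_le hβ w) ha.le
    linarith

/-- The coefficients `pmin / pr j - pmin` lie in `[0, 1]`. After subtracting the affine function
given by `A xs`, the values of `h^*` become row gaps to a solution: the one at `z` is nonnegative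
and discarded, the one at `y₀` is bounded by its full value. The remaining pairings are split
through `x₀` and treated by Young's inequality, except for `⟪A u, ys - y₀⟫`, whose second factor is
fixed. -/
lemma dual_part_le (hD : D.Assumptions) (hp : D.Parameters) {xs : Blk d} {ys : Blk e}
    (hs : D.IsSolution xs ys) (x₀ u : Blk d) {y₀ z : Blk e} (hy : D.MemY y₀) (hz : D.MemY z) :
    ∑ j, (D.pmin * (D.pr j)⁻¹ - D.pmin) * (D.hr j (y₀ j) - D.hr j (z j)
          + ⟪D.mulA u j, z j - y₀ j⟫)
      ≤ D.Hr y₀ - D.Hr ys + ⟪D.mulA u, ys - y₀⟫ + D.pmin * wsq D.wx (u - x₀)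
        + 2 / 3 * D.pmin * wsq D.wy (z - y₀) + 3 / 2 * D.pmin * wsq D.wx (x₀ - xs)
        + (2 * D.pmin)⁻¹ * wsq D.wy (y₀ - ys)
        + 1 / 2 * wsq D.wx (x₀ - xs) + 1 / 2 * wsq D.wy (y₀ - ys) := by
  have hm := hp.pmin_pos
  set c : Fin m → ℝ := fun j => D.pmin * (D.pr j)⁻¹ - D.pmin with hc
  have hq : ∀ j, 1 ≤ (D.pr j)⁻¹ := fun j => (one_le_inv₀ (hp.pr_pos j)).2 (hp.pr_le_one j)
  have hc0 : ∀ j, 0 ≤ c j := fun j => by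
    have := mul_le_mul_of_nonneg_left (hq j) hm.le
    simp only [hc]; linarith
  have hc1 : ∀ j, c j ≤ 1 := fun j => by
    have : D.pmin * (D.pr j)⁻¹ ≤ 1 := by
      rw [← div_eq_mul_inv, div_le_one (hp.pr_pos j)]; exact hp.pmin_le_pr j
    simp only [hc]; linarith
  have hcsq : ∀ j, c j ^ 2 ≤ D.pmin ^ 2 * ((D.pr j)⁻¹) ^ 2 := fun j => by
    rw [← mul_pow]
    exact pow_le_pow_left₀ (hc0 j) (by simp only [hc]; linarith) 2
  have h1 : ∀ j, c j * (D.hr j (y₀ j) - D.hr j (z j) + ⟪D.mulA u j, z j - y₀ j⟫)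
      ≤ (D.hr j (y₀ j) - D.hr j (ys j) - ⟪D.mulA xs j, y₀ j - ys j⟫)
        + c j * ⟪D.mulA (u - x₀) j, (z - y₀) j⟫ + c j * ⟪D.mulA (x₀ - xs) j, (z - y₀) j⟫ := by
    intro j
    have g1 := hD.dual_gap_nonneg hs hy j
    have g2 := hD.dual_gap_nonneg hs hz j
    have g3 := mul_le_mul_of_nonneg_left (hc1 j) g1
    have g4 := mul_nonneg (hc0 j) g2
    simp only [mulA_sub, PiLp.sub_apply, inner_sub_left, inner_sub_right] at g3 g4 ⊢
    linarith
  have h2 := Finset.sum_le_sum fun j (_ : j ∈ Finset.univ) => h1 j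
  simp only [Finset.sum_add_distrib, Finset.sum_sub_distrib] at h2
  have h3 : ∑ j, ⟪D.mulA xs j, y₀ j - ys j⟫ = ⟪D.mulA xs, y₀ - ys⟫ := by
    rw [PiLp.inner_apply]; rfl
  -- The shares of `pmin * wsq wy (z - y₀)` here and in `h5` are `1 / 2` and `1 / 6`, which add up
  -- to `2 / 3`.
  have h4 : wip c (D.mulA (u - x₀)) (z - y₀)
      ≤ D.pmin / 2 * wsq D.wx (u - x₀) + D.pmin / 2 * wsq D.wy (z - y₀) :=
    hp.wip_mulA_le hD.β_nonneg (by positivity) (fun j => (hcsq j).trans (le_of_eq (by ring))) _ _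
  have h5 : wip c (D.mulA (x₀ - xs)) (z - y₀)
      ≤ 3 / 2 * D.pmin * wsq D.wx (x₀ - xs) + D.pmin / 6 * wsq D.wy (z - y₀) :=
    hp.wip_mulA_le hD.β_nonneg (by positivity) (fun j => (hcsq j).trans (le_of_eq (by ring))) _ _
  have h6 : wip 1 (D.mulA (u - x₀)) (y₀ - ys)
      ≤ D.pmin / 2 * wsq D.wx (u - x₀) + (2 * D.pmin)⁻¹ * wsq D.wy (y₀ - ys) :=
    hp.wip_mulA_le hD.β_nonneg (by positivity) (fun j => by
      have := hp.one_le_pr_inv_sq j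
      have h7 : 4 * (D.pmin / 2) * (2 * D.pmin)⁻¹ = 1 := by field_simp; norm_num
      rw [h7]; simpa using this) _ _
  have h7 : wip 1 (D.mulA (x₀ - xs)) (y₀ - ys)
      ≤ 1 / 2 * wsq D.wx (x₀ - xs) + 1 / 2 * wsq D.wy (y₀ - ys) :=
    hp.wip_mulA_le hD.β_nonneg (by positivity) (fun j => by
      have := hp.one_le_pr_inv_sq j
      norm_num at this ⊢; linarith) _ _
  rw [wip_one, mulA_sub] at h6 h7
  rw [h3] at h2
  simp only [wip] at h4 h5
  simp only [Hr]
  simp only [inner_sub_left, inner_sub_right] at h2 h6 h7 ⊢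
  simp only [PiLp.sub_apply, inner_sub_right] at h2 h4 h5 ⊢
  linarith

/-- The bound on the accumulated gap along a path. The numbers `S`, `SA`, `SX` bound the terms
that depend on the comparison point. -/
def pathBound (D : Data d e) (xs : Blk d) (ys : Blk e) (S SA SX : ℝ) (x x' : ℕ → Blk d)
    (y y' z : ℕ → Blk e) (K : ℕ) : ℝ :=
  S + SA * (wnorm D.wx (x 0 - xs) + wnorm D.wx (x K - xs)) + SX * wnorm D.wy (ys - y 0)
    + (1 - D.pmin) * (D.Fr (x 0) - D.Fr xs)
    + 1 / 2 * wsq (fun i => D.τ i * D.p i) (D.mulAT ys) + 1 / 2 * wsq D.wx (x K - xs)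
    + D.scalarNoise (x 0) (y 0) x x' y y' z K
    + D.pmin * wsq D.wx (noise D.p x (fun k i => setBlk (x k) i (x' k i)) K)
    + (2 * D.pmin)⁻¹ * wsq (fun j => D.σ j * D.pr j)
      (noise D.p (fun k => D.mulA (x k)) (fun k i => D.mulA (setBlk (x k) i (x' k i))) K)
    + D.pmin / 4 * wsq D.wy (noise D.p y (fun k i => D.stepY (x k) (x' k) (y k) (y' k) i) K)
    + D.pmin * wsq D.wy (noise D.p z (fun k i => D.stepYb (y' k) (z k) i) K)
    + (D.Hr (y 0) - D.Hr ys) + 2 / 3 * D.pmin * wsq D.wy (z K - y 0)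
    + 3 / 2 * D.pmin * wsq D.wx (x 0 - xs) + (2 * D.pmin)⁻¹ * wsq D.wy (y 0 - ys)
    + 1 / 2 * wsq D.wx (x 0 - xs) + 1 / 2 * wsq D.wy (y 0 - ys)

/-- Each term containing the comparison point is split by Young's or the Cauchy-Schwarz inequality:
its part in `(u, v)` is absorbed by `S`, `SA` or `SX`, and the other factor is free of `(u, v)`. -/
lemma IsPath.sum_gap_le_pathBound (hD : D.Assumptions) (hp : D.Parameters) {i : ℕ → Fin n}
    {x x' : ℕ → Blk d} {y y' z : ℕ → Blk e} (h : D.IsPath i x x' y y' z)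
    {xs : Blk d} {ys : Blk e} (hs : D.IsSolution xs ys) {u : Blk d} {v : Blk e}
    (hu : D.MemX u) (hv : D.MemY v) {S SA SX : ℝ}
    (hS : 2 * D.pmin * wsq D.wx (x 0 - u) + 2 * D.pmin * wsq D.wy (y 0 - v) ≤ S)
    (hSA : wnorm (fun i => D.τ i * D.p i) (D.mulAT v) ≤ SA)
    (hSX : wnorm (fun j => D.σ j * D.pr j) (D.mulA u) ≤ SX) (K : ℕ) :
    D.pmin * ∑ k ∈ Finset.Icc 1 K, D.Γ u v (x k) (z k)
      ≤ D.pathBound xs ys S SA SX x x' y y' z K := by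
  have hm := hp.pmin_pos
  have hm1 := hp.pmin_le_one
  have hβ := hD.β_nonneg
  have h1 := h.sum_gap_le hD hp hu hv K
  rw [h.potential_sub, scalarNoise_eq hp u (x 0) v (y 0)] at h1
  have h2 := dual_part_le hD hp hs (x 0) u h.memY (h.memZ hD K)
  have h3 := hD.primal_gap_nonneg hs (h.memX_all hD K)
  have hτp : ∀ i, 0 < D.τ i * D.p i := fun i => mul_pos (hp.τ_pos i) (hp.p_pos i)
  have hσp : ∀ j, 0 < D.σ j * D.pr j := fun j => mul_pos (hp.σ_pos j) (hp.pr_pos j)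
  have hwx1 : ∀ i, D.wx i * (D.τ i * D.p i) = 1 := fun i => by
    have := (hp.τ_pos i).ne'
    have := (hp.p_pos i).ne'
    rw [wx]; field_simp
  have hwy1 : ∀ j, D.σ j * D.pr j * D.wy j = 1 := fun j => by
    have := (hp.σ_pos j).ne'
    have := (hp.pr_pos j).ne'
    rw [wy]; field_simp
  have hcs : ∀ a b : Blk d, wip 1 a b ≤ wnorm D.wx a * wnorm (fun i => D.τ i * D.p i) b :=
    fun a b => wip_le_wnorm hp.wx_pos (fun i => (hτp i).le) (fun i => by rw [hwx1]; simp) a b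
  -- the terms with `Aᵀ v`
  have h4 : (1 - D.pmin) * ⟪D.mulA (x 0 - x K), v⟫
      ≤ SA * (wnorm D.wx (x 0 - xs) + wnorm D.wx (x K - xs)) := by
    have e1 : ⟪D.mulA (x 0 - x K), v⟫
        = wip 1 (x 0 - xs) (D.mulAT v) + wip 1 (xs - x K) (D.mulAT v) := by
      rw [inner_mulA, wip_one, wip_one, ← inner_add_left]; congr 1; abel
    have e2 := hcs (x 0 - xs) (D.mulAT v)
    have e3 := hcs (xs - x K) (D.mulAT v)
    have e4 : wnorm D.wx (xs - x K) = wnorm D.wx (x K - xs) := by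
      rw [wnorm, wnorm, wsq_sub_comm]
    rw [e4] at e3
    have e5 := wnorm_nonneg D.wx (x 0 - xs)
    have e6 := wnorm_nonneg D.wx (x K - xs)
    have e7 : ⟪D.mulA (x 0 - x K), v⟫
        ≤ SA * (wnorm D.wx (x 0 - xs) + wnorm D.wx (x K - xs)) := by
      have e8 := mul_le_mul_of_nonneg_left hSA e5
      have e9 := mul_le_mul_of_nonneg_left hSA e6
      rw [e1]; linarith
    have e8 : 0 ≤ SA * (wnorm D.wx (x 0 - xs) + wnorm D.wx (x K - xs)) :=
      mul_nonneg ((wnorm_nonneg _ _).trans hSA) (add_nonneg e5 e6)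
    calc (1 - D.pmin) * ⟪D.mulA (x 0 - x K), v⟫
        ≤ (1 - D.pmin) * (SA * (wnorm D.wx (x 0 - xs) + wnorm D.wx (x K - xs))) :=
          mul_le_mul_of_nonneg_left e7 (by linarith)
      _ ≤ 1 * (SA * (wnorm D.wx (x 0 - xs) + wnorm D.wx (x K - xs))) :=
          mul_le_mul_of_nonneg_right (by linarith) e8
      _ = _ := one_mul _
  -- the primal objective at the last iterate
  have h5 : (1 - D.pmin) * (D.Fr xs - D.Fr (x K))
      ≤ 1 / 2 * wsq (fun i => D.τ i * D.p i) (D.mulAT ys) + 1 / 2 * wsq D.wx (x K - xs) := by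
    have e1 : wip 1 (x K - xs) (D.mulAT ys)
        ≤ 1 / 2 * wsq D.wx (x K - xs) + 1 / 2 * wsq (fun i => D.τ i * D.p i) (D.mulAT ys) :=
      wip_le_add (by norm_num) hp.wx_pos (fun i => by rw [hwx1]; norm_num) _ _
    rw [wip_one, ← inner_mulA] at e1
    have e2 : 0 ≤ 1 / 2 * wsq D.wx (x K - xs)
        + 1 / 2 * wsq (fun i => D.τ i * D.p i) (D.mulAT ys) :=
      add_nonneg (mul_nonneg (by norm_num) (wsq_nonneg (fun i => (hp.wx_pos i).le) _))
        (mul_nonneg (by norm_num) (wsq_nonneg (fun i => (hτp i).le) _))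
    have e3 : (1 - D.pmin) * (D.Fr xs - D.Fr (x K)) ≤ (1 - D.pmin) *
        (1 / 2 * wsq D.wx (x K - xs) + 1 / 2 * wsq (fun i => D.τ i * D.p i) (D.mulAT ys)) :=
      mul_le_mul_of_nonneg_left (by linarith) (by linarith)
    have e4 := mul_nonneg hm.le e2
    linarith
  -- the term with `A u`
  have h6 : ⟪D.mulA u, ys - y 0⟫ ≤ SX * wnorm D.wy (ys - y 0) := by
    rw [← wip_one]
    refine (wip_le_wnorm hσp (fun j => (hp.wy_pos j).le) (fun j => by rw [hwy1]; simp)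
      (D.mulA u) (ys - y 0)).trans ?_
    exact mul_le_mul_of_nonneg_right hSX (wnorm_nonneg _ _)
  -- the noise terms
  set Mx := noise D.p x (fun k i => setBlk (x k) i (x' k i)) K
  set My := noise D.p y (fun k i => D.stepY (x k) (x' k) (y k) (y' k) i) K
  set Mz := noise D.p z (fun k i => D.stepYb (y' k) (z k) i) K
  -- The constants are budgeted so that both distances in `hS` receive total weight `2 * pmin`. For
  -- `u` the shares are `1 / 2` from `V`, `1` from `dual_part_le`, and `1 / 4` each from `h8` and
  -- `h10`; for `v` they are `1 / 2` from `V`, `1 / 2` from `h7` and `1` from `h9`.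
  have h7 : ⟪D.mulA Mx, v - y 0⟫ ≤ (2 * D.pmin)⁻¹ * wsq (fun j => D.σ j * D.pr j) (D.mulA Mx)
      + D.pmin / 2 * wsq D.wy (v - y 0) := by
    rw [← wip_one]
    refine wip_le_add (by positivity) hσp (fun j => ?_) _ _
    rw [hwy1]
    refine le_of_eq ?_
    simp only [Pi.one_apply]
    field_simp
    norm_num
  have h8 : -(D.pmin * wip D.wx Mx (u - x 0))
      ≤ D.pmin * wsq D.wx Mx + D.pmin / 4 * wsq D.wx (u - x 0) := by
    rw [← neg_mul, ← wip_const_mul]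
    exact wip_le_add hm hp.wx_pos (fun i => le_of_eq (by ring)) _ _
  have h9 : -(D.pmin * wip D.wy My (v - y 0))
      ≤ D.pmin / 4 * wsq D.wy My + D.pmin * wsq D.wy (v - y 0) := by
    rw [← neg_mul, ← wip_const_mul]
    exact wip_le_add (by positivity) hp.wy_pos (fun i => le_of_eq (by ring)) _ _
  have h10 : -(D.pmin * wip (fun j => (D.pr j)⁻¹) Mz (D.mulA (u - x 0)))
      ≤ D.pmin / 4 * wsq D.wx (u - x 0) + D.pmin * wsq D.wy Mz := by
    rw [← neg_mul, ← wip_const_mul, wip_comm]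
    exact hp.wip_mulA_le hβ (by positivity) (fun i => le_of_eq (by ring)) _ _
  have h11 : 0 ≤ D.V (x K - u) (y K - v) :=
    add_nonneg (mul_nonneg (by positivity) (wsq_nonneg (fun i => (hp.wx_pos i).le) _))
      (mul_nonneg (by positivity) (wsq_nonneg (fun j => (hp.wy_pos j).le) _))
  have h12 : D.V (x 0 - u) (y 0 - v)
      = D.pmin / 2 * wsq D.wx (x 0 - u) + D.pmin / 2 * wsq D.wy (y 0 - v) := rfl
  rw [wsq_sub_comm D.wx u] at h2 h8 h10
  rw [wsq_sub_comm D.wy v] at h7 h9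
  rw [pathBound, ← mulA_noise]
  linarith

end Data

/-! ### Random variables that depend on finitely many draws -/

section Draws

variable {n : ℕ} {Ω α : Type*} {ι : ℕ → Ω → Fin n}

/-- `X` is a function of the first `k` draws. -/
def DependsOnFirst (ι : ℕ → Ω → Fin n) (k : ℕ) (X : Ω → α) : Prop :=
  ∀ ω ω', (∀ l < k, ι l ω = ι l ω') → X ω = X ω'

lemma DependsOnFirst.comp {γ : Type*} {k : ℕ} {X : Ω → α} (h : DependsOnFirst ι k X)
    (φ : α → γ) : DependsOnFirst ι k (fun ω => φ (X ω)) :=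
  fun ω ω' hω => congrArg φ (h ω ω' hω)

/-- Factoring through the finite set of values of the first draws plays the role of a filtration:
conditional expectations become finite sums. -/
lemma DependsOnFirst.exists_eq [Nonempty Ω] {k : ℕ} {X : Ω → α} (h : DependsOnFirst ι k X) :
    ∃ φ : (Finset.range k → Fin n) → α, ∀ ω, X ω = φ (fun l => ι l ω) := by
  classical
  obtain ⟨ω₀⟩ := ‹Nonempty Ω›
  have hf : Function.FactorsThrough X (fun ω (l : Finset.range k) => ι l ω) := by
    intro ω ω' hω
    exact h ω ω' fun l hl => congrFun hω ⟨l, Finset.mem_range.2 hl⟩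
  refine ⟨Function.extend (fun ω (l : Finset.range k) => ι l ω) X (fun _ => X ω₀), fun ω => ?_⟩
  exact (hf.extend_apply _ ω).symm

lemma dependsOnFirst_noise {c : ℕ} {a : Fin c → ℕ} (p : Fin n → ℝ) {G : ℕ → Ω → Blk a}
    {Gn : ℕ → Fin n → Ω → Blk a} (hG : ∀ k, DependsOnFirst ι k (G k))
    (hGn : ∀ k i, DependsOnFirst ι k (Gn k i)) (K : ℕ) :
    DependsOnFirst ι K (fun ω => noise p (fun k => G k ω) (fun k i => Gn k i ω) K) := by
  intro ω ω' h
  refine Finset.sum_congr rfl fun k hk => ?_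
  have hk' := Finset.mem_range.1 hk
  simp only [hG (k + 1) ω ω' fun l hl => h l (by omega),
    fun i => hGn k i ω ω' fun l hl => h l (by omega)]

variable [MeasurableSpace Ω]

/-- Every map out of a finite discrete space is measurable, so no regularity of `X` as a function of
the draws is required. -/
lemma DependsOnFirst.measurable [MeasurableSpace α] (hι : ∀ k, Measurable (ι k)) {k : ℕ}
    {X : Ω → α} (h : DependsOnFirst ι k X) : Measurable X := by
  rcases isEmpty_or_nonempty Ω with hΩ | hΩ
  · exact measurable_of_empty X
  obtain ⟨φ, hφ⟩ := h.exists_eq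
  rw [show X = φ ∘ fun ω (l : Finset.range k) => ι l ω from funext hφ]
  exact (measurable_of_finite φ).comp (measurable_pi_lambda _ fun l => hι l)

lemma DependsOnFirst.integrable {μ : Measure Ω} [IsProbabilityMeasure μ]
    (hι : ∀ k, Measurable (ι k)) {k : ℕ} {X : Ω → ℝ} (h : DependsOnFirst ι k X) :
    Integrable X μ := by
  have : Nonempty Ω := nonempty_of_isProbabilityMeasure μ
  obtain ⟨φ, hφ⟩ := h.exists_eq
  obtain ⟨C, hC⟩ := (Set.finite_range fun s => ‖φ s‖).bddAbove
  refine Integrable.of_bound (h.measurable hι).aestronglyMeasurable C (ae_of_all _ fun ω => ?_)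
  rw [hφ]
  exact hC ⟨_, rfl⟩

end Draws

/-! ### Averaging over one draw and the variance of the noise -/

namespace Data

variable {n m : ℕ} {d : Fin n → ℕ} {e : Fin m → ℕ} {D : Data d e}
  {Ω : Type*} [MeasurableSpace Ω] {μ : Measure Ω} [IsProbabilityMeasure μ] {ι : ℕ → Ω → Fin n}

namespace IsSampling

/-- The mean over the draw `k` of a quantity whose other arguments are determined by the
previous draws. -/
lemma integral_draw (hι : D.IsSampling μ ι) (hp : D.Parameters) {k : ℕ} {F : Fin n → Ω → ℝ}
    (hF : ∀ i, DependsOnFirst ι k (F i)) :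
    ∫ ω, F (ι k ω) ω ∂μ = ∫ ω, ∑ i, D.p i * F i ω ∂μ := by
  classical
  have : Nonempty Ω := nonempty_of_isProbabilityMeasure μ
  have hind : ∀ i, ∫ ω, (if ι k ω = i then (1 : ℝ) else 0) ∂μ = D.p i := by
    intro i
    have h1 : (fun ω => if ι k ω = i then (1 : ℝ) else 0) = Set.indicator {ω | ι k ω = i} 1 := by
      funext ω; simp [Set.indicator_apply]
    have h2 : MeasurableSet {ω | ι k ω = i} := hι.meas k (measurableSet_singleton i)
    rw [h1, integral_indicator_one h2, Measure.real, hι.law,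
      ENNReal.toReal_ofReal (hp.p_pos i).le]
  have hmul : ∀ i, ∫ ω, (if ι k ω = i then (1 : ℝ) else 0) * F i ω ∂μ
      = ∫ ω, D.p i * F i ω ∂μ := by
    intro i
    obtain ⟨φ, hφ⟩ := (hF i).exists_eq
    -- With indices starting at `0`, draw `k` is not among the first `k` draws, hence is independent
    -- of all they determine.
    have hind' : IndepFun (fun ω (l : ({k} : Finset ℕ)) => ι l ω)
        (fun ω (l : Finset.range k) => ι l ω) μ :=
      hι.indep.indepFun_finset {k} (Finset.range k) (by simp) hι.meas
    have h1 : IndepFun (fun ω => if ι k ω = i then (1 : ℝ) else 0) (F i) μ := by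
      rw [show F i = φ ∘ fun ω (l : Finset.range k) => ι l ω from funext hφ]
      exact hind'.comp (φ := fun s => if s ⟨k, by simp⟩ = i then (1 : ℝ) else 0)
        (measurable_of_finite _) (measurable_of_finite φ)
    have h2 : AEStronglyMeasurable (fun ω => if ι k ω = i then (1 : ℝ) else 0) μ := by
      have : Measurable ((fun l => if l = i then (1 : ℝ) else 0) ∘ ι k) :=
        (measurable_of_finite _).comp (hι.meas k)
      exact this.aestronglyMeasurable
    rw [h1.integral_fun_mul_eq_mul_integral h2 ((hF i).measurable hι.meas).aestronglyMeasurable,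
      hind, integral_const_mul]
  have hsum : ∀ ω, F (ι k ω) ω = ∑ i, (if ι k ω = i then (1 : ℝ) else 0) * F i ω := by
    intro ω; simp
  simp only [hsum]
  rw [integral_finsetSum, integral_finsetSum]
  · exact Finset.sum_congr rfl fun i _ => hmul i
  · exact fun i _ => ((hF i).integrable hι.meas).const_mul _
  · intro i _
    have h3 : DependsOnFirst ι (k + 1) (fun ω => (if ι k ω = i then (1 : ℝ) else 0) * F i ω) := by
      intro ω ω' h
      simp only [h k (by omega), hF i ω ω' fun l hl => h l (by omega)]
    exact h3.integrable hι.meas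

/-- The second moment of the accumulated noise of a sequence. -/
lemma integral_wsq_noise_le (hι : D.IsSampling μ ι) (hp : D.Parameters) {c : ℕ} {a : Fin c → ℕ}
    {w : Fin c → ℝ} (hw : ∀ i, 0 ≤ w i) {G : ℕ → Ω → Blk a} {Gn : ℕ → Fin n → Ω → Blk a}
    (hG : ∀ k, DependsOnFirst ι k (G k)) (hGn : ∀ k i, DependsOnFirst ι k (Gn k i))
    (hs : ∀ k ω, G (k + 1) ω = Gn k (ι k ω) ω) (K : ℕ) :
    ∫ ω, wsq w (noise D.p (fun k => G k ω) (fun k i => Gn k i ω) K) ∂μ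
      ≤ ∑ k ∈ Finset.range K, ∫ ω, ∑ i, D.p i * wsq w (Gn k i ω - G k ω) ∂μ := by
  have hN := dependsOnFirst_noise D.p hG hGn
  induction K with
  | zero => simp [noise, wsq_zero]
  | succ K ih =>
    rw [Finset.sum_range_succ]
    set M : Ω → Blk a := fun ω => noise D.p (fun k => G k ω) (fun k i => Gn k i ω) K with hM
    have h1 : ∀ ω, noise D.p (fun k => G k ω) (fun k i => Gn k i ω) (K + 1)
        = M ω + Gn K (ι K ω) ω - ∑ i, D.p i • Gn K i ω := by
      intro ω
      rw [noise, Finset.sum_range_succ, hs, ← add_sub_assoc]; rfl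
    have h2 : ∀ i, DependsOnFirst ι K
        (fun ω => wsq w (M ω + Gn K i ω - ∑ l, D.p l • Gn K l ω)) := by
      intro i ω ω' h
      simp only [hM, hN K ω ω' h, fun i => hGn K i ω ω' h]
    have h3 : DependsOnFirst ι K (fun ω => ∑ i, D.p i * wsq w (Gn K i ω - G K ω)) := by
      intro ω ω' h
      simp only [hG K ω ω' h, fun i => hGn K i ω ω' h]
    have h4 : DependsOnFirst ι K
        (fun ω => ∑ i, D.p i * wsq w (M ω + Gn K i ω - ∑ l, D.p l • Gn K l ω)) := by
      intro ω ω' h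
      exact Finset.sum_congr rfl fun i _ => congrArg (D.p i * ·) (h2 i ω ω' h)
    have h5 : DependsOnFirst ι K (fun ω => wsq w (M ω)) := (hN K).comp (wsq w)
    simp only [h1]
    rw [hι.integral_draw hp h2]
    -- With the first `K` draws fixed, the cross term with the accumulated noise averages to zero,
    -- and the variance of the increment is at most its second moment about `G K`.
    calc ∫ ω, ∑ i, D.p i * wsq w (M ω + Gn K i ω - ∑ l, D.p l • Gn K l ω) ∂μ
        ≤ ∫ ω, (wsq w (M ω) + ∑ i, D.p i * wsq w (Gn K i ω - G K ω)) ∂μ :=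
          integral_mono (h4.integrable hι.meas)
            ((h5.integrable hι.meas).add (h3.integrable hι.meas))
            (fun ω => sum_wsq_sub_mean_le hp.p_sum hw (fun i => Gn K i ω) (G K ω) (M ω))
      _ = ∫ ω, wsq w (M ω) ∂μ + ∫ ω, ∑ i, D.p i * wsq w (Gn K i ω - G K ω) ∂μ :=
          integral_add (h5.integrable hι.meas) (h3.integrable hι.meas)
      _ ≤ _ := by linarith

end IsSampling

/-- The square of the mean is at most the mean of the square. -/
lemma integral_le_sqrt {X : Ω → ℝ} (hX : Integrable X μ) (hX2 : Integrable (fun ω => X ω ^ 2) μ)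
    {c : ℝ} (hc : ∫ ω, X ω ^ 2 ∂μ ≤ c) : ∫ ω, X ω ∂μ ≤ Real.sqrt c := by
  set M := ∫ ω, X ω ∂μ with hM
  have h1 : 0 ≤ ∫ ω, (X ω - M) ^ 2 ∂μ := integral_nonneg fun ω => sq_nonneg _
  have h2 : ∫ ω, (X ω - M) ^ 2 ∂μ = ∫ ω, X ω ^ 2 ∂μ - M ^ 2 := by
    have h3 : ∀ ω, (X ω - M) ^ 2 = X ω ^ 2 - 2 * M * X ω + M ^ 2 := fun ω => by ring
    simp only [h3]
    have hi : Integrable (fun ω => X ω ^ 2 - 2 * M * X ω) μ := hX2.sub (hX.const_mul _)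
    rw [integral_add hi (integrable_const _),
      integral_sub hX2 (hX.const_mul _), integral_const_mul, ← hM]
    simp
    ring
  exact Real.le_sqrt_of_sq_le (by linarith)

end Data

/-! ### Expected energy and noise along a random run -/

namespace Data

variable {n m : ℕ} {d : Fin n → ℕ} {e : Fin m → ℕ} (D : Data d e)
  {Ω : Type*} {ι : ℕ → Ω → Fin n}

/-- The algorithm driven by the random indices `ι`, started at a deterministic point. -/
structure IsRandomPath (x₀ : Blk d) (y₀ : Blk e) (ι : ℕ → Ω → Fin n) (x x' : ℕ → Ω → Blk d)
    (y y' z : ℕ → Ω → Blk e) : Prop where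
  path : ∀ ω, D.IsPath (fun k => ι k ω) (fun k => x k ω) (fun k => x' k ω) (fun k => y k ω)
    (fun k => y' k ω) (fun k => z k ω)
  x_zero : ∀ ω, x 0 ω = x₀
  y_zero : ∀ ω, y 0 ω = y₀

variable {D}

namespace IsRandomPath

variable {x₀ xs : Blk d} {y₀ ys : Blk e} {x x' : ℕ → Ω → Blk d} {y y' z : ℕ → Ω → Blk e}

lemma z_zero (h : D.IsRandomPath x₀ y₀ ι x x' y y' z) (ω : Ω) : z 0 ω = y₀ := by
  rw [(h.path ω).zero, h.y_zero]

/-- The state and the full steps are determined by the previous draws. -/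
lemma depends (hD : D.Assumptions) (hp : D.Parameters) (h : D.IsRandomPath x₀ y₀ ι x x' y y' z)
    (k : ℕ) : DependsOnFirst ι k (fun ω => (x k ω, x' k ω, y k ω, y' k ω, z k ω)) := by
  have hstep : ∀ k ω ω', x k ω = x k ω' → y k ω = y k ω' → x' k ω = x' k ω' ∧ y' k ω = y' k ω' := by
    intro k ω ω' hx hy
    have h1 := (h.path ω).step k
    have h2 := (h.path ω').step k
    simp only [← hx, ← hy] at h2
    exact hD.isStep_unique hp h1 h2 ⟨_, (h.path ω).memX⟩ ⟨_, (h.path ω).memY⟩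
  induction k with
  | zero =>
    intro ω ω' _
    have hx : x 0 ω = x 0 ω' := by rw [h.x_zero, h.x_zero]
    have hy : y 0 ω = y 0 ω' := by rw [h.y_zero, h.y_zero]
    have hz : z 0 ω = z 0 ω' := by rw [h.z_zero, h.z_zero]
    obtain ⟨hx', hy'⟩ := hstep 0 ω ω' hx hy
    simp only [hx, hy, hz, hx', hy']
  | succ k ih =>
    intro ω ω' hω
    have h1 := ih ω ω' fun l hl => hω l (by omega)
    have h2 := hω k (by omega)
    simp only [Prod.mk.injEq] at h1
    obtain ⟨a1, a2, a3, a4, a5⟩ := h1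
    have hx : x (k + 1) ω = x (k + 1) ω' := by
      rw [(h.path ω).x_succ, (h.path ω').x_succ, a1, a2, h2]
    have hy : y (k + 1) ω = y (k + 1) ω' := by
      rw [(h.path ω).y_succ, (h.path ω').y_succ, a1, a2, a3, a4, h2]
    have hz : z (k + 1) ω = z (k + 1) ω' := by
      rw [(h.path ω).z_succ, (h.path ω').z_succ, a4, a5, h2]
    obtain ⟨hx', hy'⟩ := hstep (k + 1) ω ω' hx hy
    simp only [hx, hy, hz, hx', hy']

/-- A function of the state and of the full steps is determined by the previous draws. -/
lemma depends_comp {α : Type*} (hD : D.Assumptions) (hp : D.Parameters)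
    (h : D.IsRandomPath x₀ y₀ ι x x' y y' z) (k : ℕ)
    (φ : Blk d → Blk d → Blk e → Blk e → Blk e → α) :
    DependsOnFirst ι k (fun ω => φ (x k ω) (x' k ω) (y k ω) (y' k ω) (z k ω)) :=
  (h.depends hD hp k).comp fun s => φ s.1 s.2.1 s.2.2.1 s.2.2.2.1 s.2.2.2.2

variable [MeasurableSpace Ω] {μ : Measure Ω} [IsProbabilityMeasure μ]

lemma integrable_comp (hD : D.Assumptions) (hp : D.Parameters) (hι : D.IsSampling μ ι)
    (h : D.IsRandomPath x₀ y₀ ι x x' y y' z) (k : ℕ)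
    (φ : Blk d → Blk d → Blk e → Blk e → Blk e → ℝ) :
    Integrable (fun ω => φ (x k ω) (x' k ω) (y k ω) (y' k ω) (z k ω)) μ :=
  (h.depends_comp hD hp k φ).integrable hι.meas

/-- The mean of a function of the next state. -/
lemma integral_succ (hD : D.Assumptions) (hp : D.Parameters) (hι : D.IsSampling μ ι)
    (h : D.IsRandomPath x₀ y₀ ι x x' y y' z) (k : ℕ) (φ : Blk d → Blk e → Blk e → ℝ) :
    ∫ ω, φ (x (k + 1) ω) (y (k + 1) ω) (z (k + 1) ω) ∂μ
      = ∫ ω, ∑ i, D.p i * φ (setBlk (x k ω) i (x' k ω i))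
        (D.stepY (x k ω) (x' k ω) (y k ω) (y' k ω) i) (D.stepYb (y' k ω) (z k ω) i) ∂μ := by
  rw [← hι.integral_draw hp (fun i => h.depends_comp hD hp k fun x x' y y' z =>
    φ (setBlk x i (x' i)) (D.stepY x x' y y' i) (D.stepYb y' z i))]
  refine integral_congr_ae (ae_of_all _ fun ω => ?_)
  simp only [(h.path ω).x_succ, (h.path ω).y_succ, (h.path ω).z_succ]

/-- A supermartingale inequality for functions of the state. -/
lemma integral_succ_le (hD : D.Assumptions) (hp : D.Parameters) (hι : D.IsSampling μ ι)
    (h : D.IsRandomPath x₀ y₀ ι x x' y y' z) (φ : Blk d → Blk e → Blk e → ℝ)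
    (r : Blk d → Blk d → Blk e → Blk e → Blk e → ℝ)
    (hle : ∀ k ω, ∑ i, D.p i * φ (setBlk (x k ω) i (x' k ω i))
        (D.stepY (x k ω) (x' k ω) (y k ω) (y' k ω) i) (D.stepYb (y' k ω) (z k ω) i)
      ≤ φ (x k ω) (y k ω) (z k ω) - r (x k ω) (x' k ω) (y k ω) (y' k ω) (z k ω)) (K : ℕ) :
    ∫ ω, φ (x K ω) (y K ω) (z K ω) ∂μ
      + ∑ k ∈ Finset.range K, ∫ ω, r (x k ω) (x' k ω) (y k ω) (y' k ω) (z k ω) ∂μ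
      ≤ φ x₀ y₀ y₀ := by
  induction K with
  | zero => simp [h.x_zero, h.y_zero, h.z_zero]
  | succ K ih =>
    rw [Finset.sum_range_succ, h.integral_succ hD hp hι]
    have i1 := h.integrable_comp hD hp hι K (fun x _ y _ z => φ x y z)
    have i2 := h.integrable_comp hD hp hι K r
    have i3 := h.integrable_comp hD hp hι K (fun x x' y y' z => ∑ i, D.p i *
      φ (setBlk x i (x' i)) (D.stepY x x' y y' i) (D.stepYb y' z i))
    have h1 := integral_mono i3 (i1.sub i2) (fun ω => hle K ω)
    rw [integral_sub' i1 i2] at h1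
    linarith

/-- The expected distances to a solution and the expected lengths of the full steps are
controlled by `Δ₀`. -/
lemma energy (hD : D.Assumptions) (hp : D.Parameters) (hι : D.IsSampling μ ι)
    (h : D.IsRandomPath x₀ y₀ ι x x' y y' z) (hs : D.IsSolution xs ys) (K : ℕ) :
    D.pmin / 2 * ∫ ω, wsq D.wx (x K ω - xs) ∂μ + D.pmin / 2 * ∫ ω, wsq D.wy (y K ω - ys) ∂μ
      + D.pmin / 2 * ∑ k ∈ Finset.range K, ∫ ω, wsq D.Cτ (x' k ω - x k ω) ∂μ
      + D.pmin / 2 * ∑ k ∈ Finset.range K, ∫ ω, wsq (fun j => (D.σ j)⁻¹) (y' k ω - y k ω) ∂μ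
      ≤ D.Fr x₀ - D.Fr xs + ⟪D.mulAT ys, x₀ - xs⟫ + D.V (x₀ - xs) (y₀ - ys) := by
  have hxs : D.MemX xs := hD.memX_iff.1 hs.1.1
  have hys : D.MemY ys := hD.memY_iff.1 hs.2.1
  -- At a solution both gaps subtracted by `one_step` are nonnegative, so the decrease of `Q` is
  -- left to pay for the step lengths.
  have h1 := h.integral_succ_le hD hp hι (fun x y _ => D.Q xs ys x y - D.Fr xs - ⟪D.mulA xs, ys⟫)
    (fun x x' y y' _ => D.pmin / 2 * wsq D.Cτ (x' - x)
      + D.pmin / 2 * wsq (fun j => (D.σ j)⁻¹) (y' - y)) (fun k ω => by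
      have g1 := hD.one_step hp ((h.path ω).step k) ((h.path ω).memX_all hD k) hxs hys
      have g2 := hD.primal_gap_nonneg hs ((h.path ω).memX_all hD k)
      have g3 := hD.dual_gap_sum_nonneg hs ((h.path ω).memY' hD k)
      have g4 := mul_nonneg hp.pmin_pos.le g2
      have g5 := mul_nonneg hp.pmin_pos.le g3
      rw [mulA_sub, inner_sub_left] at g4
      rw [inner_sub_right] at g5
      simp only [mul_sub, Finset.sum_sub_distrib, ← Finset.sum_mul, hp.p_sum] at g1 ⊢
      linarith) K
  have i1 := h.integrable_comp hD hp hι K (fun x _ _ _ _ => wsq D.wx (x - xs))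
  have i2 := h.integrable_comp hD hp hι K (fun _ _ y _ _ => wsq D.wy (y - ys))
  have h2 : ∫ ω, (D.pmin / 2 * wsq D.wx (x K ω - xs) + D.pmin / 2 * wsq D.wy (y K ω - ys)) ∂μ
      ≤ ∫ ω, (D.Q xs ys (x K ω) (y K ω) - D.Fr xs - ⟪D.mulA xs, ys⟫) ∂μ := by
    refine integral_mono ((i1.const_mul _).add (i2.const_mul _)) (h.integrable_comp hD hp hι K
      (fun x _ y _ _ => D.Q xs ys x y - D.Fr xs - ⟪D.mulA xs, ys⟫)) fun ω => ?_
    have g2 := hD.primal_gap_nonneg hs ((h.path ω).memX_all hD K)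
    rw [mulA_sub, inner_sub_left] at g2
    simp only [Q, V]
    linarith
  rw [integral_add (i1.const_mul _) (i2.const_mul _), integral_const_mul,
    integral_const_mul] at h2
  have h3 : ∀ k ∈ Finset.range K, ∫ ω, (D.pmin / 2 * wsq D.Cτ (x' k ω - x k ω)
      + D.pmin / 2 * wsq (fun j => (D.σ j)⁻¹) (y' k ω - y k ω)) ∂μ
      = D.pmin / 2 * ∫ ω, wsq D.Cτ (x' k ω - x k ω) ∂μ
        + D.pmin / 2 * ∫ ω, wsq (fun j => (D.σ j)⁻¹) (y' k ω - y k ω) ∂μ := by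
    intro k _
    have j1 := h.integrable_comp hD hp hι k (fun x x' _ _ _ => wsq D.Cτ (x' - x))
    have j2 := h.integrable_comp hD hp hι k
      (fun _ _ y y' _ => wsq (fun j => (D.σ j)⁻¹) (y' - y))
    rw [integral_add (j1.const_mul _) (j2.const_mul _), integral_const_mul, integral_const_mul]
  rw [Finset.sum_congr rfl h3, Finset.sum_add_distrib, ← Finset.mul_sum, ← Finset.mul_sum] at h1
  rw [inner_mulAT_left, mulA_sub, inner_sub_left]
  have h4 : D.Q xs ys x₀ y₀ = D.Fr x₀ + ⟪D.mulA x₀, ys⟫ + D.V (x₀ - xs) (y₀ - ys) := rfl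
  rw [h4] at h1
  linarith

/-- The expected distance between the two dual sequences. -/
lemma dual_distance (hD : D.Assumptions) (hp : D.Parameters) (hι : D.IsSampling μ ι)
    (h : D.IsRandomPath x₀ y₀ ι x x' y y' z) (K : ℕ) :
    ∫ ω, wsq D.wy (y K ω - z K ω) ∂μ
      + ∑ k ∈ Finset.range K, ∫ ω, wsq (fun j => (D.σ j)⁻¹) (y k ω - z k ω) ∂μ
      ≤ D.κ * ∑ k ∈ Finset.range K, ∫ ω, wsq D.Cτ (x' k ω - x k ω) ∂μ := by
  -- The initial value vanishes because both dual sequences start at `y₀`.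
  have h1 := h.integral_succ_le hD hp hι (fun _ y z => wsq D.wy (y - z))
    (fun x x' y _ z => wsq (fun j => (D.σ j)⁻¹) (y - z) - D.κ * wsq D.Cτ (x' - x))
    (fun k ω => by
      have := hp.moment_y_sub_yb hD.β_nonneg (x k ω) (x' k ω) (y k ω) (y' k ω) (z k ω)
      linarith) K
  have h3 : ∀ k ∈ Finset.range K, ∫ ω, (wsq (fun j => (D.σ j)⁻¹) (y k ω - z k ω)
      - D.κ * wsq D.Cτ (x' k ω - x k ω)) ∂μ
      = ∫ ω, wsq (fun j => (D.σ j)⁻¹) (y k ω - z k ω) ∂μ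
        - D.κ * ∫ ω, wsq D.Cτ (x' k ω - x k ω) ∂μ := by
    intro k _
    have j1 := h.integrable_comp hD hp hι k (fun x x' _ _ _ => wsq D.Cτ (x' - x))
    have j2 := h.integrable_comp hD hp hι k
      (fun _ _ y _ z => wsq (fun j => (D.σ j)⁻¹) (y - z))
    rw [integral_sub j2 (j1.const_mul _), integral_const_mul]
  rw [Finset.sum_congr rfl h3, Finset.sum_sub_distrib, ← Finset.mul_sum, sub_self, wsq_zero] at h1
  linarith

lemma integrable_scalarNoise (hD : D.Assumptions) (hp : D.Parameters) (hι : D.IsSampling μ ι)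
    (h : D.IsRandomPath x₀ y₀ ι x x' y y' z) (u : Blk d) (v : Blk e) (K : ℕ) :
    Integrable (fun ω => D.scalarNoise u v (fun k => x k ω) (fun k => x' k ω) (fun k => y k ω)
      (fun k => y' k ω) (fun k => z k ω) K) μ := by
  simp only [scalarNoise]
  have i1 : ∀ k, Integrable (fun ω => D.L u v (x (k + 1) ω) (y (k + 1) ω) (z (k + 1) ω)) μ :=
    fun k => h.integrable_comp hD hp hι (k + 1) (fun x _ y _ z => D.L u v x y z)
  have i2 : ∀ k, Integrable (fun ω => ∑ i, D.p i * D.L u v (setBlk (x k ω) i (x' k ω i))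
      (D.stepY (x k ω) (x' k ω) (y k ω) (y' k ω) i) (D.stepYb (y' k ω) (z k ω) i)) μ :=
    fun k => h.integrable_comp hD hp hι k (fun x x' y y' z => ∑ i, D.p i *
      D.L u v (setBlk x i (x' i)) (D.stepY x x' y y' i) (D.stepYb y' z i))
  have i3 : ∀ k ∈ Finset.range K, Integrable (fun ω =>
      D.L u v (x (k + 1) ω) (y (k + 1) ω) (z (k + 1) ω)
        - ∑ i, D.p i * D.L u v (setBlk (x k ω) i (x' k ω i))
          (D.stepY (x k ω) (x' k ω) (y k ω) (y' k ω) i) (D.stepYb (y' k ω) (z k ω) i)) μ :=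
    fun k _ => (i1 k).sub (i2 k)
  exact integrable_finsetSum _ i3

/-- The scalar noise has mean zero. -/
lemma integral_scalarNoise (hD : D.Assumptions) (hp : D.Parameters) (hι : D.IsSampling μ ι)
    (h : D.IsRandomPath x₀ y₀ ι x x' y y' z) (u : Blk d) (v : Blk e) (K : ℕ) :
    ∫ ω, D.scalarNoise u v (fun k => x k ω) (fun k => x' k ω) (fun k => y k ω)
      (fun k => y' k ω) (fun k => z k ω) K ∂μ = 0 := by
  simp only [scalarNoise]
  have i1 : ∀ k, Integrable (fun ω => D.L u v (x (k + 1) ω) (y (k + 1) ω) (z (k + 1) ω)) μ :=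
    fun k => h.integrable_comp hD hp hι (k + 1) (fun x _ y _ z => D.L u v x y z)
  have i2 : ∀ k, Integrable (fun ω => ∑ i, D.p i * D.L u v (setBlk (x k ω) i (x' k ω i))
      (D.stepY (x k ω) (x' k ω) (y k ω) (y' k ω) i) (D.stepYb (y' k ω) (z k ω) i)) μ :=
    fun k => h.integrable_comp hD hp hι k (fun x x' y y' z => ∑ i, D.p i *
      D.L u v (setBlk x i (x' i)) (D.stepY x x' y y' i) (D.stepYb y' z i))
  have i3 : ∀ k ∈ Finset.range K, Integrable (fun ω =>
      D.L u v (x (k + 1) ω) (y (k + 1) ω) (z (k + 1) ω)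
        - ∑ i, D.p i * D.L u v (setBlk (x k ω) i (x' k ω i))
          (D.stepY (x k ω) (x' k ω) (y k ω) (y' k ω) i) (D.stepYb (y' k ω) (z k ω) i)) μ :=
    fun k _ => (i1 k).sub (i2 k)
  rw [integral_finsetSum _ i3]
  refine Finset.sum_eq_zero fun k _ => ?_
  rw [integral_sub (i1 k) (i2 k), h.integral_succ hD hp hι k (D.L u v), sub_self]

/-- Orthogonality of the increments reduces the squared noise to one-step second moments, which are
expressed in the step lengths that `energy` controls. -/
lemma integral_noise_x (hD : D.Assumptions) (hp : D.Parameters) (hι : D.IsSampling μ ι)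
    (h : D.IsRandomPath x₀ y₀ ι x x' y y' z) (K : ℕ) :
    ∫ ω, wsq D.wx (noise D.p (fun k => x k ω) (fun k i => setBlk (x k ω) i (x' k ω i)) K) ∂μ
      ≤ D.CτV⁻¹ * ∑ k ∈ Finset.range K, ∫ ω, wsq D.Cτ (x' k ω - x k ω) ∂μ := by
  refine (hι.integral_wsq_noise_le hp (fun i => (hp.wx_pos i).le)
    (fun k => h.depends_comp hD hp k fun x _ _ _ _ => x)
    (fun k i => h.depends_comp hD hp k fun x x' _ _ _ => setBlk x i (x' i))
    (fun k ω => (h.path ω).x_succ k) K).trans ?_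
  rw [Finset.mul_sum]
  refine Finset.sum_le_sum fun k _ => ?_
  rw [← integral_const_mul]
  exact integral_mono (h.integrable_comp hD hp hι k fun x x' _ _ _ =>
      ∑ i, D.p i * wsq D.wx (setBlk x i (x' i) - x))
    (h.integrable_comp hD hp hι k fun x x' _ _ _ => D.CτV⁻¹ * wsq D.Cτ (x' - x))
    fun ω => hp.moment_x _ _

lemma integral_noise_Ax (hD : D.Assumptions) (hp : D.Parameters) (hι : D.IsSampling μ ι)
    (h : D.IsRandomPath x₀ y₀ ι x x' y y' z) (K : ℕ) :
    ∫ ω, wsq (fun j => D.σ j * D.pr j) (noise D.p (fun k => D.mulA (x k ω))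
        (fun k i => D.mulA (setBlk (x k ω) i (x' k ω i))) K) ∂μ
      ≤ D.pmin ^ 2 * D.κ * ∑ k ∈ Finset.range K, ∫ ω, wsq D.Cτ (x' k ω - x k ω) ∂μ := by
  refine (hι.integral_wsq_noise_le hp (fun j => (mul_pos (hp.σ_pos j) (hp.pr_pos j)).le)
    (fun k => h.depends_comp hD hp k fun x _ _ _ _ => D.mulA x)
    (fun k i => h.depends_comp hD hp k fun x x' _ _ _ => D.mulA (setBlk x i (x' i)))
    (fun k ω => congrArg D.mulA ((h.path ω).x_succ k)) K).trans ?_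
  rw [Finset.mul_sum]
  refine Finset.sum_le_sum fun k _ => ?_
  rw [← integral_const_mul]
  exact integral_mono (h.integrable_comp hD hp hι k fun x x' _ _ _ =>
      ∑ i, D.p i * wsq (fun j => D.σ j * D.pr j) (D.mulA (setBlk x i (x' i)) - D.mulA x))
    (h.integrable_comp hD hp hι k fun x x' _ _ _ => D.pmin ^ 2 * D.κ * wsq D.Cτ (x' - x))
    fun ω => hp.moment_Ax hD.β_nonneg _ _

lemma integral_noise_y (hD : D.Assumptions) (hp : D.Parameters) (hι : D.IsSampling μ ι)
    (h : D.IsRandomPath x₀ y₀ ι x x' y y' z) (K : ℕ) :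
    ∫ ω, wsq D.wy (noise D.p (fun k => y k ω)
        (fun k i => D.stepY (x k ω) (x' k ω) (y k ω) (y' k ω) i) K) ∂μ
      ≤ 2 * ∑ k ∈ Finset.range K, ∫ ω, wsq (fun j => (D.σ j)⁻¹) (y' k ω - y k ω) ∂μ
        + 2 * (D.κ * ∑ k ∈ Finset.range K, ∫ ω, wsq D.Cτ (x' k ω - x k ω) ∂μ) := by
  refine (hι.integral_wsq_noise_le hp (fun j => (hp.wy_pos j).le)
    (fun k => h.depends_comp hD hp k fun _ _ y _ _ => y)
    (fun k i => h.depends_comp hD hp k fun x x' y y' _ => D.stepY x x' y y' i)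
    (fun k ω => (h.path ω).y_succ k) K).trans ?_
  rw [Finset.mul_sum, Finset.mul_sum, Finset.mul_sum, ← Finset.sum_add_distrib]
  refine Finset.sum_le_sum fun k _ => ?_
  have j1 := h.integrable_comp hD hp hι k
    (fun _ _ y y' _ => wsq (fun j => (D.σ j)⁻¹) (y' - y))
  have j2 := h.integrable_comp hD hp hι k (fun x x' _ _ _ => wsq D.Cτ (x' - x))
  rw [← integral_const_mul, ← integral_const_mul, ← integral_const_mul,
    ← integral_add (j1.const_mul _) ((j2.const_mul _).const_mul _)]
  exact integral_mono (h.integrable_comp hD hp hι k fun x x' y y' _ =>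
      ∑ i, D.p i * wsq D.wy (D.stepY x x' y y' i - y))
    ((j1.const_mul _).add ((j2.const_mul _).const_mul _))
    fun ω => hp.moment_y hD.β_nonneg _ _ _ _

/-- The increment is governed by `y' - z`, which is split at `y`: `energy` controls `y' - y` and
`dual_distance` controls `y - z`. -/
lemma integral_noise_z (hD : D.Assumptions) (hp : D.Parameters) (hι : D.IsSampling μ ι)
    (h : D.IsRandomPath x₀ y₀ ι x x' y y' z) (K : ℕ) :
    ∫ ω, wsq D.wy (noise D.p (fun k => z k ω) (fun k i => D.stepYb (y' k ω) (z k ω) i) K) ∂μ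
      ≤ 2 * ∑ k ∈ Finset.range K, ∫ ω, wsq (fun j => (D.σ j)⁻¹) (y' k ω - y k ω) ∂μ
        + 2 * ∑ k ∈ Finset.range K, ∫ ω, wsq (fun j => (D.σ j)⁻¹) (y k ω - z k ω) ∂μ := by
  refine (hι.integral_wsq_noise_le hp (fun j => (hp.wy_pos j).le)
    (fun k => h.depends_comp hD hp k fun _ _ _ _ z => z)
    (fun k i => h.depends_comp hD hp k fun _ _ _ y' z => D.stepYb y' z i)
    (fun k ω => (h.path ω).z_succ k) K).trans ?_
  rw [Finset.mul_sum, Finset.mul_sum, ← Finset.sum_add_distrib]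
  refine Finset.sum_le_sum fun k _ => ?_
  have j1 := h.integrable_comp hD hp hι k
    (fun _ _ y y' _ => wsq (fun j => (D.σ j)⁻¹) (y' - y))
  have j2 := h.integrable_comp hD hp hι k (fun _ _ y _ z => wsq (fun j => (D.σ j)⁻¹) (y - z))
  rw [← integral_const_mul, ← integral_const_mul,
    ← integral_add (j1.const_mul _) (j2.const_mul _)]
  refine integral_mono (h.integrable_comp hD hp hι k fun _ _ _ y' z =>
      ∑ i, D.p i * wsq D.wy (D.stepYb y' z i - z))
    ((j1.const_mul _).add (j2.const_mul _)) fun ω => ?_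
  simp only [hp.moment_yb]
  have := wsq_add_le (fun j => (inv_pos.2 (hp.σ_pos j)).le) (y' k ω - y k ω) (y k ω - z k ω)
  rwa [sub_add_sub_cancel] at this

/-- The expected distance of the auxiliary dual sequence to its starting point. -/
lemma integral_z_sub (hD : D.Assumptions) (hp : D.Parameters) (hι : D.IsSampling μ ι)
    (h : D.IsRandomPath x₀ y₀ ι x x' y y' z) (ys : Blk e) (K : ℕ) :
    ∫ ω, wsq D.wy (z K ω - y 0 ω) ∂μ
      ≤ 3 * (∫ ω, wsq D.wy (y K ω - z K ω) ∂μ + ∫ ω, wsq D.wy (y K ω - ys) ∂μ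
        + wsq D.wy (y₀ - ys)) := by
  have j1 := h.integrable_comp hD hp hι K (fun _ _ y _ z => wsq D.wy (y - z))
  have j2 := h.integrable_comp hD hp hι K (fun _ _ y _ _ => wsq D.wy (y - ys))
  have j3 : Integrable (fun _ : Ω => wsq D.wy (y₀ - ys)) μ := integrable_const _
  have h1 : ∫ ω, 3 * (wsq D.wy (y K ω - z K ω) + wsq D.wy (y K ω - ys)
      + wsq D.wy (y₀ - ys)) ∂μ = 3 * (∫ ω, wsq D.wy (y K ω - z K ω) ∂μ
        + ∫ ω, wsq D.wy (y K ω - ys) ∂μ + wsq D.wy (y₀ - ys)) := by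
    have j4 : Integrable (fun ω => wsq D.wy (y K ω - z K ω) + wsq D.wy (y K ω - ys)) μ :=
      j1.add j2
    rw [integral_const_mul, integral_add j4 j3, integral_add j1 j2]
    simp
  rw [← h1]
  simp only [h.y_zero]
  refine integral_mono (h.integrable_comp hD hp hι K fun _ _ _ _ z => wsq D.wy (z - y₀))
    (((j1.add j2).add j3).const_mul _) fun ω => ?_
  have := wsq_add_add_le (fun j => (hp.wy_pos j).le) (z K ω - y K ω) (y K ω - ys) (ys - y₀)
  rw [wsq_sub_comm D.wy (z K ω), wsq_sub_comm D.wy ys, sub_add_sub_cancel,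
    sub_add_sub_cancel] at this
  exact this

end IsRandomPath

end Data

/-! ### Bounded suprema, extended expectations and numerical constants -/

lemma bddAbove_image_of_isBounded {E : Type*} [PseudoMetricSpace E] [ProperSpace E] {f : E → ℝ}
    (hf : Continuous f) {s : Set E} (hs : Bornology.IsBounded s) : BddAbove (f '' s) :=
  (hs.isCompact_closure.bddAbove_image hf.continuousOn).mono (Set.image_mono subset_closure)

lemma continuous_wsq {n : ℕ} {d : Fin n → ℕ} (w : Fin n → ℝ) :
    Continuous (fun x : Blk d => wsq w x) := by
  unfold wsq; fun_prop

lemma expPos_mono {Ω : Type*} [MeasurableSpace Ω] {μ : Measure Ω} {G H : Ω → EReal}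
    (h : ∀ ω, G ω ≤ H ω) : expPos μ G ≤ expPos μ H :=
  lintegral_mono fun ω => EReal.toENNReal_le_toENNReal (h ω)

lemma expNeg_anti {Ω : Type*} [MeasurableSpace Ω] {μ : Measure Ω} {G H : Ω → EReal}
    (h : ∀ ω, G ω ≤ H ω) : expNeg μ H ≤ expNeg μ G :=
  lintegral_mono fun ω => EReal.toENNReal_le_toENNReal (EReal.neg_le_neg_iff.2 (h ω))

/-- Integrability is not needed, since subtraction in `EReal` is monotone even with infinite
arguments. This matters because the negative part of the gap may have infinite expectation. -/
lemma expectation_mono {Ω : Type*} [MeasurableSpace Ω] {μ : Measure Ω} {G H : Ω → EReal}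
    (h : ∀ ω, G ω ≤ H ω) : expectation μ G ≤ expectation μ H :=
  EReal.sub_le_sub (EReal.coe_ennreal_le_coe_ennreal_iff.2 (expPos_mono h))
    (EReal.coe_ennreal_le_coe_ennreal_iff.2 (expNeg_anti h))

lemma expPos_coe {Ω : Type*} [MeasurableSpace Ω] (μ : Measure Ω) (R : Ω → ℝ) :
    expPos μ (fun ω => (R ω : EReal)) = ∫⁻ ω, ENNReal.ofReal (R ω) ∂μ := by
  simp only [expPos]
  refine lintegral_congr fun ω => ?_
  simp

lemma expNeg_coe {Ω : Type*} [MeasurableSpace Ω] (μ : Measure Ω) (R : Ω → ℝ) :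
    expNeg μ (fun ω => (R ω : EReal)) = ∫⁻ ω, ENNReal.ofReal (-R ω) ∂μ := by
  simp only [expNeg]
  refine lintegral_congr fun ω => ?_
  rw [← EReal.coe_neg]
  simp

lemma expPos_coe_lt_top {Ω : Type*} [MeasurableSpace Ω] {μ : Measure Ω} {R : Ω → ℝ}
    (hR : Integrable R μ) : expPos μ (fun ω => (R ω : EReal)) < ⊤ := by
  rw [expPos_coe]; exact hR.lintegral_lt_top

lemma expectation_coe {Ω : Type*} [MeasurableSpace Ω] {μ : Measure Ω} {R : Ω → ℝ}
    (hR : Integrable R μ) : expectation μ (fun ω => (R ω : EReal)) = ((∫ ω, R ω ∂μ : ℝ) : EReal) := by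
  have h1 := hR.lintegral_lt_top
  have h2 := hR.neg.lintegral_lt_top
  simp only [Pi.neg_apply] at h2
  rw [expectation, expPos_coe, expNeg_coe, integral_eq_lintegral_pos_part_sub_lintegral_neg_part hR,
    EReal.coe_sub, EReal.coe_ennreal_toReal h1.ne, EReal.coe_ennreal_toReal h2.ne]

lemma sqrt_two_mul_le (t : ℝ) : Real.sqrt (2 * t) ≤ 2 * Real.sqrt t := by
  rw [Real.sqrt_mul (by norm_num)]
  refine mul_le_mul_of_nonneg_right ?_ (Real.sqrt_nonneg _)
  rw [Real.sqrt_le_left (by norm_num)]; norm_num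

/-- The difference of the sides is affine in `B` with positive slope `8 * q ^ 2 - 2 * q + 5`, and
equals `7 * q ^ 2 + 6 * q + 6` at `B = 1`. -/
lemma coefficient_bound {q B : ℝ} (hq : 1 ≤ q) (hB : 1 ≤ B) :
    2 * B + 6 * ((2 * q - 1) * B) + (4 + q ^ 2 + q) ≤ 5 + 9 * q + B * (1 + 10 * q + 8 * q ^ 2) := by
  have h1 : 0 ≤ 8 * q ^ 2 - 2 * q + 5 := by nlinarith
  have h2 := mul_nonneg (sub_nonneg.2 hB) h1
  linarith [sq_nonneg q]

/-- The numerical bound for the part of the constant that is proportional to `Δ₀`. -/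
lemma constant_bound {p B Δ r s X Y U W rx sy n₁ n₂ n₃ n₄ wz : ℝ} (hp : 0 < p) (hp1 : p ≤ 1)
    (hB : 1 ≤ B) (hr : 0 ≤ r) (hs : 0 ≤ s) (hX : 0 ≤ X) (hY : 0 ≤ Y) (hrx : 0 ≤ rx) (hsy : 0 ≤ sy)
    (h₁ : p / 2 * r + p / 2 * s + p / 2 * X + p / 2 * Y ≤ Δ)
    (h₂ : p / 2 * rx + p / 2 * sy ≤ Δ)
    (h₃ : U + W ≤ (2 * p⁻¹ - 1) * B * X)
    (hn₁ : n₁ ≤ B * X) (hn₂ : n₂ ≤ p ^ 2 * ((2 * p⁻¹ - 1) * B) * X)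
    (hn₃ : n₃ ≤ 2 * Y + 2 * ((2 * p⁻¹ - 1) * B * X)) (hn₄ : n₄ ≤ 2 * Y + 2 * W)
    (hwz : wz ≤ 3 * (U + s + sy)) :
    1 / 2 * r + p * n₁ + (2 * p)⁻¹ * n₂ + p / 4 * n₃ + p * n₄ + 2 / 3 * p * wz + 3 / 2 * p * rx
        + (2 * p)⁻¹ * sy + 1 / 2 * rx + 1 / 2 * sy
      ≤ Δ * (5 + 9 * p⁻¹ + B * (1 + 10 * p⁻¹ + 8 * (p ^ 2)⁻¹)) := by
  obtain ⟨q, hq⟩ : ∃ q, q = p⁻¹ := ⟨_, rfl⟩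
  have hpq : p * q = 1 := by rw [hq]; exact mul_inv_cancel₀ hp.ne'
  have hq1 : 1 ≤ q := by rw [hq]; exact (one_le_inv₀ hp).2 hp1
  have hq2 : (p ^ 2)⁻¹ = q ^ 2 := by rw [hq, inv_pow]
  have hq3 : (2 * p)⁻¹ = q / 2 := by rw [hq, mul_inv]; ring
  have hU : ∀ t, q * (p / 2 * t) = t / 2 := fun t => by linear_combination t / 2 * hpq
  rw [← hq] at h₃ hn₂ hn₃ ⊢
  rw [hq2, hq3]
  obtain ⟨κ, hκ⟩ : ∃ κ, κ = (2 * q - 1) * B := ⟨_, rfl⟩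
  rw [← hκ] at h₃ hn₂ hn₃
  -- In units of `p / 2` the hypotheses read `r' + s' + a + b ≤ Δ` and `α + γ ≤ Δ`, and it suffices
  -- to collect coefficients.
  obtain ⟨a, ha⟩ : ∃ a, a = p / 2 * X := ⟨_, rfl⟩
  obtain ⟨b, hb⟩ : ∃ b, b = p / 2 * Y := ⟨_, rfl⟩
  obtain ⟨r', hr'⟩ : ∃ r', r' = p / 2 * r := ⟨_, rfl⟩
  obtain ⟨s', hs'⟩ : ∃ s', s' = p / 2 * s := ⟨_, rfl⟩
  obtain ⟨α, hα⟩ : ∃ α, α = p / 2 * rx := ⟨_, rfl⟩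
  obtain ⟨γ, hγ⟩ : ∃ γ, γ = p / 2 * sy := ⟨_, rfl⟩
  have e1 : p * n₁ ≤ 2 * B * a := by
    have := mul_le_mul_of_nonneg_left hn₁ hp.le
    rw [ha]; linarith
  have e2 : q / 2 * n₂ ≤ κ * a := by
    have := mul_le_mul_of_nonneg_left hn₂ (by linarith : 0 ≤ q / 2)
    refine this.trans (le_of_eq ?_)
    rw [ha]; linear_combination p * κ * X / 2 * hpq
  have e3 : p / 4 * n₃ ≤ b + κ * a := by
    have := mul_le_mul_of_nonneg_left hn₃ (by linarith : 0 ≤ p / 4)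
    rw [ha, hb]; linarith
  have e4 : p * n₄ ≤ 4 * b + 2 * p * W := by
    have := mul_le_mul_of_nonneg_left hn₄ hp.le
    rw [hb]; linarith
  have e5 : 2 / 3 * p * wz ≤ 2 * p * U + 4 * s' + 4 * γ := by
    have := mul_le_mul_of_nonneg_left hwz (by linarith : 0 ≤ 2 / 3 * p)
    rw [hs', hγ]; linarith
  -- The weight `2 / 3` on `wz` gives `U` the same factor `2 * p` as `W`, so the bound on their sum
  -- is used only once.
  have e6 : 2 * p * U + 2 * p * W ≤ 4 * κ * a := by
    have := mul_le_mul_of_nonneg_left h₃ (by linarith : 0 ≤ 2 * p)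
    rw [ha]; linarith
  have e7 : 1 / 2 * r = q * r' := by rw [hr', hU]; ring
  have e8 : 1 / 2 * rx = q * α := by rw [hα, hU]; ring
  have e9 : 1 / 2 * sy = q * γ := by rw [hγ, hU]; ring
  have e10 : q / 2 * sy = q ^ 2 * γ := by
    rw [sq, mul_assoc, hγ, hU]; ring
  have e11 : 3 / 2 * p * rx = 3 * α := by rw [hα]; ring
  have ha0 : 0 ≤ a := by rw [ha]; positivity
  have hb0 : 0 ≤ b := by rw [hb]; positivity
  have hr0 : 0 ≤ r' := by rw [hr']; positivity
  have hs0 : 0 ≤ s' := by rw [hs']; positivity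
  have hα0 : 0 ≤ α := by rw [hα]; positivity
  have hγ0 : 0 ≤ γ := by rw [hγ]; positivity
  have hΔ1 : r' + s' + a + b ≤ Δ := by rw [ha, hb, hr', hs']; exact h₁
  have hΔ2 : α + γ ≤ Δ := by rw [hα, hγ]; exact h₂
  have hΔ0 : 0 ≤ Δ := by linarith
  have hκ1 : q ≤ κ := by
    have := mul_le_mul (by linarith : q ≤ 2 * q - 1) hB zero_le_one (by linarith)
    rw [hκ]; linarith
  -- The coefficient of `a`; as `1 ≤ B` and `1 ≤ q ≤ κ`, it also dominates the coefficients `q`, `5`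
  -- and `4` of the others.
  set M := 2 * B + 6 * κ with hM
  have m1 : q * r' + M * a + 5 * b + 4 * s' ≤ M * Δ := by
    have g1 : q * r' ≤ M * r' := mul_le_mul_of_nonneg_right (by linarith) hr0
    have g2 : 5 * b ≤ M * b := mul_le_mul_of_nonneg_right (by linarith) hb0
    have g3 : 4 * s' ≤ M * s' := mul_le_mul_of_nonneg_right (by linarith) hs0
    have g4 := mul_le_mul_of_nonneg_left hΔ1 (by linarith : 0 ≤ M)
    linarith
  have m2 : 3 * α + 4 * γ + q ^ 2 * γ + q * α + q * γ ≤ (4 + q ^ 2 + q) * Δ := by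
    have g1 : 0 ≤ (1 + q ^ 2) * α := by positivity
    have g2 := mul_le_mul_of_nonneg_left hΔ2 (by positivity : 0 ≤ 4 + q ^ 2 + q)
    linarith
  have m3 : M + (4 + q ^ 2 + q) ≤ 5 + 9 * q + B * (1 + 10 * q + 8 * q ^ 2) := by
    rw [hM, hκ]
    exact coefficient_bound hq1 hB
  have m4 := mul_le_mul_of_nonneg_left m3 hΔ0
  linarith

lemma integral_combination {Ω : Type*} [MeasurableSpace Ω] {μ : Measure Ω}
    [IsProbabilityMeasure μ] {f₁ f₂ f₃ f₄ f₅ f₆ f₇ f₈ : Ω → ℝ} (h₁ : Integrable f₁ μ)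
    (h₂ : Integrable f₂ μ) (h₃ : Integrable f₃ μ) (h₄ : Integrable f₄ μ) (h₅ : Integrable f₅ μ)
    (h₆ : Integrable f₆ μ) (h₇ : Integrable f₇ μ) (h₈ : Integrable f₈ μ)
    (c a₁ a₂ a₄ a₅ a₆ a₇ a₈ : ℝ) :
    Integrable (fun ω => c + a₁ * f₁ ω + a₂ * f₂ ω + f₃ ω + a₄ * f₄ ω + a₅ * f₅ ω + a₆ * f₆ ω
      + a₇ * f₇ ω + a₈ * f₈ ω) μ ∧
    ∫ ω, (c + a₁ * f₁ ω + a₂ * f₂ ω + f₃ ω + a₄ * f₄ ω + a₅ * f₅ ω + a₆ * f₆ ω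
      + a₇ * f₇ ω + a₈ * f₈ ω) ∂μ
      = c + a₁ * ∫ ω, f₁ ω ∂μ + a₂ * ∫ ω, f₂ ω ∂μ + ∫ ω, f₃ ω ∂μ + a₄ * ∫ ω, f₄ ω ∂μ
        + a₅ * ∫ ω, f₅ ω ∂μ + a₆ * ∫ ω, f₆ ω ∂μ + a₇ * ∫ ω, f₇ ω ∂μ + a₈ * ∫ ω, f₈ ω ∂μ := by
  refine ⟨by fun_prop, ?_⟩
  rw [integral_add (by fun_prop) (by fun_prop), integral_add (by fun_prop) (by fun_prop),
    integral_add (by fun_prop) (by fun_prop), integral_add (by fun_prop) (by fun_prop),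
    integral_add (by fun_prop) (by fun_prop), integral_add (by fun_prop) (by fun_prop),
    integral_add (by fun_prop) (by fun_prop), integral_add (by fun_prop) (by fun_prop)]
  simp only [integral_const_mul, integral_const, probReal_univ, one_smul]

/-! ### Expectation of the path bound; passage to averages and to the extended gap -/

namespace Data

variable {n m : ℕ} {d : Fin n → ℕ} {e : Fin m → ℕ} {D : Data d e}
  {Ω : Type*} {ι : ℕ → Ω → Fin n}
  {x₀ xs : Blk d} {y₀ ys : Blk e} {x x' : ℕ → Ω → Blk d} {y y' z : ℕ → Ω → Blk e}

namespace IsRandomPath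

/-- The expectation of the bound on the accumulated gap. -/
lemma integral_pathBound_le [MeasurableSpace Ω] {μ : Measure Ω} [IsProbabilityMeasure μ]
    (hD : D.Assumptions) (hp : D.Parameters) (hι : D.IsSampling μ ι)
    (h : D.IsRandomPath x₀ y₀ ι x x' y y' z) (hs : D.IsSolution xs ys) {S SA SX Δ : ℝ}
    (hSA : 0 ≤ SA) (hSX : 0 ≤ SX)
    (hΔ : Δ = D.Fr x₀ - D.Fr xs + ⟪D.mulAT ys, x₀ - xs⟫ + D.V (x₀ - xs) (y₀ - ys)) (K : ℕ) :
    Integrable (fun ω => D.pathBound xs ys S SA SX (fun k => x k ω) (fun k => x' k ω)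
      (fun k => y k ω) (fun k => y' k ω) (fun k => z k ω) K) μ ∧
    ∫ ω, D.pathBound xs ys S SA SX (fun k => x k ω) (fun k => x' k ω)
      (fun k => y k ω) (fun k => y' k ω) (fun k => z k ω) K ∂μ
      ≤ S + 4 * Real.sqrt (Δ * D.pmin⁻¹) * SA
        + Real.sqrt (Δ * (D.pmin⁻¹ + 2 * (D.pmin ^ 2)⁻¹ * D.CτV⁻¹)) * SX
        + (Δ * (5 + 9 * D.pmin⁻¹ + D.CτV⁻¹ * (1 + 10 * D.pmin⁻¹ + 8 * (D.pmin ^ 2)⁻¹))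
          + (1 - D.pmin) * (D.Fr x₀ - D.Fr xs) + (D.Hr y₀ - D.Hr ys)
          + 1 / 2 * wsq (fun i => D.τ i * D.p i) (D.mulAT ys)) := by
  have hm := hp.pmin_pos
  have hwx : ∀ i, 0 ≤ D.wx i := fun i => (hp.wx_pos i).le
  have hwy : ∀ j, 0 ≤ D.wy j := fun j => (hp.wy_pos j).le
  have hσ : ∀ j, 0 ≤ (D.σ j)⁻¹ := fun j => (inv_pos.2 (hp.σ_pos j)).le
  have hr0 : 0 ≤ ∫ ω, wsq D.wx (x K ω - xs) ∂μ := integral_nonneg fun ω => wsq_nonneg hwx _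
  have hs0 : 0 ≤ ∫ ω, wsq D.wy (y K ω - ys) ∂μ := integral_nonneg fun ω => wsq_nonneg hwy _
  have hX0 : 0 ≤ ∑ k ∈ Finset.range K, ∫ ω, wsq D.Cτ (x' k ω - x k ω) ∂μ :=
    Finset.sum_nonneg fun k _ => integral_nonneg fun ω =>
      wsq_nonneg (fun i => (hp.Cτ_pos i).le) _
  have hY0 : 0 ≤ ∑ k ∈ Finset.range K, ∫ ω, wsq (fun j => (D.σ j)⁻¹) (y' k ω - y k ω) ∂μ :=
    Finset.sum_nonneg fun k _ => integral_nonneg fun ω => wsq_nonneg hσ _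
  have hm2 : 0 ≤ D.pmin / 2 := (half_pos hm).le
  have hrx := wsq_nonneg hwx (x₀ - xs)
  have hsy := wsq_nonneg hwy (y₀ - ys)
  have hen := h.energy hD hp hι hs K
  rw [← hΔ] at hen
  have hΔ' : D.pmin / 2 * wsq D.wx (x₀ - xs) + D.pmin / 2 * wsq D.wy (y₀ - ys) ≤ Δ := by
    have hΩ : Nonempty Ω := nonempty_of_isProbabilityMeasure μ
    obtain ⟨ω⟩ := hΩ
    have h1 := hD.primal_gap_nonneg hs ((h.path ω).memX_all hD 0)
    simp only [h.x_zero] at h1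
    rw [hΔ, inner_mulAT_left, V]
    linarith
  have hdist := h.dual_distance hD hp hι K
  -- the square root terms
  have hB := (one_le_inv₀ hp.CτV_pos).2 (hp.CτV_le_one hD.β_nonneg)
  have hq := (one_le_inv₀ hm).2 hp.pmin_le_one
  have two_of : ∀ t u : ℝ, 0 ≤ u → D.pmin / 2 * t + u ≤ Δ → t ≤ 2 * (Δ * D.pmin⁻¹) := by
    intro t u hu htu
    have h1 : D.pmin * t ≤ 2 * Δ := by linarith
    have h2 := mul_le_mul_of_nonneg_left h1 (inv_nonneg.2 hm.le)
    rw [inv_mul_cancel_left₀ hm.ne'] at h2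
    linarith
  have four := sqrt_two_mul_le (Δ * D.pmin⁻¹)
  have hsx₀ : wnorm D.wx (x₀ - xs) ≤ 2 * Real.sqrt (Δ * D.pmin⁻¹) :=
    (Real.sqrt_le_sqrt (two_of _ _ (mul_nonneg hm2 hsy) hΔ')).trans four
  have iw : Integrable (fun ω => wnorm D.wx (x K ω - xs)) μ :=
    h.integrable_comp hD hp hι K fun x _ _ _ _ => wnorm D.wx (x - xs)
  have i2 : Integrable (fun ω => wsq D.wx (x K ω - xs)) μ :=
    h.integrable_comp hD hp hι K fun x _ _ _ _ => wsq D.wx (x - xs)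
  -- Jensen's inequality converts the second moment given by `energy` into a first moment.
  have hsxK : ∫ ω, wnorm D.wx (x K ω - xs) ∂μ ≤ 2 * Real.sqrt (Δ * D.pmin⁻¹) := by
    refine (integral_le_sqrt iw (by simpa only [wnorm_sq hwx] using i2) (c := 2 * (Δ * D.pmin⁻¹))
      ?_).trans four
    simp only [wnorm_sq hwx]
    refine two_of _ _ (add_nonneg (add_nonneg (mul_nonneg hm2 hs0) (mul_nonneg hm2 hX0))
      (mul_nonneg hm2 hY0)) (le_trans (le_of_eq (by ring)) hen)
  have hsy₀ : wnorm D.wy (ys - y₀)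
      ≤ Real.sqrt (Δ * (D.pmin⁻¹ + 2 * (D.pmin ^ 2)⁻¹ * D.CτV⁻¹)) := by
    refine Real.sqrt_le_sqrt ?_
    rw [wsq_sub_comm]
    refine (two_of _ _ (mul_nonneg hm2 hrx) (by linarith)).trans ?_
    have hΔ0 : 0 ≤ Δ := le_trans (add_nonneg (mul_nonneg hm2 hrx) (mul_nonneg hm2 hsy)) hΔ'
    -- The direct bound has constant `2 * pmin⁻¹`; the larger one in `Cg₁` dominates it because
    -- `pmin⁻¹` and `CτV⁻¹` are at least `1`.
    have h1 : 2 * D.pmin⁻¹ ≤ D.pmin⁻¹ + 2 * (D.pmin ^ 2)⁻¹ * D.CτV⁻¹ := by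
      rw [← inv_pow]
      have h2 := mul_le_mul_of_nonneg_left hB (sq_nonneg D.pmin⁻¹)
      have h3 := mul_le_mul_of_nonneg_left hq (inv_nonneg.2 hm.le)
      linarith
    linarith [mul_le_mul_of_nonneg_left h1 hΔ0]
  -- integrability of the noise terms
  have i3 := h.integrable_scalarNoise hD hp hι x₀ y₀ K
  have i4 := ((dependsOnFirst_noise D.p (fun k => h.depends_comp hD hp k fun x _ _ _ _ => x)
    (fun k i => h.depends_comp hD hp k fun x x' _ _ _ => setBlk x i (x' i)) K).comp
    (wsq D.wx)).integrable (μ := μ) hι.meas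
  have i5 := ((dependsOnFirst_noise D.p
    (fun k => h.depends_comp hD hp k fun x _ _ _ _ => D.mulA x)
    (fun k i => h.depends_comp hD hp k fun x x' _ _ _ => D.mulA (setBlk x i (x' i))) K).comp
    (wsq fun j => D.σ j * D.pr j)).integrable (μ := μ) hι.meas
  have i6 := ((dependsOnFirst_noise D.p (fun k => h.depends_comp hD hp k fun _ _ y _ _ => y)
    (fun k i => h.depends_comp hD hp k fun x x' y y' _ => D.stepY x x' y y' i) K).comp
    (wsq D.wy)).integrable (μ := μ) hι.meas
  have i7 := ((dependsOnFirst_noise D.p (fun k => h.depends_comp hD hp k fun _ _ _ _ z => z)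
    (fun k i => h.depends_comp hD hp k fun _ _ _ y' z => D.stepYb y' z i) K).comp
    (wsq D.wy)).integrable (μ := μ) hι.meas
  have i8 : Integrable (fun ω => wsq D.wy (z K ω - y₀)) μ :=
    h.integrable_comp hD hp hι K fun _ _ _ _ z => wsq D.wy (z - y₀)
  have j3 := h.integral_scalarNoise hD hp hι x₀ y₀ K
  have j4 := h.integral_noise_x hD hp hι K
  have j5 := h.integral_noise_Ax hD hp hι K
  have j6 := h.integral_noise_y hD hp hι K
  have j7 := h.integral_noise_z hD hp hι K
  have j8 := h.integral_z_sub hD hp hι ys K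
  simp only [h.y_zero] at j8
  have hconst := constant_bound hm hp.pmin_le_one hB hr0 hs0 hX0 hY0 hrx hsy
    (le_trans (le_of_eq (by ring)) hen) hΔ' hdist j4 j5 j6 j7 j8
  set c₀ := S + SA * wnorm D.wx (x₀ - xs) + SX * wnorm D.wy (ys - y₀)
    + (1 - D.pmin) * (D.Fr x₀ - D.Fr xs) + 1 / 2 * wsq (fun i => D.τ i * D.p i) (D.mulAT ys)
    + (D.Hr y₀ - D.Hr ys) + 3 / 2 * D.pmin * wsq D.wx (x₀ - xs)
    + (2 * D.pmin)⁻¹ * wsq D.wy (y₀ - ys) + 1 / 2 * wsq D.wx (x₀ - xs)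
    + 1 / 2 * wsq D.wy (y₀ - ys) with hc₀
  have heq : ∀ ω, D.pathBound xs ys S SA SX (fun k => x k ω) (fun k => x' k ω)
      (fun k => y k ω) (fun k => y' k ω) (fun k => z k ω) K
      = c₀ + SA * wnorm D.wx (x K ω - xs) + 1 / 2 * wsq D.wx (x K ω - xs)
        + D.scalarNoise x₀ y₀ (fun k => x k ω) (fun k => x' k ω) (fun k => y k ω)
          (fun k => y' k ω) (fun k => z k ω) K
        + D.pmin * wsq D.wx (noise D.p (fun k => x k ω) (fun k i => setBlk (x k ω) i (x' k ω i)) K)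
        + (2 * D.pmin)⁻¹ * wsq (fun j => D.σ j * D.pr j) (noise D.p (fun k => D.mulA (x k ω))
          (fun k i => D.mulA (setBlk (x k ω) i (x' k ω i))) K)
        + D.pmin / 4 * wsq D.wy (noise D.p (fun k => y k ω)
          (fun k i => D.stepY (x k ω) (x' k ω) (y k ω) (y' k ω) i) K)
        + D.pmin * wsq D.wy (noise D.p (fun k => z k ω)
          (fun k i => D.stepYb (y' k ω) (z k ω) i) K)
        + 2 / 3 * D.pmin * wsq D.wy (z K ω - y₀) := by
    intro ω
    simp only [pathBound, h.x_zero, h.y_zero]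
    rw [hc₀]
    ring
  obtain ⟨hint, hval⟩ := integral_combination iw i2 i3 i4 i5 i6 i7 i8 c₀ SA (1 / 2) D.pmin
    (2 * D.pmin)⁻¹ (D.pmin / 4) D.pmin (2 / 3 * D.pmin)
  simp only [heq]
  refine ⟨hint, hval.trans_le ?_⟩
  rw [j3]
  have k1 := mul_le_mul_of_nonneg_left hsx₀ hSA
  have k2 := mul_le_mul_of_nonneg_left hsxK hSA
  have k3 := mul_le_mul_of_nonneg_left hsy₀ hSX
  rw [hc₀]
  linarith

end IsRandomPath

/-- A run of the algorithm is a random path. -/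
lemma IsRun.isRandomPath (hD : D.Assumptions) (hx₀ : x₀ ∈ dom D.gSum) (hy₀ : y₀ ∈ dom D.hConj)
    {xbar : ℕ → Ω → Blk d} {ybar : ℕ → Ω → Blk e}
    (h : D.IsRun x₀ y₀ ι x xbar y ybar z) :
    D.IsRandomPath x₀ y₀ ι x (fun k => xbar (k + 1)) y (fun k => ybar (k + 1)) z := by
  have hx : ∀ k ω, x (k + 1) ω = setBlk (x k ω) (ι k ω) (xbar (k + 1) ω (ι k ω)) := by
    intro k ω
    refine PiLp.ext fun i => ?_
    by_cases hi : i = ι k ω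
    · subst hi; rw [setBlk_same, h.x_upd]
    · rw [setBlk_of_ne _ hi, h.x_keep k ω i hi]
  refine ⟨fun ω => ⟨fun k => ⟨h.ybar_succ k ω, h.xbar_succ k ω⟩, fun k => hx k ω, fun k => ?_,
    fun k => ?_, by rw [h.yb_zero, h.y_zero], ?_, ?_⟩, h.x_zero, h.y_zero⟩
  · refine PiLp.ext fun j => ?_
    by_cases hj : j ∈ D.J (ι k ω)
    · rw [h.y_upd k ω j hj, hx k ω, mulA_setBlk_sub]; simp [stepY, hj]
    · rw [h.y_keep k ω j hj]; simp [stepY, hj]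
  · refine PiLp.ext fun j => ?_
    by_cases hj : j ∈ D.J (ι k ω)
    · rw [h.yb_upd k ω j hj]; simp [stepYb, hj]
    · rw [h.yb_keep k ω j hj]; simp [stepYb, hj]
  · rw [h.x_zero]; exact hD.memX_iff.1 hx₀
  · rw [h.y_zero]; exact hD.memY_iff.1 hy₀

lemma average_f_le (hD : D.Assumptions) {K : ℕ} (hK : 1 ≤ K) (u : ℕ → Blk d) :
    D.f ((K : ℝ)⁻¹ • ∑ k ∈ Finset.Icc 1 K, u k)
      ≤ (K : ℝ)⁻¹ * ∑ k ∈ Finset.Icc 1 K, D.f (u k) := by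
  have hK' : (K : ℝ) ≠ 0 := by positivity
  have := hD.f_convex.map_sum_le (t := Finset.Icc 1 K) (w := fun _ => (K : ℝ)⁻¹)
    (p := u) (fun _ _ => by positivity) (by simp [hK']) (fun k _ => Set.mem_univ _)
  simpa [Finset.smul_sum, Finset.mul_sum] using this

/-- The gap at the averages is at most the average of the gaps. -/
lemma Γ_average_le (hD : D.Assumptions) {K : ℕ} (hK : 1 ≤ K) (u : Blk d) (v : Blk e)
    {a : ℕ → Blk d} {b : ℕ → Blk e} (ha : ∀ k, D.MemX (a k)) (hb : ∀ k, D.MemY (b k)) :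
    D.Γ u v ((K : ℝ)⁻¹ • ∑ k ∈ Finset.Icc 1 K, a k) ((K : ℝ)⁻¹ • ∑ k ∈ Finset.Icc 1 K, b k)
      ≤ (K : ℝ)⁻¹ * ∑ k ∈ Finset.Icc 1 K, D.Γ u v (a k) (b k) := by
  have hK' : (K : ℝ) ≠ 0 := by positivity
  have h1 := average_f_le hD hK a
  have h2 := hD.sep_g.average_le hK ha
  have h3 := hD.sep_h.average_le hK hb
  simp only [Γ, Fr, Hr, Finset.sum_add_distrib, Finset.sum_sub_distrib, mul_add, mul_sub,
    mulA_smul, mulA_sum, real_inner_smul_left, real_inner_smul_right, sum_inner, inner_sum,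
    Finset.sum_const, Nat.card_Icc, add_tsub_cancel_right, nsmul_eq_mul]
  simp only [inv_mul_cancel_left₀ hK']
  linarith

/-- The extended real gap is the supremum of the real gaps. -/
lemma gap_le (hD : D.Assumptions) {Cx : Set (Blk d)} {Cy : Set (Blk e)} {a : Blk d} {b : Blk e}
    (ha : D.MemX a) (hb : D.MemY b) {R : ℝ}
    (h : ∀ u ∈ Cx, ∀ v ∈ Cy, D.MemX u → D.MemY v → D.Γ u v a b ≤ R) :
    D.gap Cx Cy a b ≤ (R : EReal) := by
  refine iSup₂_le fun u hu => iSup₂_le fun v hv => ?_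
  rw [hD.sep_g.coe a ha, hD.sep_h.coe b hb]
  by_cases hv' : D.MemY v
  · by_cases hu' : D.MemX u
    · rw [hD.sep_g.coe u hu', hD.sep_h.coe v hv']
      have := h u hu v hv hu' hv'
      simp only [Γ, Fr, Hr] at this
      norm_cast
      linarith
    -- A comparison point outside the domain contributes `⊥` to the supremum.
    · have : D.gSum u = ⊤ := by
        by_contra h1; exact hu' (hD.memX_iff.1 h1)
      simp [this]
  · have : D.hConj v = ⊤ := by
      by_contra h1; exact hv' (hD.memY_iff.1 h1)
    simp [this]

lemma continuous_mulA : Continuous D.mulA := by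
  unfold mulA; fun_prop

lemma continuous_mulAT : Continuous D.mulAT := by
  unfold mulAT; fun_prop

end Data

end

end PureCD

/-! ### The bound on the expected restricted gap -/

theorem theorem3 {n m : ℕ} {d : Fin n → ℕ} {e : Fin m → ℕ} (D : PureCD.Data d e)
    (hD : D.Assumptions) (hpar : D.Parameters)
    {Ω : Type*} [MeasurableSpace Ω] (μ : MeasureTheory.Measure Ω)
    [MeasureTheory.IsProbabilityMeasure μ]
    (ι : ℕ → Ω → Fin n) (hι : D.IsSampling μ ι)
    (x₀ : PureCD.Blk d) (y₀ : PureCD.Blk e)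
    (hx₀ : x₀ ∈ PureCD.dom D.gSum) (hy₀ : y₀ ∈ PureCD.dom D.hConj)
    (x xbar : ℕ → Ω → PureCD.Blk d) (y ybar yb : ℕ → Ω → PureCD.Blk e)
    (hrun : D.IsRun x₀ y₀ ι x xbar y ybar yb)
    (xs : PureCD.Blk d) (ys : PureCD.Blk e) (hs : D.IsSolution xs ys)
    (Cx : Set (PureCD.Blk d)) (Cy : Set (PureCD.Blk e))
    (hCx : Bornology.IsBounded Cx) (hCy : Bornology.IsBounded Cy)
    (K : ℕ) (hK : 1 ≤ K) :
    Measurable (fun ω => D.gap Cx Cy (PureCD.average x K ω) (PureCD.average yb K ω)) ∧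
    PureCD.expPos μ
        (fun ω => D.gap Cx Cy (PureCD.average x K ω) (PureCD.average yb K ω)) < ⊤ ∧
    PureCD.expectation μ
        (fun ω => D.gap Cx Cy (PureCD.average x K ω) (PureCD.average yb K ω))
      ≤ ((D.Cg x₀ xs y₀ ys Cx Cy / (D.pmin * K) : ℝ) : EReal) := by
  have hpath := hrun.isRandomPath hD hx₀ hy₀
  have hm := hpar.pmin_pos
  have hK0 : (0 : ℝ) < K := by positivity
  set S : ℝ := sSup ((fun q : PureCD.Blk d × PureCD.Blk e =>
      2 * D.pmin * PureCD.wsq (fun i => (D.τ i)⁻¹ * (D.p i)⁻¹) (x₀ - q.1)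
        + 2 * D.pmin * PureCD.wsq (fun j => (D.σ j)⁻¹ * (D.pr j)⁻¹) (y₀ - q.2)) '' (Cx ×ˢ Cy))
    with hS
  set SA : ℝ := sSup ((fun v => PureCD.wnorm (fun i => D.τ i * D.p i) (D.mulAT v)) '' Cy) with hSA
  set SX : ℝ := sSup ((fun u => PureCD.wnorm (fun j => D.σ j * D.pr j) (D.mulA u)) '' Cx) with hSX
  -- This covers empty sets too, where `sSup` takes its default value `0`.
  have hSA0 : 0 ≤ SA := Real.sSup_nonneg (by
    rintro _ ⟨v, -, rfl⟩; exact PureCD.wnorm_nonneg _ _)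
  have hSX0 : 0 ≤ SX := Real.sSup_nonneg (by
    rintro _ ⟨v, -, rfl⟩; exact PureCD.wnorm_nonneg _ _)
  have hS_le : ∀ u ∈ Cx, ∀ v ∈ Cy, 2 * D.pmin * PureCD.wsq D.wx (x₀ - u)
      + 2 * D.pmin * PureCD.wsq D.wy (y₀ - v) ≤ S := by
    intro u hu v hv
    refine le_csSup (PureCD.bddAbove_image_of_isBounded ?_ (hCx.prod hCy)) ⟨(u, v), ⟨hu, hv⟩, rfl⟩
    exact (((PureCD.continuous_wsq _).comp (by fun_prop)).const_mul _).add
      (((PureCD.continuous_wsq _).comp (by fun_prop)).const_mul _)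
  have hSA_le : ∀ v ∈ Cy, PureCD.wnorm (fun i => D.τ i * D.p i) (D.mulAT v) ≤ SA := by
    intro v hv
    refine le_csSup (PureCD.bddAbove_image_of_isBounded ?_ hCy) ⟨v, hv, rfl⟩
    exact Real.continuous_sqrt.comp ((PureCD.continuous_wsq _).comp PureCD.Data.continuous_mulAT)
  have hSX_le : ∀ u ∈ Cx, PureCD.wnorm (fun j => D.σ j * D.pr j) (D.mulA u) ≤ SX := by
    intro u hu
    refine le_csSup (PureCD.bddAbove_image_of_isBounded ?_ hCx) ⟨u, hu, rfl⟩
    exact Real.continuous_sqrt.comp ((PureCD.continuous_wsq _).comp PureCD.Data.continuous_mulA)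
  set R : Ω → ℝ := fun ω => D.pathBound xs ys S SA SX (fun k => x k ω) (fun k => xbar (k + 1) ω)
      (fun k => y k ω) (fun k => ybar (k + 1) ω) (fun k => yb k ω) K with hR
  have hxs : D.MemX xs := hD.memX_iff.1 hs.1.1
  have hys : D.MemY ys := hD.memY_iff.1 hs.2.1
  obtain ⟨hRint, hRle⟩ := hpath.integral_pathBound_le (S := S) hD hpar hι hs hSA0 hSX0
    (Δ := D.Δ₀ x₀ xs y₀ ys)
    (by rw [PureCD.Data.Δ₀, hD.F_eq (hD.memX_iff.1 hx₀), hD.F_eq hxs]) K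
  -- As `R` is free of the comparison point, it bounds the supremum for each outcome, before any
  -- expectation is taken.
  have hgap : ∀ ω, D.gap Cx Cy (PureCD.average x K ω) (PureCD.average yb K ω)
      ≤ (((D.pmin * K)⁻¹ * R ω : ℝ) : EReal) := by
    intro ω
    have hp := hpath.path ω
    have hxm := hp.memX_all hD
    have hzm := hp.memZ hD
    refine PureCD.Data.gap_le hD (hD.sep_g.average_mem hK hxm) (hD.sep_h.average_mem hK hzm) ?_
    intro u hu v hv hu' hv'
    refine (PureCD.Data.Γ_average_le hD hK u v hxm hzm).trans ?_
    have h1 := hp.sum_gap_le_pathBound hD hpar hs hu' hv'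
      (S := S) (SA := SA) (SX := SX)
      (by simpa only [hrun.x_zero, hrun.y_zero] using hS_le u hu v hv)
      (hSA_le v hv) (hSX_le u hu) K
    have h2 : (K : ℝ)⁻¹ * ∑ k ∈ Finset.Icc 1 K, D.Γ u v (x k ω) (yb k ω)
        = (D.pmin * K)⁻¹ * (D.pmin * ∑ k ∈ Finset.Icc 1 K, D.Γ u v (x k ω) (yb k ω)) := by
      field_simp
    rw [h2]
    exact mul_le_mul_of_nonneg_left h1 (by positivity)
  have hRint' : MeasureTheory.Integrable (fun ω => (D.pmin * K)⁻¹ * R ω) μ := hRint.const_mul _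
  refine ⟨?_, (PureCD.expPos_mono hgap).trans_lt (PureCD.expPos_coe_lt_top hRint'), ?_⟩
  -- The supremum may be uncountable, but the averages, and with them the gap, are functions of the
  -- first `K` draws.
  · have hdep : PureCD.DependsOnFirst ι K
        (fun ω => D.gap Cx Cy (PureCD.average x K ω) (PureCD.average yb K ω)) := by
      intro ω ω' h
      have h1 : ∀ k ∈ Finset.Icc 1 K, x k ω = x k ω' ∧ yb k ω = yb k ω' := by
        intro k hk
        have hk' := (Finset.mem_Icc.1 hk).2
        have := hpath.depends hD hpar k ω ω' fun l hl => h l (by omega)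
        simp only [Prod.mk.injEq] at this
        exact ⟨this.1, this.2.2.2.2⟩
      simp only [PureCD.average]
      rw [Finset.sum_congr rfl fun k hk => (h1 k hk).1,
        Finset.sum_congr rfl fun k hk => (h1 k hk).2]
    exact hdep.measurable hι.meas
  · refine (PureCD.expectation_mono hgap).trans ?_
    rw [PureCD.expectation_coe hRint', EReal.coe_le_coe_iff, MeasureTheory.integral_const_mul,
      div_eq_inv_mul]
    refine mul_le_mul_of_nonneg_left (hRle.trans ?_) (by positivity)
    -- The integrated bound has half of the `Aᵀ ys` term and no `A xs` term; the surplus in `Cg₂₃₄`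
    -- is nonnegative.
    have h1 : 0 ≤ D.pmin * PureCD.wnorm (fun j => D.σ j * (D.pr j)⁻¹) (D.mulA xs) :=
      mul_nonneg hm.le (PureCD.wnorm_nonneg _ _)
    have h2 : 0 ≤ PureCD.wsq (fun i => D.τ i * D.p i) (D.mulAT ys) :=
      PureCD.wsq_nonneg (fun i => (mul_pos (hpar.τ_pos i) (hpar.p_pos i)).le) _
    rw [PureCD.Data.Cg, PureCD.Data.Cg₁, PureCD.Data.Cg₂₃₄, ← hS, ← hSA, ← hSX,
      hD.F_eq (hD.memX_iff.1 hx₀), hD.F_eq hxs, hD.hConj_toReal (hD.memY_iff.1 hy₀),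
      hD.hConj_toReal hys]
    linarith
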